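/- **Theorem 2.1.** Let $j\ge 1$ be an integer and $m=2j+1$. Call $(h_0,\dots,h_{j-1})$ boundary data if each $h_\ell:\mathbb R\to\mathbb C$ is $C^\infty$ with support in $[0,2]$, and consider the reduced pure initial-boundary value problem $$\partial_t v+(-1)^{j+1}\partial_x^m v=0\quad(0<x<\infty,\ 0<t<2),\qquad v(x,0)=0,\qquad \partial_x^\ell v(0,t)=h_\ell(t)\quad(0<t<2,\ \ell=0,\dots,j-1).$$ Its solution is given by the Fokas formula $$S[0,h_0,\dots,h_{j-1};0](x,t)=\sum_{p=1}^{j}\sum_{\ell=0}^{j-1}C'_{p,\ell}\int_{\partial D_{2p}^+}e^{i\xi x+i\xi^m t}(i\xi)^{2j-\ell}\,\tilde h_\ell(\xi^m,2)\,d\xi,\qquad x>0,\ t\in\mathbb R,$$ where $\tilde h_\ell(z,2)=\int_0^2e^{-iz\tau}h_\ell(\tau)\,d\tau$, $D_{2p}^+=\{\xi:(2p-1)\pi/m<\arg\xi<2p\pi/m\}$ with its boundary traversed keeping the sector on the left, and, with $\alpha_{p,n}=e^{i[m-(2p+1)+2n]\pi/m}$, $$C'_{p,\ell}=\frac{(-1)^{j+1}}{2\pi}\Big(1-\sum_{n=1}^{j+1}\alpha_{p,n}^{2j-\ell}\prod_{r\ne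 n,\,1\le r\le j+1}\frac{1-\alpha_{p,r}}{\alpha_{p,n}-\alpha_{p,r}}\Big).$$ That is, for all boundary data, $v=S[0,h_0,\dots,h_{j-1};0]$ is a classical solution of this problem: it is differentiable in $t$, $m$ times continuously differentiable in $x$ and satisfies the equation for $x>0$, $0<t<2$; $v(x,0)=0=\lim_{t\to0^+}v(x,t)$ for $x>0$; and $\lim_{x\to0^+}\partial_x^\ell v(x,t)=h_\ell(t)$ for $0<t<2$, $\ell=0,\dots,j-1$. Moreover it satisfies the following estimates. *(Hadamard space estimate)* For every $s\ge0$ there is a constant $c_s$ (depending only on $j$ and $s$) such that for all boundary data $$\sup_{t\in\mathbb R}\|S[0,h_0,\dots,h_{j-1};0](\cdot,t)\|_{H^s_x(0,\infty)}\le c_s\sum_{\ell=0}^{j-1}\|h_\ell\|_{H_t^{(s+j-\ell)/m}(\mathbb R)}.$$ *(Bourgain space estimate)* For all real $s>-j-\frac12$, $0\le b<\frac12$ and $\frac12<\alpha\le\frac12+\frac1m\left(s+j+\frac12\right)$ there is a constant $c_{s,b,\alpha}$ (depending only on $j,s,b,\alpha$) such that for all boundary data $$\|S[0,h_0,\dots,h_{j-1};0]\|_{X^{s,b,\alpha}(\mathbb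 R^+\times(0,2))}\le c_{s,b,\alpha}\sum_{\ell=0}^{j-1}\|h_\ell\|_{H_t^{(s+j-\ell)/m}(\mathbb R)}.$$ Here $\|f\|_{H^\sigma(\mathbb R)}^2=\int_{\mathbb R}(1+|\xi|)^{2\sigma}|\widehat f(\xi)|^2d\xi$ with $\widehat f(\xi)=\int e^{-i\xi x}f(x)\,dx$; $$\|w\|_{X^{s,b,\alpha}(\mathbb R^2)}^2=\int_{\mathbb R^2}(1+|\xi|)^{2s}(1+|\tau-\xi^m|)^{2b}|\widehat w(\xi,\tau)|^2d\xi d\tau+\int_{\mathbb R}\int_{-1}^1(1+|\tau|)^{2\alpha}|\widehat w(\xi,\tau)|^2d\xi d\tau$$ with $\widehat w(\xi,\tau)=\int\int e^{-i(\xi x+\tau t)}w(x,t)\,dx\,dt$; these norms are finite only for tempered distributions whose Fourier transform is a measurable function. The norms in $H^s(0,\infty)$ and $X^{s,b,\alpha}(\mathbb R^+\times(0,2))$ are the restriction norms, i.e. the infimum of the $H^s(\mathbb R)$, respectively $X^{s,b,\alpha}(\mathbb R^2)$, norms of all extensions (agreeing as distributions on $(0,\infty)$, respectively on $(0,\infty)\times(0,2)$);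 in particular the estimates assert that an extension of finite norm exists. -/

import Mathlib

open MeasureTheory Set Filter Topology
open scoped ContDiff ENNReal NNReal

noncomputable section

namespace KdVm

/-! ### Boundary data and the Fokas solution formula -/

/-- The boundary data: `h_0, …, h_{j-1}` are smooth and supported in `[0,2]`. -/
def IsBoundaryData {j : ℕ} (h : Fin j → ℝ → ℂ) : Prop :=
  ∀ l, ContDiff ℝ ∞ (h l) ∧ tsupport (h l) ⊆ Icc 0 2

/-- The temporal transform over `[0,T]`, `∫_0^T e^{-izτ} g(τ) dτ`, at a complex frequency `z`. -/
def timeTransform (g : ℝ → ℂ) (T : ℝ) (z : ℂ) : ℂ :=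
  ∫ τ in (0 : ℝ)..T, Complex.exp (-(Complex.I * z * (τ : ℂ))) * g τ

/-- `e^{iπk/m}` with `m = 2j+1`. -/
def rot (j : ℕ) (k : ℤ) : ℂ :=
  Complex.exp (Complex.I * (Real.pi : ℂ) * (k : ℂ) / ((2 * j + 1 : ℕ) : ℂ))

/-- The rotation numbers `α_{p,n} = e^{i[m-(2p+1)+2n]π/m}`, `1 ≤ p ≤ j`, `1 ≤ n ≤ j+1`. -/
def alphaRot (j p n : ℕ) : ℂ :=
  rot j ((2 * j + 1 : ℤ) - (2 * p + 1) + 2 * n)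

/-- The constants `C'_{p,ℓ}` of the Fokas formula.  They come from solving, for fixed `p`, the
`(j+1) × (j+1)` Vandermonde system in the nodes `α_{p,1}, …, α_{p,j+1}` for the unknown boundary
values `(iξ)^k g̃_{2j-k}`, `0 ≤ k ≤ j`, and inserting them in
`(-1)^{j+1}/(2π) ∑_{k=0}^{2j} (iξ)^k g̃_{2j-k}`:  the sum over `n` is the value at `1` of the
Lagrange interpolation polynomial of `z ↦ z^{2j-ℓ}` in these nodes. -/
def fokasCoeff (j p l : ℕ) : ℂ :=
  (-1) ^ (j + 1) / (2 * (Real.pi : ℂ)) *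
    (1 - ∑ n ∈ Finset.Icc 1 (j + 1), alphaRot j p n ^ (2 * j - l) *
      ∏ r ∈ (Finset.Icc 1 (j + 1)).erase n,
        (1 - alphaRot j p r) / (alphaRot j p n - alphaRot j p r))

/-- The integral of `f` along the boundary of the sector
`D_{2p}^+ = {(2p-1)π/m < arg ξ < 2pπ/m}`, traversed with the sector on the left: outwards on the
ray of argument `(2p-1)π/m`, inwards on the ray of argument `2pπ/m`. -/
def sectorBoundaryIntegral (j p : ℕ) (f : ℂ → ℂ) : ℂ :=
  (∫ r in Ioi (0 : ℝ), f (rot j (2 * p - 1) * (r : ℂ)) * rot j (2 * p - 1)) -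
    ∫ r in Ioi (0 : ℝ), f (rot j (2 * p) * (r : ℂ)) * rot j (2 * p)

/-- The solution `S[0,h_0,…,h_{j-1};0](x,t)` of the reduced pure problem, given by the Fokas
formula
`∑_p ∑_ℓ C'_{p,ℓ} ∫_{∂D_{2p}^+} e^{iξx+iξ^m t} (iξ)^{2j-ℓ} h̃_ℓ(ξ^m,2) dξ`. -/
def reducedSolution {j : ℕ} (h : Fin j → ℝ → ℂ) (x t : ℝ) : ℂ :=
  ∑ p ∈ Finset.Icc 1 j, ∑ l : Fin j, fokasCoeff j p l *
    sectorBoundaryIntegral j p (fun ξ =>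
      Complex.exp (Complex.I * ξ * (x : ℂ) + Complex.I * ξ ^ (2 * j + 1) * (t : ℂ)) *
        (Complex.I * ξ) ^ (2 * j - (l : ℕ)) * timeTransform (h l) 2 (ξ ^ (2 * j + 1)))

/-- `v` is a classical solution of the reduced pure initial-boundary value problem
`∂_t v + (-1)^{j+1} ∂_x^{2j+1} v = 0` on `(0,∞) × (0,2)`, `v(x,0) = 0`,
`∂_x^ℓ v(0,t) = h_ℓ(t)` for `ℓ = 0, …, j-1`; the boundary values are attained as limits. -/
structure IsReducedSolution {j : ℕ} (h : Fin j → ℝ → ℂ) (v : ℝ → ℝ → ℂ) : Prop where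
  smooth_x : ∀ t ∈ Ioo (0 : ℝ) 2, ContDiffOn ℝ (2 * j + 1 : ℕ) (fun y => v y t) (Ioi 0)
  diff_t : ∀ x > 0, ∀ t ∈ Ioo (0 : ℝ) 2, DifferentiableAt ℝ (fun r => v x r) t
  eqn : ∀ x > 0, ∀ t ∈ Ioo (0 : ℝ) 2,
    deriv (fun r => v x r) t + (-1) ^ (j + 1) * iteratedDeriv (2 * j + 1) (fun y => v y t) x = 0
  initial : ∀ x > 0, v x 0 = 0 ∧ Tendsto (fun t => v x t) (𝓝[>] 0) (𝓝 0)
  boundary : ∀ l : Fin j, ∀ t ∈ Ioo (0 : ℝ) 2,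
    Tendsto (fun x => iteratedDeriv l (fun y => v y t) x) (𝓝[>] 0) (𝓝 (h l t))

/-! ### Sobolev norms on the line and on the half-line -/

/-- The Fourier transform `∫ e^{-iξt} f(t) dt`. -/
def lineFourier (f : ℝ → ℂ) (ξ : ℝ) : ℂ :=
  ∫ t : ℝ, Complex.exp (-(Complex.I * (ξ : ℂ) * (t : ℂ))) * f t

/-- The norm of `H^σ(ℝ)` in terms of the Fourier transform `W` of the element:
`(∫ (1+|ξ|)^{2σ} |W(ξ)|² dξ)^{1/2}`. -/
def sobolevFourierNorm (σ : ℝ) (W : ℝ → ℂ) : ℝ≥0∞ :=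
  (∫⁻ ξ : ℝ, ENNReal.ofReal ((1 + |ξ|) ^ (2 * σ)) * ‖W ξ‖ₑ ^ 2) ^ (1 / 2 : ℝ)

/-- The `H^σ(ℝ)` norm of an integrable function. -/
def sobolevNorm (σ : ℝ) (f : ℝ → ℂ) : ℝ≥0∞ :=
  sobolevFourierNorm σ (lineFourier f)

/-- The tempered distribution on `ℝ` with Fourier transform `W` coincides with `u` on the open set
`U`, as a distribution: it gives the same value as `u` on each test function `φ` supported in `U`,
the value being `(2π)⁻¹ ∫ W(ξ) (∫ e^{iξx} φ(x) dx) dξ`.  When some `sobolevFourierNorm σ W` is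
finite these integrals converge absolutely, and every element of `H^σ(ℝ)` arises so. -/
def AgreesOnLine (W : ℝ → ℂ) (u : ℝ → ℂ) (U : Set ℝ) : Prop :=
  ∀ φ : ℝ → ℂ, ContDiff ℝ ∞ φ → HasCompactSupport φ → tsupport φ ⊆ U →
    ∫ x : ℝ, u x * φ x = (2 * (Real.pi : ℂ))⁻¹ *
      ∫ ξ : ℝ, W ξ * ∫ x : ℝ, Complex.exp (Complex.I * (ξ : ℂ) * (x : ℂ)) * φ x

/-- The `H^s(0,∞)` norm: the infimum of the `H^s(ℝ)` norms of the extensions of `u` from `(0,∞)`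
to `ℝ` (`∞` if there is no extension in `H^s(ℝ)`). -/
def halfLineSobolevNorm (s : ℝ) (u : ℝ → ℂ) : ℝ≥0∞ :=
  ⨅ (W : ℝ → ℂ) (_ : AEStronglyMeasurable W volume) (_ : AgreesOnLine W u (Ioi 0)),
    sobolevFourierNorm s W

/-! ### Modified Bourgain spaces -/

/-- The norm of `X^{s,b,α}(ℝ²)`, for the symbol `ξ^m`, in terms of the space-time Fourier transform
`V(ξ,τ)` of the element. -/
def bourgainFourierNorm (m : ℕ) (s b α : ℝ) (V : ℝ × ℝ → ℂ) : ℝ≥0∞ :=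
  ((∫⁻ q : ℝ × ℝ, ENNReal.ofReal
      ((1 + |q.1|) ^ (2 * s) * (1 + |q.2 - q.1 ^ m|) ^ (2 * b)) * ‖V q‖ₑ ^ 2) +
    ∫⁻ q in Icc (-1 : ℝ) 1 ×ˢ (univ : Set ℝ),
      ENNReal.ofReal ((1 + |q.2|) ^ (2 * α)) * ‖V q‖ₑ ^ 2) ^ (1 / 2 : ℝ)

/-- The tempered distribution on `ℝ²` (variables `(x,t)`) with Fourier transform `V` (variables
`(ξ,τ)`) coincides with `u` on the open set `U`, as a distribution.  When some
`bourgainFourierNorm m s b α V` is finite these integrals converge absolutely, and every element of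
`X^{s,b,α}(ℝ²)` arises so. -/
def AgreesOnPlane (V : ℝ × ℝ → ℂ) (u : ℝ → ℝ → ℂ) (U : Set (ℝ × ℝ)) : Prop :=
  ∀ φ : ℝ × ℝ → ℂ, ContDiff ℝ ∞ φ → HasCompactSupport φ → tsupport φ ⊆ U →
    ∫ y : ℝ × ℝ, u y.1 y.2 * φ y = ((2 * (Real.pi : ℂ)) ^ 2)⁻¹ *
      ∫ q : ℝ × ℝ, V q * ∫ y : ℝ × ℝ,
        Complex.exp (Complex.I * ((q.1 : ℂ) * (y.1 : ℂ) + (q.2 : ℂ) * (y.2 : ℂ))) * φ y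

/-- The norm of the restriction space `X^{s,b,α}((0,∞) × (0,T))`: the infimum of the
`X^{s,b,α}(ℝ²)` norms of the extensions of `u` (`∞` if there is no extension in
`X^{s,b,α}(ℝ²)`). -/
def bourgainRestrictionNorm (m : ℕ) (s b α T : ℝ) (u : ℝ → ℝ → ℂ) : ℝ≥0∞ :=
  ⨅ (V : ℝ × ℝ → ℂ) (_ : AEStronglyMeasurable V volume)
    (_ : AgreesOnPlane V u (Ioi (0 : ℝ) ×ˢ Ioo 0 T)), bourgainFourierNorm m s b α V

end KdVm

end

noncomputable section

namespace KdVm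

/-! ### The rotation numbers -/

/-! On the boundary of `D_{2p}^+` the number `ξ^m` is real, so writing `ξ = ρ r` with `ρ^m = ε = ±1`
turns the Fokas formula into a finite combination of ray waves `∫_0^∞ e^{iρrx + iεr^m t} r^N ĝ(εr^m)
dr` with `Im ρ > 0`. Everything is proved for one ray wave and then summed, except the initial and
boundary values, where the rays must cooperate.

Classical solution. The transform of smooth compactly supported data decays rapidly, so one may
differentiate under the integral; each `x`-derivative brings down `iρr`, each `t`-derivative
`iεr^m`, and `(iρ)^m = (-1)^j iε` gives the equation. At `t = 0` each sector integral vanishes by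
Cauchy's theorem: inside the sector `Im ξ^m ≤ 0`, so the time transform is bounded, while `e^{iξx}`
decays (`sector_integral_eq`). As `x → 0` the wave loses its dependence on the direction `ρ`, and
the boundary values reduce to an algebraic identity for the constants (`sum_fokasCoeff_mul_rot_pow`)
followed by Fourier inversion in `λ = ±r^m` (`rayWave_zero_add`). The identity holds because the
nodes `α_{p,n}` are exactly the `m`-th roots of unity other than `ω^{q-p}`, `1 ≤ q ≤ j`, with `ω =
e^{2πi/m}`; hence the interpolation defects form, up to scaling, the inverse of a Vandermonde
matrix.

Estimates. For `x > 0`, `e^{iρx}` has Schwartz extensions whose transform `Φ` vanishes at `0` to any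
prescribed order (`exists_profile`). Dilating by `r` replaces `e^{iρrx}` by a superposition of
`e^{iξx}` with amplitude `r⁻¹Φ(ξ/r)`, concentrated at `|ξ| ~ r`, so weights in `ξ` become weights in
`r` (`rpow_mul_damp_pow_le`). In the Hadamard estimate the passage from `r` to `ξ` is bounded on
`L²` by Schur's test for a kernel homogeneous of degree `-1`. In the Bourgain estimate `τ = εr^m`
determines `r`, and one only integrates in `ξ` for fixed `r` (`IsProfile.plane_bound`). The
substitution `τ = ±r^m` then produces the `H^{(s+j-ℓ)/m}` norm of the data; the low frequencies left
over in the Bourgain case are controlled because the data live in `[0,2]`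
(`exists_lowFrequency_bound`). -/

lemma rot_eq_zpow (j : ℕ) (k : ℤ) : rot j k = rot j 1 ^ k := by
  unfold rot
  rw [← Complex.exp_int_mul]
  congr 1
  push_cast
  ring

lemma rot_one_ne_zero (j : ℕ) : rot j 1 ≠ 0 := Complex.exp_ne_zero _

lemma rot_add (j : ℕ) (k l : ℤ) : rot j (k + l) = rot j k * rot j l := by
  rw [rot_eq_zpow j (k + l), zpow_add₀ (rot_one_ne_zero j), ← rot_eq_zpow, ← rot_eq_zpow]

lemma rot_two_mul (j : ℕ) (k : ℤ) : rot j (2 * k) = rot j 2 ^ k := by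
  rw [rot_eq_zpow j (2 * k), zpow_mul, ← rot_eq_zpow]

lemma isPrimitiveRoot_rot_two (j : ℕ) : IsPrimitiveRoot (rot j 2) (2 * j + 1) := by
  have h := Complex.isPrimitiveRoot_exp (2 * j + 1) (by omega)
  convert h using 1
  unfold rot
  congr 1
  push_cast
  ring

lemma rot_one_pow (j : ℕ) : rot j 1 ^ (2 * j + 1) = -1 := by
  unfold rot
  rw [← Complex.exp_nat_mul, ← Complex.exp_pi_mul_I]
  congr 1
  have : ((2 * j + 1 : ℕ) : ℂ) ≠ 0 := Nat.cast_ne_zero.2 (by omega)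
  field_simp
  push_cast
  ring

lemma rot_pow (j : ℕ) (k : ℤ) : rot j k ^ (2 * j + 1) = (-1) ^ k := by
  rw [rot_eq_zpow, ← zpow_natCast, ← zpow_mul, mul_comm, zpow_mul, zpow_natCast, rot_one_pow]

lemma rot_eq_exp (j : ℕ) (k : ℤ) :
    rot j k = Complex.exp (((Real.pi * k / (2 * j + 1) : ℝ) : ℂ) * Complex.I) := by
  unfold rot
  congr 1
  push_cast
  ring

lemma rot_im_pos (j : ℕ) (k : ℤ) (h0 : 0 < k) (h1 : k < 2 * j + 1) : 0 < (rot j k).im := by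
  rw [rot_eq_exp, Complex.exp_ofReal_mul_I_im]
  have hk : (0 : ℝ) < k := by exact_mod_cast h0
  have hk' : (k : ℝ) < 2 * j + 1 := by exact_mod_cast h1
  apply Real.sin_pos_of_pos_of_lt_pi
  · have := Real.pi_pos
    positivity
  · rw [div_lt_iff₀ (by linarith)]
    exact mul_lt_mul_of_pos_left hk' Real.pi_pos

lemma alphaRot_eq (j p n : ℕ) : alphaRot j p n = rot j 2 ^ ((j : ℤ) - p + n) := by
  rw [← rot_two_mul]
  unfold alphaRot
  congr 1
  ring

/-! ### The Fokas constants -/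

/-- The value at `1` of the Lagrange basis polynomial of the node `α_{p,n}`. -/
def lagrangeWeight (j p n : ℕ) : ℂ :=
  ∏ r ∈ (Finset.Icc 1 (j + 1)).erase n,
    (1 - alphaRot j p r) / (alphaRot j p n - alphaRot j p r)

/-- The defect at `1` of the Lagrange interpolation of `z ↦ z^N`. -/
def lagrangeDefect (j p N : ℕ) : ℂ :=
  1 - ∑ n ∈ Finset.Icc 1 (j + 1), alphaRot j p n ^ N * lagrangeWeight j p n

lemma fokasCoeff_eq (j p l : ℕ) :
    fokasCoeff j p l = (-1) ^ (j + 1) / (2 * (Real.pi : ℂ)) * lagrangeDefect j p (2 * j - l) :=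
  rfl

lemma rot_two_ne_zero (j : ℕ) : rot j 2 ≠ 0 := Complex.exp_ne_zero _

lemma alphaRot_injOn (j p : ℕ) : Set.InjOn (alphaRot j p) (Finset.Icc 1 (j + 1) : Finset ℕ) := by
  intro a ha b hb hab
  simp only [Finset.coe_Icc, Set.mem_Icc] at ha hb
  rw [alphaRot_eq, alphaRot_eq] at hab
  have h1 : rot j 2 ^ (((j : ℤ) - p + a) - ((j : ℤ) - p + b)) = 1 := by
    rw [zpow_sub₀ (rot_two_ne_zero j), hab]
    exact div_self (zpow_ne_zero _ (rot_two_ne_zero j))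
  rw [(isPrimitiveRoot_rot_two j).zpow_eq_one_iff_dvd] at h1
  obtain ⟨c, hc⟩ := h1
  push_cast at hc
  rcases lt_trichotomy c 0 with h | h | h
  · nlinarith
  · subst h; omega
  · nlinarith

/-- Interpolation at `j+1` distinct nodes is exact on polynomials of degree at most `j`. -/
lemma lagrangeDefect_eq_zero (j p N : ℕ) (hN : N ≤ j) : lagrangeDefect j p N = 0 := by
  have h := Lagrange.eq_interpolate (f := (Polynomial.X ^ N : Polynomial ℂ))
    (alphaRot_injOn j p) (by
      rw [Polynomial.degree_X_pow, Nat.card_Icc]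
      exact_mod_cast (by omega))
  have h2 := congrArg (Polynomial.eval 1) h
  simp only [Polynomial.eval_pow, Polynomial.eval_X, one_pow, Lagrange.interpolate_apply,
    Polynomial.eval_finsetSum, Polynomial.eval_mul, Polynomial.eval_C, Lagrange.basis,
    Polynomial.eval_prod, Lagrange.basisDivisor, Polynomial.eval_sub] at h2
  unfold lagrangeDefect lagrangeWeight
  rw [sub_eq_zero]
  refine h2.trans ?_
  refine Finset.sum_congr rfl fun n _ => ?_
  congr 1
  refine Finset.prod_congr rfl fun r _ => ?_
  rw [div_eq_inv_mul]

lemma geom_sum_rootOfUnity {m : ℕ} {z : ℂ} (hz : z ^ m = 1) :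
    ∑ N ∈ Finset.range m, z ^ N = if z = 1 then (m : ℂ) else 0 := by
  split_ifs with h
  · simp [h]
  · rw [geom_sum_eq h, hz, sub_self, zero_div]

/-- A discrete Fourier transform in disguise. The terms `j ≤ l ≤ 2j` vanish, so the sum may run over
all residues modulo `m`; then every power of a root of unity sums to `m` or to `0`. -/
lemma sum_lagrangeDefect_mul_pow (j p : ℕ) {y : ℂ} (hy : y ^ (2 * j + 1) = 1) :
    ∑ l ∈ Finset.range j, lagrangeDefect j p (2 * j - l) * y ^ l =
      y ^ (2 * j) * ((if y = 1 then ((2 * j + 1 : ℕ) : ℂ) else 0) -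
        ∑ n ∈ Finset.Icc 1 (j + 1), lagrangeWeight j p n *
          if alphaRot j p n = y then ((2 * j + 1 : ℕ) : ℂ) else 0) := by
  have hy0 : y ≠ 0 := by rintro rfl; simp at hy
  have hyi : (y⁻¹) ^ (2 * j + 1) = 1 := by rw [inv_pow, hy, inv_one]
  have e1 : ∑ l ∈ Finset.range j, lagrangeDefect j p (2 * j - l) * y ^ l =
      ∑ l ∈ Finset.range (2 * j + 1), lagrangeDefect j p (2 * j - l) * y ^ l := by
    refine Finset.sum_subset (Finset.range_mono (by omega)) fun l hl hl' => ?_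
    simp only [Finset.mem_range] at hl hl'
    rw [lagrangeDefect_eq_zero _ _ _ (by omega), zero_mul]
  have e2 : ∑ l ∈ Finset.range (2 * j + 1), lagrangeDefect j p (2 * j - l) * y ^ l =
      ∑ N ∈ Finset.range (2 * j + 1), lagrangeDefect j p N * (y ^ (2 * j) * y⁻¹ ^ N) := by
    rw [← Finset.sum_range_reflect]
    refine Finset.sum_congr rfl fun N hN => ?_
    simp only [Finset.mem_range] at hN
    rw [show 2 * j - (2 * j + 1 - 1 - N) = N by omega,
      show 2 * j + 1 - 1 - N = 2 * j - N by omega, pow_sub₀ y hy0 (by omega), inv_pow]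
  have e3 : ∀ n, ∑ N ∈ Finset.range (2 * j + 1), (alphaRot j p n * y⁻¹) ^ N =
      if alphaRot j p n = y then ((2 * j + 1 : ℕ) : ℂ) else 0 := by
    intro n
    have ha : alphaRot j p n ^ (2 * j + 1) = 1 := by
      rw [alphaRot_eq, ← zpow_natCast, ← zpow_mul, mul_comm, zpow_mul, zpow_natCast,
        (isPrimitiveRoot_rot_two j).pow_eq_one, one_zpow]
    rw [geom_sum_rootOfUnity (by rw [mul_pow, ha, hyi, one_mul])]
    have : alphaRot j p n * y⁻¹ = 1 ↔ alphaRot j p n = y := mul_inv_eq_one₀ hy0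
    simp only [this]
  have e4 : ∑ N ∈ Finset.range (2 * j + 1), y⁻¹ ^ N =
      if y = 1 then ((2 * j + 1 : ℕ) : ℂ) else 0 := by
    rw [geom_sum_rootOfUnity hyi]
    simp only [inv_eq_one]
  rw [e1, e2, ← e4]
  simp only [← e3]
  simp only [lagrangeDefect, sub_mul, one_mul, Finset.sum_sub_distrib, mul_sub, Finset.mul_sum,
    Finset.sum_mul]
  congr 1
  rw [Finset.sum_comm]
  refine Finset.sum_congr rfl fun n _ => Finset.sum_congr rfl fun N _ => ?_
  rw [mul_pow]
  ring

lemma rot_two_zpow_eq_one_iff (j : ℕ) (a : ℤ) (h1 : -(2 * j + 1) < a) (h2 : a < 2 * j + 1) :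
    rot j 2 ^ a = 1 ↔ a = 0 := by
  rw [(isPrimitiveRoot_rot_two j).zpow_eq_one_iff_dvd]
  constructor
  · rintro ⟨c, hc⟩
    push_cast at hc
    rcases lt_trichotomy c 0 with h | h | h
    · nlinarith
    · subst h; omega
    · nlinarith
  · rintro rfl; exact dvd_zero _

/-- The exponents of the nodes, `j-p+1, …, 2j+1-p`, and the exponents `1-p, …, j-p` of the points
tested here partition the residues modulo `m`. So no node is hit, and only the point `1`, that is `q
= p`, contributes. -/
lemma sum_lagrangeDefect_mul_zpow (j p q : ℕ) (hp : p ∈ Finset.Icc 1 j)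
    (hq : q ∈ Finset.Icc 1 j) :
    ∑ l ∈ Finset.range j, lagrangeDefect j p (2 * j - l) * (rot j 2 ^ ((q : ℤ) - p)) ^ l =
      if p = q then ((2 * j + 1 : ℕ) : ℂ) else 0 := by
  simp only [Finset.mem_Icc] at hp hq
  have hw := rot_two_ne_zero j
  rw [sum_lagrangeDefect_mul_pow]
  swap
  · rw [← zpow_natCast, ← zpow_mul, mul_comm, zpow_mul, zpow_natCast,
      (isPrimitiveRoot_rot_two j).pow_eq_one, one_zpow]
  have h1 : ∑ n ∈ Finset.Icc 1 (j + 1), lagrangeWeight j p n *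
      (if alphaRot j p n = rot j 2 ^ ((q : ℤ) - p) then ((2 * j + 1 : ℕ) : ℂ) else 0) = 0 := by
    refine Finset.sum_eq_zero fun n hn => ?_
    simp only [Finset.mem_Icc] at hn
    rw [if_neg, mul_zero]
    intro h
    rw [alphaRot_eq] at h
    have h3 : rot j 2 ^ (((j : ℤ) - p + n) - ((q : ℤ) - p)) = 1 := by
      rw [zpow_sub₀ hw, h]
      exact div_self (zpow_ne_zero _ hw)
    rw [rot_two_zpow_eq_one_iff _ _ (by omega) (by omega)] at h3
    omega
  rw [h1, sub_zero]
  by_cases hpq : p = q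
  · subst hpq
    simp
  · rw [if_neg hpq, if_neg, mul_zero]
    rw [rot_two_zpow_eq_one_iff _ _ (by omega) (by omega)]
    omega

lemma sum_zpow_mul_lagrangeDefect (j : ℕ) (k l : Fin j) :
    ∑ p ∈ Finset.Icc 1 j, lagrangeDefect j p (2 * j - l) * rot j 2 ^ ((p : ℤ) * ((k : ℤ) - l)) =
      if k = l then ((2 * j + 1 : ℕ) : ℂ) else 0 := by
  have hw := rot_two_ne_zero j
  have hm : ((2 * j + 1 : ℕ) : ℂ) ≠ 0 := Nat.cast_ne_zero.2 (by omega)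
  let X : Matrix (Fin j) (Fin j) ℂ := fun p l =>
    lagrangeDefect j (p + 1) (2 * j - l) * rot j 2 ^ (-((p : ℤ) + 1) * l) / ((2 * j + 1 : ℕ) : ℂ)
  let Y : Matrix (Fin j) (Fin j) ℂ := fun l q => rot j 2 ^ (((q : ℤ) + 1) * l)
  have hXY : X * Y = 1 := by
    ext p q
    rw [Matrix.mul_apply]
    have h := sum_lagrangeDefect_mul_zpow j (p + 1) (q + 1) (by simp) (by simp)
    rw [Finset.sum_range] at h
    have h2 : ∑ l, X p l * Y l q = (∑ l : Fin j, lagrangeDefect j (p + 1) (2 * j - l) *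
        (rot j 2 ^ (((q + 1 : ℕ) : ℤ) - (p + 1 : ℕ))) ^ (l : ℕ)) / ((2 * j + 1 : ℕ) : ℂ) := by
      rw [Finset.sum_div]
      refine Finset.sum_congr rfl fun l _ => ?_
      simp only [X, Y]
      rw [← zpow_natCast, ← zpow_mul, div_mul_eq_mul_div, mul_assoc, ← zpow_add₀ hw]
      congr 3
      push_cast
      ring
    rw [h2, h, Matrix.one_apply]
    by_cases hpq : p = q
    · subst hpq
      simp only [if_true]
      exact div_self hm
    · rw [if_neg hpq, if_neg, zero_div]
      intro h'
      exact hpq (Fin.ext (by omega))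
  -- A one-sided inverse of a square matrix is two-sided: orthogonality summed over `l` becomes
  -- orthogonality summed over `p`, which is what the boundary values need.
  have hYX : Y * X = 1 := mul_eq_one_comm.1 hXY
  have h := congrFun (congrFun hYX k) l
  rw [Matrix.mul_apply, Matrix.one_apply] at h
  have h2 : ∑ p ∈ Finset.Icc 1 j,
      lagrangeDefect j p (2 * j - l) * rot j 2 ^ ((p : ℤ) * ((k : ℤ) - l)) =
      (∑ i, Y k i * X i l) * ((2 * j + 1 : ℕ) : ℂ) := by
    rw [Finset.sum_mul, ← Finset.Ico_add_one_right_eq_Icc, Finset.sum_Ico_eq_sum_range,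
      Finset.sum_range]
    refine Finset.sum_congr rfl fun p _ => ?_
    simp only [X, Y]
    rw [mul_assoc, div_mul_cancel₀ _ hm, mul_left_comm, ← zpow_add₀ hw, Nat.add_comm 1]
    congr 2
    push_cast
    ring
  rw [h2, h]
  split_ifs <;> simp

/-- The coefficient of the datum `h_l` in the `k`-th boundary derivative: differentiating `k` times
and the line element `dξ` raise the power of the direction from `2j-l` to `2j-l+k+1`, which is `k-l`
modulo `m`. -/
lemma sum_fokasCoeff_mul_rot_pow (j : ℕ) (k l : Fin j) :
    ∑ p ∈ Finset.Icc 1 j, fokasCoeff j p l * rot j (2 * p) ^ (2 * j - (l : ℕ) + k + 1) =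
      if k = l then (-1) ^ (j + 1) / (2 * (Real.pi : ℂ)) * ((2 * j + 1 : ℕ) : ℂ) else 0 := by
  have hw := rot_two_ne_zero j
  have h := congrArg (fun z => (-1) ^ (j + 1) / (2 * (Real.pi : ℂ)) * z)
    (sum_zpow_mul_lagrangeDefect j k l)
  simp only [mul_ite, mul_zero] at h
  rw [← h, Finset.mul_sum]
  refine Finset.sum_congr rfl fun p _ => ?_
  rw [fokasCoeff_eq, mul_assoc]
  congr 2
  have hl := l.2
  rw [rot_two_mul, ← zpow_natCast, ← zpow_mul]
  have e : (p : ℤ) * ((2 * j - (l : ℕ) + k + 1 : ℕ) : ℤ) =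
      ((2 * j + 1 : ℕ) : ℤ) * p + p * ((k : ℤ) - l) := by
    rw [Nat.cast_add, Nat.cast_add, Nat.cast_sub (by omega)]
    push_cast
    ring
  rw [e, zpow_add₀ hw, zpow_mul, zpow_natCast (rot j 2) (2 * j + 1),
    (isPrimitiveRoot_rot_two j).pow_eq_one, one_zpow, one_mul]

section FourierTransforms

/-! ### The Fourier transform on the line -/

open scoped FourierTransform SchwartzMap

lemma lineFourier_eq_fourier (f : ℝ → ℂ) (ξ : ℝ) :
    lineFourier f ξ = 𝓕 f (ξ / (2 * Real.pi)) := by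
  rw [Real.fourier_real_eq_integral_exp_smul]
  unfold lineFourier
  congr 1
  ext t
  rw [smul_eq_mul]
  congr 2
  have : (Real.pi : ℂ) ≠ 0 := by exact_mod_cast Real.pi_ne_zero
  push_cast
  field_simp

lemma continuous_lineFourier (f : 𝓢(ℝ, ℂ)) : Continuous (lineFourier f) := by
  have : lineFourier f = fun ξ => (𝓕 f : 𝓢(ℝ, ℂ)) (ξ / (2 * Real.pi)) := by
    ext ξ
    rw [lineFourier_eq_fourier, SchwartzMap.fourier_coe]
  rw [this]
  exact (𝓕 f : 𝓢(ℝ, ℂ)).continuous.comp (by fun_prop)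

lemma schwartz_decay (f : 𝓢(ℝ, ℂ)) (N : ℕ) :
    ∃ C, 0 < C ∧ ∀ x, ‖f x‖ * (1 + |x|) ^ N ≤ C := by
  refine ⟨2 ^ N * ((Finset.Iic (N, 0)).sup fun m => SchwartzMap.seminorm ℝ m.1 m.2) f + 1,
    by positivity, fun x => ?_⟩
  have h := SchwartzMap.one_add_le_sup_seminorm_apply (𝕜 := ℝ) (m := (N, 0)) le_rfl le_rfl f x
  rw [norm_iteratedFDeriv_zero, Real.norm_eq_abs, mul_comm] at h
  exact h.trans (le_add_of_nonneg_right zero_le_one)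

lemma lineFourier_decay (f : 𝓢(ℝ, ℂ)) (N : ℕ) :
    ∃ C, 0 < C ∧ ∀ ξ, ‖lineFourier f ξ‖ * (1 + |ξ|) ^ N ≤ C := by
  obtain ⟨C, hC, h⟩ := schwartz_decay (𝓕 f) N
  refine ⟨(2 * Real.pi) ^ N * C, by positivity, fun ξ => ?_⟩
  rw [lineFourier_eq_fourier, ← SchwartzMap.fourier_coe]
  have hpi : 1 ≤ 2 * Real.pi := by linarith [Real.pi_gt_three]
  have h1 : 1 + |ξ| ≤ 2 * Real.pi * (1 + |ξ / (2 * Real.pi)|) := by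
    rw [abs_div, abs_of_pos (by positivity : 0 < 2 * Real.pi), mul_add, mul_div_cancel₀]
    · linarith
    · positivity
  calc _ ≤ ‖(𝓕 f) (ξ / (2 * Real.pi))‖ * (2 * Real.pi * (1 + |ξ / (2 * Real.pi)|)) ^ N := by
        gcongr
    _ = (2 * Real.pi) ^ N * (‖(𝓕 f) (ξ / (2 * Real.pi))‖ * (1 + |ξ / (2 * Real.pi)|) ^ N) := by
        rw [mul_pow]; ring
    _ ≤ _ := by gcongr; exact h _

lemma integral_exp_mul_lineFourier (f : 𝓢(ℝ, ℂ)) (x : ℝ) :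
    ∫ ξ : ℝ, Complex.exp (Complex.I * ξ * x) * lineFourier f ξ = 2 * (Real.pi : ℂ) * f x := by
  have h := congrFun (f.continuous.fourierInv_fourier_eq f.integrable
    (by rw [← SchwartzMap.fourier_coe]; exact (𝓕 f).integrable)) x
  rw [← h, Real.fourierInv_eq']
  have h2 := MeasureTheory.Measure.integral_comp_div (fun v : ℝ =>
    Complex.exp (↑(2 * Real.pi * inner ℝ v x) * Complex.I) • 𝓕 (f : ℝ → ℂ) v) (2 * Real.pi)
  rw [abs_of_pos (by positivity), Complex.real_smul] at h2
  push_cast at h2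
  push_cast
  rw [← h2]
  congr 1
  ext ξ
  rw [lineFourier_eq_fourier, smul_eq_mul]
  congr 2
  have : (Real.pi : ℂ) ≠ 0 := by exact_mod_cast Real.pi_ne_zero
  simp only [RCLike.inner_apply, conj_trivial]
  push_cast
  field_simp

lemma lineFourier_derivCLM (f : 𝓢(ℝ, ℂ)) (ξ : ℝ) :
    lineFourier (SchwartzMap.derivCLM ℂ ℂ f) ξ = Complex.I * ξ * lineFourier f ξ := by
  have e : (SchwartzMap.derivCLM ℂ ℂ f : ℝ → ℂ) = deriv f := by
    ext x; exact SchwartzMap.derivCLM_apply ℂ f x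
  rw [lineFourier_eq_fourier, lineFourier_eq_fourier, e, Real.fourier_deriv f.integrable
    f.differentiable (by rw [← e]; exact (SchwartzMap.derivCLM ℂ ℂ f).integrable)]
  have : (Real.pi : ℂ) ≠ 0 := by exact_mod_cast Real.pi_ne_zero
  simp only [smul_eq_mul]
  push_cast
  field_simp

lemma lineFourier_const_smul (c : ℂ) (f : 𝓢(ℝ, ℂ)) (ξ : ℝ) :
    lineFourier (c • f : 𝓢(ℝ, ℂ)) ξ = c * lineFourier f ξ := by
  unfold lineFourier
  rw [← integral_const_mul]
  congr 1
  ext t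
  rw [_root_.smul_apply, smul_eq_mul]
  ring

/-! ### Schwartz extensions of decaying exponentials -/

/-- A smooth function vanishing on `(-∞,-1)` and equal to a multiple of `e^{iρx}` on `(0,∞)`. -/
structure IsExpTail (ρ : ℂ) (f : ℝ → ℂ) : Prop where
  smooth : ContDiff ℝ ∞ f
  left : ∀ x < -1, f x = 0
  right : ∃ c : ℂ, ∀ x > 0, f x = c * Complex.exp (Complex.I * ρ * x)

lemma hasDerivAt_cexp_mul (c ρ : ℂ) (x : ℝ) :
    HasDerivAt (fun x : ℝ => c * Complex.exp (Complex.I * ρ * x))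
      (c * (Complex.I * ρ) * Complex.exp (Complex.I * ρ * x)) x := by
  have h : HasDerivAt (fun x : ℝ => Complex.I * ρ * (x : ℂ)) (Complex.I * ρ) x := by
    simpa using (Complex.ofRealCLM.hasDerivAt (x := x)).const_mul (Complex.I * ρ)
  exact (h.cexp.const_mul c).congr_deriv (by ring)

lemma IsExpTail.deriv {ρ : ℂ} {f : ℝ → ℂ} (hf : IsExpTail ρ f) : IsExpTail ρ (deriv f) := by
  refine ⟨(contDiff_infty_iff_deriv.1 hf.smooth).2, fun x hx => ?_, ?_⟩
  · have : f =ᶠ[𝓝 x] fun _ => 0 := by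
      filter_upwards [Iio_mem_nhds hx] with y hy using hf.left y hy
    rw [this.deriv_eq, deriv_const]
  · obtain ⟨c, hc⟩ := hf.right
    refine ⟨c * (Complex.I * ρ), fun x hx => ?_⟩
    have : f =ᶠ[𝓝 x] fun x : ℝ => c * Complex.exp (Complex.I * ρ * x) := by
      filter_upwards [Ioi_mem_nhds hx] with y hy using hc y hy
    rw [this.deriv_eq, (hasDerivAt_cexp_mul c ρ x).deriv]

lemma norm_cexp_I_mul (ρ : ℂ) (x : ℝ) :
    ‖Complex.exp (Complex.I * ρ * x)‖ = Real.exp (-(ρ.im * x)) := by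
  rw [Complex.norm_exp]
  congr 1
  simp

lemma IsExpTail.bounded {ρ : ℂ} (hρ : 0 < ρ.im) {f : ℝ → ℂ} (hf : IsExpTail ρ f) (k : ℕ) :
    ∃ C, ∀ x, |x| ^ k * ‖f x‖ ≤ C := by
  obtain ⟨c, hc⟩ := hf.right
  obtain ⟨B, hB⟩ := (isCompact_Icc (a := (-1 : ℝ)) (b := 0)).exists_bound_of_continuousOn
    (f := fun x => (|x| : ℝ) ^ k * ‖f x‖) (by
      have := hf.smooth.continuous
      fun_prop)
  have hB' : 0 ≤ B := (norm_nonneg _).trans (hB 0 (by simp))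
  refine ⟨B + ‖c‖ * (k.factorial / ρ.im ^ k), fun x => ?_⟩
  have hpos : 0 ≤ ‖c‖ * (k.factorial / ρ.im ^ k) := by positivity
  rcases lt_or_ge x (-1) with h | h
  · rw [hf.left x h]
    simp only [norm_zero, mul_zero]
    positivity
  rcases le_or_gt x 0 with h0 | h0
  · have := hB x ⟨h, h0⟩
    rw [Real.norm_of_nonneg (by positivity)] at this
    linarith
  · rw [hc x h0, norm_mul, norm_cexp_I_mul, abs_of_pos h0]
    -- One term of the exponential series bounds `x^k e^{-x Im ρ}` by `k!/(Im ρ)^k`.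
    have h1 := Real.pow_div_factorial_le_exp (ρ.im * x) (by positivity) k
    have h2 : x ^ k * Real.exp (-(ρ.im * x)) ≤ k.factorial / ρ.im ^ k := by
      rw [Real.exp_neg, ← div_eq_mul_inv, div_le_div_iff₀ (Real.exp_pos _) (by positivity)]
      rw [div_le_iff₀ (by positivity), mul_pow] at h1
      linarith
    calc _ = ‖c‖ * (x ^ k * Real.exp (-(ρ.im * x))) := by ring
      _ ≤ ‖c‖ * (k.factorial / ρ.im ^ k) := by gcongr
      _ ≤ _ := by linarith

lemma IsExpTail.iteratedDeriv {ρ : ℂ} {f : ℝ → ℂ} (hf : IsExpTail ρ f) (n : ℕ) :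
    IsExpTail ρ (iteratedDeriv n f) := by
  induction n with
  | zero => simpa using hf
  | succ n ih => rw [iteratedDeriv_succ]; exact ih.deriv

lemma exists_schwartz_eq_exp {ρ : ℂ} (hρ : 0 < ρ.im) :
    ∃ f : 𝓢(ℝ, ℂ), ∀ x > 0, f x = Complex.exp (Complex.I * ρ * x) := by
  let f : ℝ → ℂ := fun x => (Real.smoothTransition (x + 1) : ℂ) * Complex.exp (Complex.I * ρ * x)
  have hf : IsExpTail ρ f := by
    refine ⟨?_, fun x hx => ?_, 1, fun x hx => ?_⟩
    · refine ContDiff.mul (Complex.ofRealCLM.contDiff.comp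
        (Real.smoothTransition.contDiff.comp (by fun_prop))) ?_
      exact (contDiff_const.mul Complex.ofRealCLM.contDiff).cexp
    · simp only [f]
      rw [Real.smoothTransition.zero_of_nonpos (by linarith)]
      simp
    · simp only [f]
      rw [Real.smoothTransition.one_of_one_le (by linarith)]
      simp
  refine ⟨⟨f, hf.smooth, fun k n => ?_⟩, fun x hx => ?_⟩
  · obtain ⟨C, hC⟩ := (hf.iteratedDeriv n).bounded hρ k
    refine ⟨C, fun x => ?_⟩
    rw [norm_iteratedFDeriv_eq_norm_iteratedDeriv, Real.norm_eq_abs]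
    exact hC x
  · change f x = _
    simp only [f]
    rw [Real.smoothTransition.one_of_one_le (by linarith)]
    simp

/-- The operator `(iρ)⁻¹ d/dx` fixes `e^{iρx}` on the half-line and multiplies the transform by
`ξ/ρ`. Iterating it keeps the extension property and adds zeros at the origin. -/
lemma exists_schwartz_eq_exp_vanishing {ρ : ℂ} (hρ : 0 < ρ.im) (M : ℕ) :
    ∃ f f₀ : 𝓢(ℝ, ℂ), (∀ x > 0, f x = Complex.exp (Complex.I * ρ * x)) ∧
      ∀ ξ : ℝ, lineFourier f ξ = ((ξ : ℂ) / ρ) ^ M * lineFourier f₀ ξ := by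
  have hρ0 : ρ ≠ 0 := by rintro rfl; simp at hρ
  induction M with
  | zero =>
    obtain ⟨f, hf⟩ := exists_schwartz_eq_exp hρ
    exact ⟨f, f, hf, fun ξ => by simp⟩
  | succ M ih =>
    obtain ⟨f, f₀, hf, hf₀⟩ := ih
    refine ⟨(Complex.I * ρ)⁻¹ • SchwartzMap.derivCLM ℂ ℂ f, f₀, fun x hx => ?_, fun ξ => ?_⟩
    · rw [_root_.smul_apply, SchwartzMap.derivCLM_apply]
      have : f =ᶠ[𝓝 x] fun x : ℝ => 1 * Complex.exp (Complex.I * ρ * x) := by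
        filter_upwards [Ioi_mem_nhds hx] with y hy
        rw [hf y hy, one_mul]
      rw [this.deriv_eq, (hasDerivAt_cexp_mul 1 ρ x).deriv, smul_eq_mul, one_mul,
        inv_mul_cancel_left₀ (mul_ne_zero Complex.I_ne_zero hρ0)]
    · rw [lineFourier_const_smul, lineFourier_derivCLM, hf₀, pow_succ]
      have := Complex.I_ne_zero
      field_simp

/-- The Fourier transform of an extension of `e^{iρx}` from the half-line which vanishes to high
order at zero and decays fast at infinity. -/
lemma exists_profile {ρ : ℂ} (hρ : 0 < ρ.im) (K : ℕ) :
    ∃ Φ : ℝ → ℂ, Continuous Φ ∧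
      (∃ C, 0 < C ∧ ∀ η, ‖Φ η‖ ≤ C * (|η| ^ K / (1 + |η|) ^ (2 * K + 2))) ∧
      ∀ x : ℝ, x > 0 → ∫ η : ℝ, Complex.exp (Complex.I * η * x) * Φ η =
        2 * (Real.pi : ℂ) * Complex.exp (Complex.I * ρ * x) := by
  obtain ⟨f, f₀, hf, hf₀⟩ := exists_schwartz_eq_exp_vanishing hρ K
  obtain ⟨C, hC, hdec⟩ := lineFourier_decay f₀ (2 * K + 2)
  have hρ0 : ρ ≠ 0 := by rintro rfl; simp at hρ
  -- The decay order `2K+2` makes the bound equal to `(|η|/(1+|η|)²)^K (1+|η|)⁻²`: `K` factors to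
  -- spend on weights and an integrable remainder.
  have hn : 0 < ‖ρ‖ := norm_pos_iff.2 hρ0
  refine ⟨lineFourier f, continuous_lineFourier f, ⟨(‖ρ‖ ^ K)⁻¹ * C, by positivity, fun η => ?_⟩,
    fun x hx => ?_⟩
  · rw [hf₀, norm_mul, norm_pow, norm_div, Complex.norm_real, Real.norm_eq_abs, div_pow]
    have h1 : ‖lineFourier f₀ η‖ ≤ C / (1 + |η|) ^ (2 * K + 2) := by
      rw [le_div_iff₀ (by positivity)]
      exact hdec η
    calc _ ≤ |η| ^ K / ‖ρ‖ ^ K * (C / (1 + |η|) ^ (2 * K + 2)) := by gcongr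
      _ = _ := by field_simp
  · rw [integral_exp_mul_lineFourier, hf x hx]

/-! ### Smooth functions supported in `[0,2]` -/

lemma hasCompactSupport_of_data {g : ℝ → ℂ} (hs : tsupport g ⊆ Icc 0 2) : HasCompactSupport g :=
  isCompact_Icc.of_isClosed_subset (isClosed_tsupport g) hs

lemma exists_schwartz_of_data {g : ℝ → ℂ} (hg : ContDiff ℝ ∞ g) (hs : tsupport g ⊆ Icc 0 2) :
    ∃ f : 𝓢(ℝ, ℂ), (f : ℝ → ℂ) = g :=
  ⟨(hasCompactSupport_of_data hs).toSchwartzMap hg, by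
    ext x; exact HasCompactSupport.toSchwartzMap_toFun _ _ x⟩

lemma timeTransform_ofReal {g : ℝ → ℂ} (hs : tsupport g ⊆ Icc 0 2) (τ : ℝ) :
    timeTransform g 2 τ = lineFourier g τ := by
  unfold timeTransform lineFourier
  rw [intervalIntegral.integral_of_le (by norm_num), ← integral_Icc_eq_integral_Ioc]
  refine setIntegral_eq_integral_of_forall_compl_eq_zero fun x hx => ?_
  rw [image_eq_zero_of_notMem_tsupport (fun h => hx (hs h)), mul_zero]

lemma exists_cutoff : ∃ χ : 𝓢(ℝ, ℂ), ∀ t ∈ Icc (0 : ℝ) 2, χ t = 1 := by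
  let b : ContDiffBump (1 : ℝ) := ⟨1, 2, by norm_num, by norm_num⟩
  have hc : HasCompactSupport fun t => (b t : ℂ) :=
    b.hasCompactSupport.comp_left Complex.ofReal_zero
  have hd : ContDiff ℝ ∞ fun t => (b t : ℂ) := Complex.ofRealCLM.contDiff.comp b.contDiff
  refine ⟨hc.toSchwartzMap hd, fun t ht => ?_⟩
  rw [HasCompactSupport.toSchwartzMap_toFun, b.one_of_mem_closedBall, Complex.ofReal_one]
  rw [Metric.mem_closedBall, Real.dist_eq, abs_le]
  change -1 ≤ _ ∧ _ ≤ (1 : ℝ)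
  constructor <;> linarith [ht.1, ht.2]

/-- The transform of a function supported in `[0,2]` is reproduced by convolution with the
transform of a cut-off. -/
lemma lineFourier_eq_convolution (χ : 𝓢(ℝ, ℂ)) (hχ : ∀ t ∈ Icc (0 : ℝ) 2, χ t = 1)
    (g : 𝓢(ℝ, ℂ)) (hs : tsupport g ⊆ Icc 0 2) (τ : ℝ) :
    2 * (Real.pi : ℂ) * lineFourier g τ = ∫ l : ℝ, lineFourier χ (τ - l) * lineFourier g l := by
  have hint : Integrable (lineFourier χ) := by
    have : lineFourier χ = fun ξ => (𝓕 χ : 𝓢(ℝ, ℂ)) (ξ / (2 * Real.pi)) := by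
      ext ξ
      rw [lineFourier_eq_fourier, SchwartzMap.fourier_coe]
    rw [this]
    exact (𝓕 χ : 𝓢(ℝ, ℂ)).integrable.comp_div (by positivity)
  have h1 : ∫ l : ℝ, lineFourier χ (τ - l) * lineFourier g l =
      ∫ l : ℝ, lineFourier χ l * lineFourier g (τ - l) := by
    rw [← integral_sub_left_eq_self _ volume τ]
    simp only [sub_sub_cancel]
  have h2 : ∀ t : ℝ, 2 * (Real.pi : ℂ) * (Complex.exp (-(Complex.I * τ * t)) * g t) =
      ∫ l : ℝ, lineFourier χ l * (Complex.exp (-(Complex.I * (τ - l : ℝ) * t)) * g t) := by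
    intro t
    have h3 : g t = χ t * g t := by
      by_cases ht : t ∈ Icc (0 : ℝ) 2
      · rw [hχ t ht, one_mul]
      · rw [image_eq_zero_of_notMem_tsupport (fun h => ht (hs h)), mul_zero]
    have h4 := integral_exp_mul_lineFourier χ t
    calc _ = (2 * (Real.pi : ℂ) * χ t) * (Complex.exp (-(Complex.I * τ * t)) * g t) := by
          nth_rewrite 1 [h3]; ring
      _ = _ := by
          rw [← h4, ← integral_mul_const]
          congr 1
          ext l
          have : Complex.exp (-(Complex.I * (τ - l : ℝ) * t)) =
              Complex.exp (Complex.I * l * t) * Complex.exp (-(Complex.I * τ * t)) := by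
            rw [← Complex.exp_add]
            congr 1
            push_cast
            ring
          rw [this]
          ring
  rw [h1]
  unfold lineFourier at *
  rw [← integral_const_mul]
  simp only [h2]
  rw [integral_integral_swap]
  · simp only [integral_const_mul]
  · have hp := g.integrable (μ := volume) |>.mul_prod hint
    refine hp.mono ?_ (Eventually.of_forall fun q => ?_)
    · have e : (Function.uncurry fun (t l : ℝ) => lineFourier χ l *
          (Complex.exp (-(Complex.I * (τ - l : ℝ) * t)) * g t)) = fun q : ℝ × ℝ =>
          lineFourier χ q.2 * (Complex.exp (-(Complex.I * (τ - q.2 : ℝ) * q.1)) * g q.1) := rfl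
      have hc1 := continuous_lineFourier χ
      have hc2 := g.continuous
      change AEStronglyMeasurable (Function.uncurry fun (t l : ℝ) => lineFourier χ l *
          (Complex.exp (-(Complex.I * (τ - l : ℝ) * t)) * g t)) _
      rw [e]
      exact Continuous.aestronglyMeasurable (by fun_prop)
    · simp only [Function.uncurry, norm_mul]
      have : ‖Complex.exp (-(Complex.I * ((τ - q.2 : ℝ) : ℂ) * (q.1 : ℂ)))‖ = 1 := by
        rw [Complex.norm_exp]
        simp
      rw [this, one_mul, mul_comm]

/-! ### Sobolev norms and low frequencies -/

lemma sobolevFourierNorm_eq (σ : ℝ) (W : ℝ → ℂ) :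
    sobolevFourierNorm σ W =
      (∫⁻ ξ : ℝ, (ENNReal.ofReal ((1 + |ξ|) ^ σ) * ‖W ξ‖ₑ) ^ (2 : ℝ)) ^ (1 / 2 : ℝ) := by
  unfold sobolevFourierNorm
  congr 1
  refine lintegral_congr fun ξ => ?_
  rw [ENNReal.mul_rpow_of_nonneg _ _ (by norm_num : (0 : ℝ) ≤ 2),
    ENNReal.ofReal_rpow_of_nonneg (by positivity) (by norm_num), ← Real.rpow_mul (by positivity),
    mul_comm σ 2]
  norm_cast

lemma sobolevFourierNorm_sq (σ : ℝ) (W : ℝ → ℂ) :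
    sobolevFourierNorm σ W ^ 2 = ∫⁻ ξ : ℝ, ENNReal.ofReal ((1 + |ξ|) ^ (2 * σ)) * ‖W ξ‖ₑ ^ 2 := by
  unfold sobolevFourierNorm
  rw [← ENNReal.rpow_natCast, ← ENNReal.rpow_mul]
  norm_num

/-- For functions supported in `[0,2]`, low frequencies are controlled by any Sobolev norm. -/
lemma exists_lowFrequency_bound (σ : ℝ) :
    ∃ c : ℝ≥0, ∀ g : ℝ → ℂ, ContDiff ℝ ∞ g → tsupport g ⊆ Icc 0 2 →
      ∀ τ : ℝ, |τ| ≤ 1 → ‖lineFourier g τ‖ₑ ≤ c * sobolevNorm σ g := by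
  obtain ⟨χ, hχ⟩ := exists_cutoff
  -- Cauchy–Schwarz is applied to `χ̂(τ-l) ĝ(l)` with the weight `(1+|l|)^σ` on `ĝ`. Decay of order
  -- `N ≥ 1-σ` leaves `(1+|l|)⁻¹`, which is square integrable; `2^N` comes from `1+|l| ≤ 2(1+|τ-l|)`
  -- for `|τ| ≤ 1`.
  obtain ⟨N, hN⟩ := exists_nat_ge (1 - σ)
  obtain ⟨C, hC, hdec⟩ := lineFourier_decay χ N
  let D : ℝ≥0∞ :=
    (∫⁻ l : ℝ, (ENNReal.ofReal (C * 2 ^ N * (1 + |l|) ^ (-1 : ℝ))) ^ (2 : ℝ)) ^ (1 / 2 : ℝ)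
  have hD : D ≠ ⊤ := by
    have hi : Integrable fun l : ℝ => (C * 2 ^ N) ^ 2 * (1 + ‖l‖) ^ (-2 : ℝ) :=
      (integrable_one_add_norm (μ := (volume : Measure ℝ)) (by simp)).const_mul _
    refine ENNReal.rpow_ne_top_of_nonneg (by norm_num) ?_
    convert hi.lintegral_lt_top.ne using 3 with l
    rw [ENNReal.ofReal_rpow_of_nonneg (by positivity) (by norm_num), Real.mul_rpow (by positivity)
      (by positivity), ← Real.rpow_mul (by positivity), Real.norm_eq_abs]
    norm_num
  refine ⟨D.toNNReal, fun g hg hs τ hτ => ?_⟩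
  rw [ENNReal.coe_toNNReal hD]
  obtain ⟨f, rfl⟩ := exists_schwartz_of_data hg hs
  have h := lineFourier_eq_convolution χ hχ f hs τ
  have hpi : (1 : ℝ≥0∞) ≤ ‖2 * (Real.pi : ℂ)‖ₑ := by
    rw [← ofReal_norm, ENNReal.one_le_ofReal]
    simp only [Complex.norm_mul, Complex.norm_ofNat, Complex.norm_real, Real.norm_eq_abs,
      abs_of_pos Real.pi_pos]
    linarith [Real.pi_gt_three]
  have hcg := continuous_lineFourier f
  calc ‖lineFourier f τ‖ₑ ≤ ‖2 * (Real.pi : ℂ)‖ₑ * ‖lineFourier f τ‖ₑ :=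
        le_mul_of_one_le_left' hpi
    _ = ‖∫ l : ℝ, lineFourier χ (τ - l) * lineFourier f l‖ₑ := by rw [← enorm_mul, h]
    _ ≤ ∫⁻ l : ℝ, ‖lineFourier χ (τ - l) * lineFourier f l‖ₑ := enorm_integral_le_lintegral_enorm _
    _ ≤ ∫⁻ l : ℝ, ((fun l : ℝ => ENNReal.ofReal (C * 2 ^ N * (1 + |l|) ^ (-1 : ℝ))) *
          fun l : ℝ => ENNReal.ofReal ((1 + |l|) ^ σ) * ‖lineFourier f l‖ₑ) l := by
        refine lintegral_mono fun l => ?_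
        simp only [Pi.mul_apply]
        rw [enorm_mul, ← mul_assoc]
        gcongr
        rw [← ENNReal.ofReal_mul (by positivity), ← ofReal_norm]
        refine ENNReal.ofReal_le_ofReal ?_
        have h1 : 1 + |l| ≤ 2 * (1 + |τ - l|) := by
          have : |l| ≤ |τ| + |τ - l| := by
            have := abs_sub τ (τ - l)
            simpa using this
          linarith [abs_nonneg (τ - l)]
        have h2 : ‖lineFourier χ (τ - l)‖ * (1 + |l|) ^ N ≤ C * 2 ^ N := by
          calc _ ≤ ‖lineFourier χ (τ - l)‖ * (2 * (1 + |τ - l|)) ^ N := by gcongr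
            _ = ‖lineFourier χ (τ - l)‖ * (1 + |τ - l|) ^ N * 2 ^ N := by rw [mul_pow]; ring
            _ ≤ _ := by gcongr; exact hdec _
        rw [mul_assoc, ← Real.rpow_add (by positivity)]
        have h3 : (1 : ℝ) ≤ (1 + |l|) ^ N * (1 + |l|) ^ (-1 + σ) := by
          rw [← Real.rpow_natCast, ← Real.rpow_add (by positivity)]
          exact Real.one_le_rpow (by linarith [abs_nonneg l]) (by linarith)
        calc _ ≤ ‖lineFourier χ (τ - l)‖ * ((1 + |l|) ^ N * (1 + |l|) ^ (-1 + σ)) :=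
              le_mul_of_one_le_right (norm_nonneg _) h3
          _ = ‖lineFourier χ (τ - l)‖ * (1 + |l|) ^ N * (1 + |l|) ^ (-1 + σ) := by ring
          _ ≤ _ := by gcongr
    _ ≤ D * sobolevNorm σ f := by
        unfold sobolevNorm
        rw [sobolevFourierNorm_eq]
        exact ENNReal.lintegral_mul_le_Lp_mul_Lq volume Real.HolderConjugate.two_two
          (by fun_prop) (by fun_prop)

end FourierTransforms

section RayWaves

/-! ### Waves carried by a ray -/

/-- The superposition `∫_0^∞ e^{iρrx + iεr^m t} r^N ĝ(εr^m) dr`, `m = 2j+1`. -/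
def rayWave (j : ℕ) (ρ : ℂ) (ε : ℝ) (N : ℕ) (g : ℝ → ℂ) (x t : ℝ) : ℂ :=
  ∫ r in Ioi (0 : ℝ), Complex.exp (Complex.I * ρ * r * x +
    Complex.I * (ε * r ^ (2 * j + 1) : ℝ) * t) * (r ^ N * lineFourier g (ε * r ^ (2 * j + 1)))

lemma norm_rayPhase (j : ℕ) (ρ : ℂ) (ε r x t : ℝ) :
    ‖Complex.exp (Complex.I * ρ * r * x + Complex.I * (ε * r ^ (2 * j + 1) : ℝ) * t)‖ =
      Real.exp (-(ρ.im * r * x)) := by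
  rw [Complex.norm_exp]
  congr 1
  rw [Complex.add_re, show Complex.I * ((ε * r ^ (2 * j + 1) : ℝ) : ℂ) * t =
    ((ε * r ^ (2 * j + 1) * t : ℝ) : ℂ) * Complex.I by push_cast; ring, Complex.re_ofReal_mul,
    Complex.I_re, mul_zero, add_zero, show Complex.I * ρ * r * x = ((r * x : ℝ) : ℂ) *
      (Complex.I * ρ) by push_cast; ring, Complex.re_ofReal_mul, Complex.I_mul_re]
  ring

lemma norm_rayPhase_le_one (j : ℕ) {ρ : ℂ} (hρ : 0 ≤ ρ.im) (ε : ℝ) {r x : ℝ} (hr : 0 < r)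
    (hx : 0 ≤ x) (t : ℝ) :
    ‖Complex.exp (Complex.I * ρ * r * x + Complex.I * (ε * r ^ (2 * j + 1) : ℝ) * t)‖ ≤ 1 := by
  rw [norm_rayPhase, Real.exp_le_one_iff]
  have : 0 ≤ ρ.im * r * x := by positivity
  linarith

lemma one_add_le_two_mul_one_add_pow (j : ℕ) {r : ℝ} (hr : 0 ≤ r) :
    1 + r ≤ 2 * (1 + r ^ (2 * j + 1)) := by
  rcases le_total r 1 with h | h
  · have : 0 ≤ r ^ (2 * j + 1) := by positivity
    linarith
  · have := le_self_pow₀ h (n := 2 * j + 1) (by omega)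
    linarith

variable {g : ℝ → ℂ}

lemma continuous_lineFourier_of_data (hg : ContDiff ℝ ∞ g) (hs : tsupport g ⊆ Icc 0 2) :
    Continuous (lineFourier g) := by
  obtain ⟨f, rfl⟩ := exists_schwartz_of_data hg hs
  exact continuous_lineFourier f

/-- This integrable function dominates the ray integrands of power `N` for all `x ≥ 0` and all `t`,
since their phases have modulus at most one. -/
lemma integrableOn_pow_mul_lineFourier (hg : ContDiff ℝ ∞ g) (hs : tsupport g ⊆ Icc 0 2) (j : ℕ)
    {ε : ℝ} (hε : |ε| = 1) (N : ℕ) :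
    IntegrableOn (fun r : ℝ => (r : ℂ) ^ N * lineFourier g (ε * r ^ (2 * j + 1))) (Ioi 0) := by
  have hc := continuous_lineFourier_of_data hg hs
  obtain ⟨f, rfl⟩ := exists_schwartz_of_data hg hs
  obtain ⟨C, hC, hdec⟩ := lineFourier_decay f (N + 2)
  have hi : Integrable fun l : ℝ => C * 2 ^ (N + 2) * (1 + ‖l‖) ^ (-2 : ℝ) :=
    (integrable_one_add_norm (μ := (volume : Measure ℝ)) (by simp)).const_mul _
  refine hi.integrableOn.mono' (Continuous.aestronglyMeasurable (by fun_prop)) ?_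
  refine (ae_restrict_iff' measurableSet_Ioi).2 (Eventually.of_forall fun r hr => ?_)
  have hr : 0 < r := hr
  have h := hdec (ε * r ^ (2 * j + 1))
  rw [abs_mul, hε, one_mul, abs_of_pos (pow_pos hr _)] at h
  have h1 := one_add_le_two_mul_one_add_pow j hr.le
  rw [norm_mul, norm_pow, Complex.norm_real, Real.norm_of_nonneg hr.le, Real.rpow_neg (by positivity),
    ← div_eq_mul_inv, le_div_iff₀ (by positivity)]
  calc _ ≤ (1 + r) ^ N * ‖lineFourier f (ε * r ^ (2 * j + 1))‖ * (1 + r) ^ (2 : ℝ) := by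
        gcongr
        linarith
    _ = ‖lineFourier f (ε * r ^ (2 * j + 1))‖ * (1 + r) ^ (N + 2) := by
        rw [Real.rpow_two]; ring
    _ ≤ ‖lineFourier f (ε * r ^ (2 * j + 1))‖ * (2 * (1 + r ^ (2 * j + 1))) ^ (N + 2) := by
        gcongr
    _ = ‖lineFourier f (ε * r ^ (2 * j + 1))‖ * (1 + r ^ (2 * j + 1)) ^ (N + 2) * 2 ^ (N + 2) := by
        rw [mul_pow]; ring
    _ ≤ _ := by gcongr

lemma continuous_rayIntegrand (hg : ContDiff ℝ ∞ g) (hs : tsupport g ⊆ Icc 0 2) (j : ℕ) (ρ : ℂ)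
    (ε : ℝ) (N : ℕ) (x t : ℝ) :
    Continuous fun r : ℝ => Complex.exp (Complex.I * ρ * r * x +
      Complex.I * (ε * r ^ (2 * j + 1) : ℝ) * t) *
        ((r : ℂ) ^ N * lineFourier g (ε * r ^ (2 * j + 1))) := by
  have hc := continuous_lineFourier_of_data hg hs
  fun_prop

lemma integrableOn_rayIntegrand (hg : ContDiff ℝ ∞ g) (hs : tsupport g ⊆ Icc 0 2) (j : ℕ) {ρ : ℂ}
    (hρ : 0 ≤ ρ.im) {ε : ℝ} (hε : |ε| = 1) (N : ℕ) {x : ℝ} (hx : 0 ≤ x) (t : ℝ) :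
    IntegrableOn (fun r : ℝ => Complex.exp (Complex.I * ρ * r * x +
      Complex.I * (ε * r ^ (2 * j + 1) : ℝ) * t) *
        ((r : ℂ) ^ N * lineFourier g (ε * r ^ (2 * j + 1)))) (Ioi 0) := by
  refine (integrableOn_pow_mul_lineFourier hg hs j hε N).norm.mono'
    (continuous_rayIntegrand hg hs j ρ ε N x t).aestronglyMeasurable ?_
  refine (ae_restrict_iff' measurableSet_Ioi).2 (Eventually.of_forall fun r hr => ?_)
  rw [norm_mul]
  exact mul_le_of_le_one_left (norm_nonneg _) (norm_rayPhase_le_one j hρ ε hr hx t)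

lemma hasDerivAt_rayWave_x (hg : ContDiff ℝ ∞ g) (hs : tsupport g ⊆ Icc 0 2) (j : ℕ) {ρ : ℂ}
    (hρ : 0 ≤ ρ.im) {ε : ℝ} (hε : |ε| = 1) (N : ℕ) {x : ℝ} (hx : 0 < x) (t : ℝ) :
    HasDerivAt (fun y => rayWave j ρ ε N g y t)
      (Complex.I * ρ * rayWave j ρ ε (N + 1) g x t) x := by
  have h := hasDerivAt_integral_of_dominated_loc_of_deriv_le (μ := volume.restrict (Ioi (0 : ℝ)))
    (F := fun (y : ℝ) (r : ℝ) => Complex.exp (Complex.I * ρ * r * y +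
      Complex.I * (ε * r ^ (2 * j + 1) : ℝ) * t) *
        ((r : ℂ) ^ N * lineFourier g (ε * r ^ (2 * j + 1))))
    (F' := fun (y : ℝ) (r : ℝ) => Complex.I * ρ * (Complex.exp (Complex.I * ρ * r * y +
      Complex.I * (ε * r ^ (2 * j + 1) : ℝ) * t) *
        ((r : ℂ) ^ (N + 1) * lineFourier g (ε * r ^ (2 * j + 1)))))
    (bound := fun r => ‖ρ‖ * ‖(r : ℂ) ^ (N + 1) * lineFourier g (ε * r ^ (2 * j + 1))‖)
    (s := Ioi 0) (x₀ := x) (Ioi_mem_nhds hx)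
    (Eventually.of_forall fun y =>
      (continuous_rayIntegrand hg hs j ρ ε N y t).aestronglyMeasurable)
    (integrableOn_rayIntegrand hg hs j hρ hε N hx.le t)
    ((continuous_const.mul
      (continuous_rayIntegrand hg hs j ρ ε (N + 1) x t)).aestronglyMeasurable)
    ((ae_restrict_iff' measurableSet_Ioi).2 (Eventually.of_forall fun r hr y hy => ?_))
    ((integrableOn_pow_mul_lineFourier hg hs j hε (N + 1)).norm.const_mul _)
    (Eventually.of_forall fun r y _ => ?_)
  · have h2 := h.2
    simp only [integral_const_mul] at h2
    exact h2
  · rw [norm_mul, norm_mul, norm_mul (Complex.exp _), Complex.norm_I, one_mul]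
    gcongr
    exact mul_le_of_le_one_left (norm_nonneg _)
      (norm_rayPhase_le_one j hρ ε hr (le_of_lt hy) t)
  · have h1 : HasDerivAt (fun y : ℝ => Complex.I * ρ * r * (y : ℂ) +
        Complex.I * (ε * r ^ (2 * j + 1) : ℝ) * t) (Complex.I * ρ * r) y := by
      simpa using ((Complex.ofRealCLM.hasDerivAt (x := y)).const_mul
        (Complex.I * ρ * r)).add_const (Complex.I * (ε * r ^ (2 * j + 1) : ℝ) * t)
    exact (h1.cexp.mul_const _).congr_deriv (by ring)

lemma hasDerivAt_rayWave_t (hg : ContDiff ℝ ∞ g) (hs : tsupport g ⊆ Icc 0 2) (j : ℕ) {ρ : ℂ}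
    (hρ : 0 ≤ ρ.im) {ε : ℝ} (hε : |ε| = 1) (N : ℕ) {x : ℝ} (hx : 0 ≤ x) (t : ℝ) :
    HasDerivAt (fun y => rayWave j ρ ε N g x y)
      (Complex.I * ε * rayWave j ρ ε (N + (2 * j + 1)) g x t) t := by
  have h := hasDerivAt_integral_of_dominated_loc_of_deriv_le (μ := volume.restrict (Ioi (0 : ℝ)))
    (F := fun (y : ℝ) (r : ℝ) => Complex.exp (Complex.I * ρ * r * x +
      Complex.I * (ε * r ^ (2 * j + 1) : ℝ) * y) *
        ((r : ℂ) ^ N * lineFourier g (ε * r ^ (2 * j + 1))))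
    (F' := fun (y : ℝ) (r : ℝ) => Complex.I * ε * (Complex.exp (Complex.I * ρ * r * x +
      Complex.I * (ε * r ^ (2 * j + 1) : ℝ) * y) *
        ((r : ℂ) ^ (N + (2 * j + 1)) * lineFourier g (ε * r ^ (2 * j + 1)))))
    (bound := fun r => ‖(r : ℂ) ^ (N + (2 * j + 1)) * lineFourier g (ε * r ^ (2 * j + 1))‖)
    (s := univ) (x₀ := t) univ_mem
    (Eventually.of_forall fun y =>
      (continuous_rayIntegrand hg hs j ρ ε N x y).aestronglyMeasurable)
    (integrableOn_rayIntegrand hg hs j hρ hε N hx t)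
    ((continuous_const.mul
      (continuous_rayIntegrand hg hs j ρ ε (N + (2 * j + 1)) x t)).aestronglyMeasurable)
    ((ae_restrict_iff' measurableSet_Ioi).2 (Eventually.of_forall fun r hr y hy => ?_))
    ((integrableOn_pow_mul_lineFourier hg hs j hε (N + (2 * j + 1))).norm)
    (Eventually.of_forall fun r y _ => ?_)
  · have h2 := h.2
    simp only [integral_const_mul] at h2
    exact h2
  · rw [norm_mul, norm_mul, norm_mul (Complex.exp _), Complex.norm_I, one_mul, Complex.norm_real,
      Real.norm_eq_abs, hε, one_mul]
    exact mul_le_of_le_one_left (norm_nonneg _)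
      (norm_rayPhase_le_one j hρ ε hr hx y)
  · have h1 : HasDerivAt (fun y : ℝ => Complex.I * ρ * r * (x : ℂ) +
        Complex.I * (ε * r ^ (2 * j + 1) : ℝ) * (y : ℂ))
          (Complex.I * (ε * r ^ (2 * j + 1) : ℝ)) y := by
      simpa using ((Complex.ofRealCLM.hasDerivAt (x := y)).const_mul
        (Complex.I * (ε * r ^ (2 * j + 1) : ℝ))).const_add (Complex.I * ρ * r * (x : ℂ))
    exact (h1.cexp.mul_const _).congr_deriv (by push_cast; ring)

/-- The limit no longer involves `ρ`; this lets the sum over `p` act on the constants alone. -/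
lemma tendsto_rayWave_x_zero (hg : ContDiff ℝ ∞ g) (hs : tsupport g ⊆ Icc 0 2) (j : ℕ) {ρ : ℂ}
    (hρ : 0 ≤ ρ.im) {ε : ℝ} (hε : |ε| = 1) (N : ℕ) (t : ℝ) :
    Tendsto (fun x => rayWave j ρ ε N g x t) (𝓝[>] 0) (𝓝 (rayWave j 0 ε N g 0 t)) := by
  refine tendsto_integral_filter_of_dominated_convergence
    (fun r => ‖(r : ℂ) ^ N * lineFourier g (ε * r ^ (2 * j + 1))‖)
    (Eventually.of_forall fun y =>
      (continuous_rayIntegrand hg hs j ρ ε N y t).aestronglyMeasurable) ?_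
    ((integrableOn_pow_mul_lineFourier hg hs j hε N).norm) (Eventually.of_forall fun r => ?_)
  · filter_upwards [self_mem_nhdsWithin] with x hx
    refine (ae_restrict_iff' measurableSet_Ioi).2 (Eventually.of_forall fun r hr => ?_)
    rw [norm_mul]
    exact mul_le_of_le_one_left (norm_nonneg _) (norm_rayPhase_le_one j hρ ε hr (le_of_lt hx) t)
  · have hc : Continuous fun x : ℝ => Complex.exp (Complex.I * ρ * r * x +
      Complex.I * (ε * r ^ (2 * j + 1) : ℝ) * t) *
        ((r : ℂ) ^ N * lineFourier g (ε * r ^ (2 * j + 1))) := by fun_prop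
    have := (hc.tendsto 0).mono_left (nhdsWithin_le_nhds (s := Ioi 0))
    simpa using this

lemma integral_Ioi_comp_pow (j : ℕ) (F : ℝ → ℂ) :
    ((2 * j + 1 : ℕ) : ℂ) * ∫ r in Ioi (0 : ℝ), (r : ℂ) ^ (2 * j) * F (r ^ (2 * j + 1)) =
      ∫ r in Ioi (0 : ℝ), F r := by
  have hp : ((2 * j + 1 : ℕ) : ℝ) ≠ 0 := Nat.cast_ne_zero.2 (by omega)
  rw [← integral_comp_rpow_Ioi F hp, ← integral_const_mul]
  refine setIntegral_congr_fun measurableSet_Ioi fun r hr => ?_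
  have e : ((2 * j + 1 : ℕ) : ℝ) - 1 = ((2 * j : ℕ) : ℝ) := by push_cast; ring
  simp only [Complex.real_smul]
  rw [e, Real.rpow_natCast, Real.rpow_natCast, abs_of_nonneg (Nat.cast_nonneg _)]
  push_cast
  ring

/-- Fourier inversion in the variable `λ = ± r^m`. -/
lemma rayWave_zero_add (hg : ContDiff ℝ ∞ g) (hs : tsupport g ⊆ Icc 0 2) (j : ℕ) (t : ℝ) :
    ((2 * j + 1 : ℕ) : ℂ) * (rayWave j 0 1 (2 * j) g 0 t + rayWave j 0 (-1) (2 * j) g 0 t) =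
      2 * (Real.pi : ℂ) * g t := by
  obtain ⟨f, rfl⟩ := exists_schwartz_of_data hg hs
  have hc := continuous_lineFourier f
  have hint : Integrable fun l : ℝ => Complex.exp (Complex.I * l * t) * lineFourier f l := by
    obtain ⟨C, hC, hdec⟩ := lineFourier_decay f 2
    have hi : Integrable fun l : ℝ => C * (1 + ‖l‖) ^ (-2 : ℝ) :=
      (integrable_one_add_norm (μ := (volume : Measure ℝ)) (by simp)).const_mul _
    refine hi.mono' (Continuous.aestronglyMeasurable (by fun_prop))
      (Eventually.of_forall fun l => ?_)
    rw [norm_mul, Complex.norm_exp, Real.rpow_neg (by positivity), Real.rpow_two, ← div_eq_mul_inv,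
      le_div_iff₀ (by positivity)]
    simpa using hdec l
  rw [← integral_exp_mul_lineFourier, ← integral_add_compl measurableSet_Ioi (s := Ioi 0) hint,
    compl_Ioi]
  have hneg := integral_comp_neg_Ioi (0 : ℝ)
    (fun l : ℝ => Complex.exp (Complex.I * l * t) * lineFourier f l)
  rw [neg_zero] at hneg
  rw [← hneg, mul_add]
  rw [← integral_Ioi_comp_pow j (fun l : ℝ => Complex.exp (Complex.I * l * t) * lineFourier f l),
    ← integral_Ioi_comp_pow j (fun l : ℝ => Complex.exp (Complex.I * (-l : ℝ) * t) * lineFourier f (-l))]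
  unfold rayWave
  congr 3 <;>
  · ext r
    simp only [Complex.ofReal_zero, mul_zero, zero_mul, zero_add, one_mul, neg_one_mul]
    push_cast
    ring

/-! ### Vanishing of the sector integrals -/

/-- An entire function has a primitive `P`, so the integral along a ray up to radius `R` is
`P(Re^{iθ}) - P(0)`. The difference of two rays is an increment of `P` along the arc, at most the
arc length times the bound on `f`, hence it tends to zero. -/
lemma sector_integral_eq {f : ℂ → ℂ} (hf : Differentiable ℂ f) {θ₁ θ₂ : ℝ} (hθ : θ₁ ≤ θ₂)
    {B δ : ℝ} {n : ℕ} (hδ : 0 < δ)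
    (hB : ∀ θ ∈ Icc θ₁ θ₂, ∀ r : ℝ, 0 < r →
      ‖f (Complex.exp (θ * Complex.I) * r)‖ ≤ B * r ^ n * Real.exp (-(δ * r)))
    (h1 : IntegrableOn (fun r : ℝ => f (Complex.exp (θ₁ * Complex.I) * r) *
      Complex.exp (θ₁ * Complex.I)) (Ioi 0))
    (h2 : IntegrableOn (fun r : ℝ => f (Complex.exp (θ₂ * Complex.I) * r) *
      Complex.exp (θ₂ * Complex.I)) (Ioi 0)) :
    ∫ r in Ioi (0 : ℝ), f (Complex.exp (θ₁ * Complex.I) * r) * Complex.exp (θ₁ * Complex.I) =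
      ∫ r in Ioi (0 : ℝ), f (Complex.exp (θ₂ * Complex.I) * r) * Complex.exp (θ₂ * Complex.I) := by
  obtain ⟨P, hP⟩ := hf.isExactOn_univ
  have hfc := hf.continuous
  have hray : ∀ (w : ℂ) (R : ℝ), ∫ r in (0 : ℝ)..R, f (w * r) * w = P (w * R) - P 0 := by
    intro w R
    have hd : ∀ r ∈ uIcc 0 R, HasDerivAt (fun r : ℝ => P (w * r)) (f (w * r) * w) r := by
      intro r _
      have hl : HasDerivAt (fun r : ℝ => w * (r : ℂ)) w r := by
        simpa using (Complex.ofRealCLM.hasDerivAt (x := r)).const_mul w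
      exact (hP (w * r) (mem_univ _)).comp_of_eq r hl rfl
    rw [intervalIntegral.integral_eq_sub_of_hasDerivAt hd
      (Continuous.intervalIntegrable (by fun_prop) _ _)]
    simp
  have t1 := intervalIntegral_tendsto_integral_Ioi 0 h1 tendsto_id
  have t2 := intervalIntegral_tendsto_integral_Ioi 0 h2 tendsto_id
  simp only [id, hray] at t1 t2
  have t3 := t2.sub t1
  have t4 : Tendsto (fun R : ℝ => (P (Complex.exp (θ₂ * Complex.I) * R) - P 0) -
      (P (Complex.exp (θ₁ * Complex.I) * R) - P 0)) atTop (𝓝 0) := by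
    have hlim : Tendsto (fun R : ℝ => B * (R ^ (n + 1) * Real.exp (-(δ * R))) * (θ₂ - θ₁)) atTop
        (𝓝 0) := by
      have := ((Real.tendsto_pow_mul_exp_neg_atTop_nhds_zero (n + 1)).comp
        (tendsto_id.const_mul_atTop hδ)).const_mul ((δ ^ (n + 1))⁻¹)
      simp only [Function.comp_def, id, mul_pow, mul_zero, ← mul_assoc,
        inv_mul_cancel₀ (pow_pos hδ (n + 1)).ne', one_mul] at this
      simpa using (this.const_mul B).mul_const (θ₂ - θ₁)
    refine squeeze_zero_norm' ?_ hlim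
    filter_upwards [eventually_gt_atTop 0] with R hR
    rw [sub_sub_sub_cancel_right]
    have hd : ∀ θ ∈ Icc θ₁ θ₂, HasDerivWithinAt (fun θ : ℝ => P (Complex.exp (θ * Complex.I) * R))
        (f (Complex.exp (θ * Complex.I) * R) * (Complex.exp (θ * Complex.I) * Complex.I * R))
        (Icc θ₁ θ₂) θ := by
      intro θ _
      have hl : HasDerivAt (fun θ : ℝ => Complex.exp (θ * Complex.I) * (R : ℂ))
          (Complex.exp (θ * Complex.I) * Complex.I * R) θ := by
        have : HasDerivAt (fun θ : ℝ => (θ : ℂ) * Complex.I) Complex.I θ := by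
          simpa using (Complex.ofRealCLM.hasDerivAt (x := θ)).mul_const Complex.I
        exact this.cexp.mul_const _
      exact ((hP _ (mem_univ _)).comp_of_eq θ hl rfl).hasDerivWithinAt
    refine (norm_image_sub_le_of_norm_deriv_le_segment' hd (C := B * (R ^ (n + 1) *
      Real.exp (-(δ * R)))) (fun θ hθ' => ?_) θ₂ (right_mem_Icc.2 hθ))
    rw [norm_mul, norm_mul, norm_mul, Complex.norm_exp_ofReal_mul_I, Complex.norm_I, one_mul,
      one_mul, Complex.norm_real, Real.norm_of_nonneg hR.le]
    calc _ ≤ B * R ^ n * Real.exp (-(δ * R)) * R := by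
          gcongr
          exact hB θ ⟨hθ'.1, hθ'.2.le⟩ R hR
      _ = _ := by ring
  exact (sub_eq_zero.1 (tendsto_nhds_unique t3 t4)).symm

lemma differentiable_timeTransform (hg : Continuous g) {T : ℝ} (hT : 0 ≤ T) :
    Differentiable ℂ (timeTransform g T) := by
  intro z
  have h := intervalIntegral.hasDerivAt_integral_of_dominated_loc_of_deriv_le (μ := volume)
    (a := 0) (b := T)
    (F := fun (w : ℂ) (τ : ℝ) => Complex.exp (-(Complex.I * w * τ)) * g τ)
    (F' := fun (w : ℂ) (τ : ℝ) => Complex.exp (-(Complex.I * w * τ)) * (-(Complex.I * τ)) * g τ)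
    (bound := fun τ => Real.exp ((‖z‖ + 1) * T) * T * ‖g τ‖) (x₀ := z)
    (s := Metric.ball z 1) (Metric.ball_mem_nhds z one_pos)
    (Eventually.of_forall fun w => Continuous.aestronglyMeasurable (by fun_prop))
    (Continuous.intervalIntegrable (by fun_prop) _ _)
    (Continuous.aestronglyMeasurable (by fun_prop))
    (Eventually.of_forall fun τ hτ w hw => ?_)
    (Continuous.intervalIntegrable (by fun_prop) _ _)
    (Eventually.of_forall fun τ _ w _ => ?_)
  · exact h.2.differentiableAt
  · rw [uIoc_of_le hT] at hτ
    have hw' : ‖w‖ ≤ ‖z‖ + 1 := by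
      have := norm_le_norm_add_norm_sub' w z
      rw [mem_ball_iff_norm] at hw
      linarith
    have hτ0 := hτ.1.le
    rw [norm_mul, norm_mul, norm_neg, norm_mul, Complex.norm_I, one_mul, Complex.norm_real,
      Real.norm_of_nonneg hτ0]
    gcongr
    · refine (Complex.norm_exp_le_exp_norm _).trans (Real.exp_le_exp.2 ?_)
      rw [norm_neg, norm_mul, norm_mul, Complex.norm_I, one_mul, Complex.norm_real,
        Real.norm_of_nonneg hτ0]
      gcongr
      exact hτ.2
    · exact hτ.2
  · have h1 : HasDerivAt (fun w : ℂ => -(Complex.I * w * τ)) (-(Complex.I * τ)) w := by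
      simpa using (((hasDerivAt_id w).const_mul Complex.I).mul_const (τ : ℂ)).fun_neg
    exact h1.cexp.mul_const _

/-- For `τ ≥ 0` and `Im z ≤ 0` the factor `e^{-izτ}` has modulus at most one. -/
lemma exists_norm_timeTransform_le (hg : Continuous g) {T : ℝ} (hT : 0 ≤ T) :
    ∃ B, 0 ≤ B ∧ ∀ z : ℂ, z.im ≤ 0 → ‖timeTransform g T z‖ ≤ B := by
  refine ⟨∫ τ in (0 : ℝ)..T, ‖g τ‖,
    intervalIntegral.integral_nonneg hT fun _ _ => norm_nonneg _, fun z hz => ?_⟩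
  unfold timeTransform
  refine intervalIntegral.norm_integral_le_of_norm_le hT ?_
    (Continuous.intervalIntegrable (by fun_prop) _ _)
  refine Eventually.of_forall fun τ hτ => ?_
  rw [norm_mul]
  refine mul_le_of_le_one_left (norm_nonneg _) ?_
  rw [Complex.norm_exp, Real.exp_le_one_iff]
  have e : (-(Complex.I * z * τ)).re = z.im * τ := by simp
  rw [e]
  exact mul_nonpos_of_nonpos_of_nonneg hz hτ.1.le

lemma rayIntegrand_eq (hs : tsupport g ⊆ Icc 0 2) (j N : ℕ) {ρ : ℂ} {ε : ℝ}
    (hρε : ρ ^ (2 * j + 1) = ε) (x t r : ℝ) :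
    Complex.exp (Complex.I * (ρ * r) * x + Complex.I * (ρ * r) ^ (2 * j + 1) * t) *
        (Complex.I * (ρ * r)) ^ N * timeTransform g 2 ((ρ * r) ^ (2 * j + 1)) * ρ =
      (Complex.I * ρ) ^ N * ρ * (Complex.exp (Complex.I * ρ * r * x +
        Complex.I * (ε * r ^ (2 * j + 1) : ℝ) * t) *
          ((r : ℂ) ^ N * lineFourier g (ε * r ^ (2 * j + 1)))) := by
  have e : (ρ * r) ^ (2 * j + 1) = ((ε * r ^ (2 * j + 1) : ℝ) : ℂ) := by
    rw [mul_pow, hρε]; push_cast; ring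
  rw [e, timeTransform_ofReal hs, ← mul_assoc Complex.I, mul_pow (Complex.I * ρ)]
  ring

lemma rot_odd_pow (j : ℕ) (p : ℤ) : rot j (2 * p - 1) ^ (2 * j + 1) = ((-1 : ℝ) : ℂ) := by
  rw [rot_pow]
  push_cast
  exact (Int.odd_sub.2 (by simp)).neg_one_zpow

lemma rot_even_pow (j : ℕ) (p : ℤ) : rot j (2 * p) ^ (2 * j + 1) = ((1 : ℝ) : ℂ) := by
  rw [rot_pow]
  push_cast
  exact (even_two_mul p).neg_one_zpow

lemma rot_odd_im_pos {j p : ℕ} (hp : p ∈ Finset.Icc 1 j) : 0 < (rot j (2 * p - 1)).im := by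
  simp only [Finset.mem_Icc] at hp
  exact rot_im_pos j _ (by omega) (by omega)

lemma rot_even_im_pos {j p : ℕ} (hp : p ∈ Finset.Icc 1 j) : 0 < (rot j (2 * p)).im := by
  simp only [Finset.mem_Icc] at hp
  exact rot_im_pos j _ (by omega) (by omega)

lemma sectorBoundaryIntegral_eq (hs : tsupport g ⊆ Icc 0 2) (j p N : ℕ) (x t : ℝ) :
    sectorBoundaryIntegral j p (fun ξ =>
      Complex.exp (Complex.I * ξ * (x : ℂ) + Complex.I * ξ ^ (2 * j + 1) * (t : ℂ)) *
        (Complex.I * ξ) ^ N * timeTransform g 2 (ξ ^ (2 * j + 1))) =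
      (Complex.I * rot j (2 * p - 1)) ^ N * rot j (2 * p - 1) *
          rayWave j (rot j (2 * p - 1)) (-1) N g x t -
        (Complex.I * rot j (2 * p)) ^ N * rot j (2 * p) *
          rayWave j (rot j (2 * p)) 1 N g x t := by
  unfold sectorBoundaryIntegral rayWave
  simp only [rayIntegrand_eq hs j N (rot_odd_pow j p), rayIntegrand_eq hs j N (rot_even_pow j p),
    integral_const_mul]

lemma sectorBoundaryIntegral_initial (hg : ContDiff ℝ ∞ g) (hs : tsupport g ⊆ Icc 0 2) {j p : ℕ}
    (hp : p ∈ Finset.Icc 1 j) (N : ℕ) {x : ℝ} (hx : 0 < x) :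
    sectorBoundaryIntegral j p (fun ξ =>
      Complex.exp (Complex.I * ξ * (x : ℂ) + Complex.I * ξ ^ (2 * j + 1) * ((0 : ℝ) : ℂ)) *
        (Complex.I * ξ) ^ N * timeTransform g 2 (ξ ^ (2 * j + 1))) = 0 := by
  obtain ⟨B, hB0, hB⟩ := exists_norm_timeTransform_le hg.continuous (T := 2) (by norm_num)
  have hdiff := differentiable_timeTransform hg.continuous (T := 2) (by norm_num)
  set f : ℂ → ℂ := fun ξ => Complex.exp (Complex.I * ξ * (x : ℂ) +
    Complex.I * ξ ^ (2 * j + 1) * ((0 : ℝ) : ℂ)) * (Complex.I * ξ) ^ N *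
      timeTransform g 2 (ξ ^ (2 * j + 1)) with hfdef
  have hm : (0 : ℝ) < 2 * j + 1 := by positivity
  have hpi := Real.pi_pos
  simp only [Finset.mem_Icc] at hp
  have hp1 : (1 : ℝ) ≤ p := by exact_mod_cast hp.1
  have hp2 : (p : ℝ) ≤ j := by exact_mod_cast hp.2
  set θ₁ : ℝ := Real.pi * ((2 * p - 1 : ℤ) : ℝ) / (2 * j + 1) with hθ₁
  set θ₂ : ℝ := Real.pi * ((2 * p : ℤ) : ℝ) / (2 * j + 1) with hθ₂
  have e1 : rot j (2 * p - 1) = Complex.exp (θ₁ * Complex.I) := rot_eq_exp _ _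
  have e2 : rot j (2 * p) = Complex.exp (θ₂ * Complex.I) := rot_eq_exp _ _
  have hθ : θ₁ ≤ θ₂ := by
    rw [hθ₁, hθ₂]
    gcongr
    simp
  have hθpos : 0 < θ₁ := by
    rw [hθ₁]
    push_cast
    have : (0 : ℝ) < 2 * p - 1 := by linarith
    positivity
  have hθlt : θ₂ < Real.pi := by
    rw [hθ₂, div_lt_iff₀ hm]
    push_cast
    nlinarith
  -- The closed sector lies strictly inside the upper half-plane, so the minimum of `sin` over its
  -- angles gives a decay rate `x sin θ₀` uniform in the angle.
  obtain ⟨θ₀, hθ₀, hmin⟩ := (isCompact_Icc (a := θ₁) (b := θ₂)).exists_isMinOn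
    ⟨θ₁, left_mem_Icc.2 hθ⟩ Real.continuous_sin.continuousOn
  have hsin : 0 < Real.sin θ₀ :=
    Real.sin_pos_of_pos_of_lt_pi (by linarith [hθ₀.1]) (by linarith [hθ₀.2])
  have hint : ∀ {ρ : ℂ} {ε : ℝ}, 0 ≤ ρ.im → |ε| = 1 → ρ ^ (2 * j + 1) = ε →
      IntegrableOn (fun r : ℝ => f (ρ * r) * ρ) (Ioi 0) := by
    intro ρ ε h1 h2 h3
    simp only [hfdef, rayIntegrand_eq hs j N h3]
    exact (integrableOn_rayIntegrand hg hs j h1 h2 N hx.le 0).const_mul _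
  have key := sector_integral_eq (f := f) (θ₁ := θ₁) (θ₂ := θ₂) (B := B) (n := N)
    (δ := Real.sin θ₀ * x) (by rw [hfdef]; fun_prop) hθ (by positivity) ?_ ?_ ?_
  · unfold sectorBoundaryIntegral
    rw [e1, e2]
    exact sub_eq_zero.2 key
  · intro θ hθ' r hr
    have him : ((Complex.exp (θ * Complex.I) * r) ^ (2 * j + 1)).im ≤ 0 := by
      rw [mul_pow, ← Complex.exp_nat_mul, ← Complex.ofReal_pow, Complex.im_mul_ofReal,
        show ((2 * j + 1 : ℕ) : ℂ) * (θ * Complex.I) = (((2 * j + 1) * θ : ℝ) : ℂ) * Complex.I by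
          push_cast; ring, Complex.exp_ofReal_mul_I_im]
      refine mul_nonpos_of_nonpos_of_nonneg ?_ (by positivity)
      -- In the sector `mθ` lies in `[(2p-1)π, 2pπ]`; subtracting `2pπ` puts it in `[-π, 0]`, where
      -- the sine is nonpositive.
      rw [← Real.sin_sub_nat_mul_two_pi _ p]
      have b1 := hθ'.1
      have b2 := hθ'.2
      rw [hθ₁, div_le_iff₀ hm] at b1
      rw [hθ₂, le_div_iff₀ hm] at b2
      push_cast at b1 b2
      exact Real.sin_nonpos_of_nonpos_of_neg_pi_le (by linarith) (by linarith)
    have hb := hB _ him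
    have hn : ‖Complex.exp (Complex.I * (Complex.exp (θ * Complex.I) * r) * (x : ℂ) +
        Complex.I * (Complex.exp (θ * Complex.I) * r) ^ (2 * j + 1) * ((0 : ℝ) : ℂ))‖ ≤
        Real.exp (-(Real.sin θ₀ * x * r)) := by
      rw [Complex.ofReal_zero, mul_zero, add_zero, norm_cexp_I_mul, Complex.im_mul_ofReal,
        Complex.exp_ofReal_mul_I_im]
      apply Real.exp_le_exp.2
      have h4 : Real.sin θ₀ ≤ Real.sin θ := hmin hθ'
      have : Real.sin θ₀ * (r * x) ≤ Real.sin θ * (r * x) := by gcongr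
      linarith
    have hpow : ‖(Complex.I * (Complex.exp (θ * Complex.I) * r)) ^ N‖ = r ^ N := by
      rw [norm_pow, norm_mul, norm_mul, Complex.norm_I, Complex.norm_exp_ofReal_mul_I, one_mul,
        one_mul, Complex.norm_real, Real.norm_of_nonneg hr.le]
    rw [hfdef]
    simp only [norm_mul _ (timeTransform _ _ _), norm_mul _ (_ ^ N)]
    rw [hpow]
    calc _ ≤ Real.exp (-(Real.sin θ₀ * x * r)) * r ^ N * B := by gcongr
      _ = _ := by ring
  · rw [← e1]
    refine hint (ε := -1) ?_ (by simp) (rot_odd_pow j p)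
    exact (rot_odd_im_pos (Finset.mem_Icc.2 hp)).le
  · rw [← e2]
    refine hint (ε := 1) ?_ (by simp) (rot_even_pow j p)
    exact (rot_even_im_pos (Finset.mem_Icc.2 hp)).le

end RayWaves

section ClassicalSolution

/-! ### The Fokas formula gives a classical solution -/

variable {j : ℕ} {h : Fin j → ℝ → ℂ}

/-- The `n`-th spatial derivative of the solution, as a superposition of ray waves. -/
def solutionDeriv (h : Fin j → ℝ → ℂ) (n : ℕ) (x t : ℝ) : ℂ :=
  ∑ p ∈ Finset.Icc 1 j, ∑ l : Fin j, fokasCoeff j p l *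
    ((Complex.I * rot j (2 * p - 1)) ^ (2 * j - (l : ℕ) + n) * rot j (2 * p - 1) *
        rayWave j (rot j (2 * p - 1)) (-1) (2 * j - (l : ℕ) + n) (h l) x t -
      (Complex.I * rot j (2 * p)) ^ (2 * j - (l : ℕ) + n) * rot j (2 * p) *
        rayWave j (rot j (2 * p)) 1 (2 * j - (l : ℕ) + n) (h l) x t)

lemma reducedSolution_eq (hh : IsBoundaryData h) (x t : ℝ) :
    reducedSolution h x t = solutionDeriv h 0 x t := by
  unfold reducedSolution solutionDeriv
  simp only [sectorBoundaryIntegral_eq (hh _).2, add_zero]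

lemma hasDerivAt_solutionDeriv (hh : IsBoundaryData h) (n : ℕ) {x : ℝ} (hx : 0 < x) (t : ℝ) :
    HasDerivAt (fun y => solutionDeriv h n y t) (solutionDeriv h (n + 1) x t) x := by
  unfold solutionDeriv
  refine HasDerivAt.fun_sum fun p hp => HasDerivAt.fun_sum fun l _ => ?_
  have h1 := hasDerivAt_rayWave_x (hh l).1 (hh l).2 j (rot_odd_im_pos hp).le (ε := -1) (by simp)
    (2 * j - (l : ℕ) + n) hx t
  have h2 := hasDerivAt_rayWave_x (hh l).1 (hh l).2 j (rot_even_im_pos hp).le (ε := 1) (by simp)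
    (2 * j - (l : ℕ) + n) hx t
  refine (((h1.const_mul _).fun_sub (h2.const_mul _)).const_mul _).congr_deriv ?_
  simp only [← add_assoc, pow_succ]
  ring

/-- A time derivative contributes `iε r^m` and `m` space derivatives contribute `(iρr)^m = (-1)^j iε
r^m`, on either kind of ray. -/
lemma hasDerivAt_solutionDeriv_zero_t (hh : IsBoundaryData h) {x : ℝ} (hx : 0 ≤ x) (t : ℝ) :
    HasDerivAt (fun y => solutionDeriv h 0 x y)
      ((-1) ^ j * solutionDeriv h (2 * j + 1) x t) t := by
  unfold solutionDeriv
  simp only [Finset.mul_sum]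
  refine HasDerivAt.fun_sum fun p hp => HasDerivAt.fun_sum fun l _ => ?_
  have h1 := hasDerivAt_rayWave_t (hh l).1 (hh l).2 j (rot_odd_im_pos hp).le (ε := -1) (by simp)
    (2 * j - (l : ℕ) + 0) hx t
  have h2 := hasDerivAt_rayWave_t (hh l).1 (hh l).2 j (rot_even_im_pos hp).le (ε := 1) (by simp)
    (2 * j - (l : ℕ) + 0) hx t
  refine (((h1.const_mul _).fun_sub (h2.const_mul _)).const_mul _).congr_deriv ?_
  have hI : Complex.I ^ (2 * j + 1) = (-1) ^ j * Complex.I := by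
    rw [pow_succ, pow_mul, Complex.I_sq]
  have hs : ((-1 : ℂ) ^ j) * (-1) ^ j = 1 := by rw [← mul_pow]; simp
  have e1 : (Complex.I * rot j (2 * p - 1)) ^ (2 * j - (l : ℕ) + (2 * j + 1)) =
      (-1) ^ j * ((Complex.I * rot j (2 * p - 1)) ^ (2 * j - (l : ℕ)) * (Complex.I * (-1))) := by
    rw [pow_add, mul_pow _ _ (2 * j + 1), hI, rot_odd_pow]
    push_cast
    ring
  have e2 : (Complex.I * rot j (2 * p)) ^ (2 * j - (l : ℕ) + (2 * j + 1)) =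
      (-1) ^ j * ((Complex.I * rot j (2 * p)) ^ (2 * j - (l : ℕ)) * Complex.I) := by
    rw [pow_add, mul_pow _ _ (2 * j + 1), hI, rot_even_pow]
    push_cast
    ring
  rw [e1, e2, add_zero]
  push_cast
  linear_combination (-(fokasCoeff j p l *
    ((Complex.I * rot j (2 * p - 1)) ^ (2 * j - (l : ℕ)) * (Complex.I * (-1)) * rot j (2 * p - 1) *
        rayWave j (rot j (2 * p - 1)) (-1) (2 * j - (l : ℕ) + (2 * j + 1)) (h l) x t -
      (Complex.I * rot j (2 * p)) ^ (2 * j - (l : ℕ)) * Complex.I * rot j (2 * p) *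
        rayWave j (rot j (2 * p)) 1 (2 * j - (l : ℕ) + (2 * j + 1)) (h l) x t))) * hs

lemma iteratedDeriv_eq_of_hasDerivAt {D : ℕ → ℝ → ℂ}
    (hD : ∀ n, ∀ x > 0, HasDerivAt (D n) (D (n + 1) x) x) (n : ℕ) :
    ∀ x > 0, iteratedDeriv n (D 0) x = D n x := by
  induction n with
  | zero => simp
  | succ n ih =>
    intro x hx
    rw [iteratedDeriv_succ, ← (hD n x hx).deriv]
    refine Filter.EventuallyEq.deriv_eq ?_
    filter_upwards [Ioi_mem_nhds hx] with y hy using ih y hy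

lemma contDiffOn_of_hasDerivAt {D : ℕ → ℝ → ℂ}
    (hD : ∀ n, ∀ x > 0, HasDerivAt (D n) (D (n + 1) x) x) (k : ℕ) :
    ∀ n, ContDiffOn ℝ k (D n) (Ioi 0) := by
  induction k with
  | zero =>
    intro n
    rw [Nat.cast_zero, contDiffOn_zero]
    exact fun x hx => (hD n x hx).continuousAt.continuousWithinAt
  | succ k ih =>
    intro n
    rw [Nat.cast_succ, contDiffOn_succ_iff_deriv_of_isOpen isOpen_Ioi]
    refine ⟨fun x hx => (hD n x hx).differentiableAt.differentiableWithinAt, by simp, ?_⟩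
    exact (ih (n + 1)).congr fun x hx => (hD n x hx).deriv

lemma tendsto_solutionDeriv (hh : IsBoundaryData h) (k : Fin j) (t : ℝ) :
    Tendsto (fun x => solutionDeriv h k x t) (𝓝[>] 0) (𝓝 (h k t)) := by
  have hlim : Tendsto (fun x => solutionDeriv h k x t) (𝓝[>] 0)
      (𝓝 (∑ p ∈ Finset.Icc 1 j, ∑ l : Fin j, fokasCoeff j p l *
    ((Complex.I * rot j (2 * p - 1)) ^ (2 * j - (l : ℕ) + k) * rot j (2 * p - 1) *
        rayWave j 0 (-1) (2 * j - (l : ℕ) + k) (h l) 0 t -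
      (Complex.I * rot j (2 * p)) ^ (2 * j - (l : ℕ) + k) * rot j (2 * p) *
        rayWave j 0 1 (2 * j - (l : ℕ) + k) (h l) 0 t))) := by
    unfold solutionDeriv
    refine tendsto_finsetSum _ fun p hp => tendsto_finsetSum _ fun l _ => ?_
    exact (((tendsto_rayWave_x_zero (hh l).1 (hh l).2 j (rot_odd_im_pos hp).le (by simp) _
      t).const_mul _).sub ((tendsto_rayWave_x_zero (hh l).1 (hh l).2 j (rot_even_im_pos hp).le
      (by simp) _ t).const_mul _)).const_mul _
  convert hlim using 2
  rw [Finset.sum_comm]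
  -- Since `rot j (2p-1) = rot j (2p) * rot j (-1)`, both rays of the sector carry the same power of
  -- `rot j (2p)`, and the remaining bracket is independent of `p`.
  have e : ∀ l : Fin j, ∑ p ∈ Finset.Icc 1 j, fokasCoeff j p l *
    ((Complex.I * rot j (2 * p - 1)) ^ (2 * j - (l : ℕ) + k) * rot j (2 * p - 1) *
        rayWave j 0 (-1) (2 * j - (l : ℕ) + k) (h l) 0 t -
      (Complex.I * rot j (2 * p)) ^ (2 * j - (l : ℕ) + k) * rot j (2 * p) *
        rayWave j 0 1 (2 * j - (l : ℕ) + k) (h l) 0 t) =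
      (∑ p ∈ Finset.Icc 1 j, fokasCoeff j p l * rot j (2 * p) ^ (2 * j - (l : ℕ) + k + 1)) *
        (Complex.I ^ (2 * j - (l : ℕ) + k) *
        (rot j (-1) ^ (2 * j - (l : ℕ) + k + 1) *
          rayWave j 0 (-1) (2 * j - (l : ℕ) + k) (h l) 0 t -
          rayWave j 0 1 (2 * j - (l : ℕ) + k) (h l) 0 t)) := by
    intro l
    rw [Finset.sum_mul]
    refine Finset.sum_congr rfl fun p _ => ?_
    rw [sub_eq_add_neg (2 * (p : ℤ)) 1, rot_add, mul_pow, mul_pow, mul_pow, pow_succ, pow_succ]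
    ring
  simp only [e, sum_fokasCoeff_mul_rot_pow, ite_mul, zero_mul, Finset.sum_ite_eq, Finset.mem_univ,
    if_true]
  have hk := k.2
  have e2 : 2 * j - (k : ℕ) + k = 2 * j := by omega
  have hpi : (Real.pi : ℂ) ≠ 0 := by exact_mod_cast Real.pi_ne_zero
  -- For `l = k` the exponent is `m`; this sign turns the difference of the two ray waves into minus
  -- their sum, ready for Fourier inversion.
  have e3 : rot j (-1) ^ (2 * j + 1) = -1 := by rw [rot_pow]; norm_num
  have hinv := rayWave_zero_add (hh k).1 (hh k).2 j t
  have hs : ((-1 : ℂ) ^ j) * (-1) ^ j = 1 := by rw [← mul_pow]; simp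
  rw [e2, e3, pow_mul, Complex.I_sq]
  have h3 : h k t = (2 * (Real.pi : ℂ))⁻¹ * (((2 * j + 1 : ℕ) : ℂ) *
      (rayWave j 0 1 (2 * j) (h k) 0 t + rayWave j 0 (-1) (2 * j) (h k) 0 t)) := by
    rw [hinv]
    field_simp
  rw [h3, pow_succ]
  linear_combination (-((2 * (Real.pi : ℂ))⁻¹ * (((2 * j + 1 : ℕ) : ℂ) *
      (rayWave j 0 1 (2 * j) (h k) 0 t + rayWave j 0 (-1) (2 * j) (h k) 0 t)))) * hs

lemma reducedSolution_initial (hh : IsBoundaryData h) {x : ℝ} (hx : 0 < x) :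
    reducedSolution h x 0 = 0 := by
  unfold reducedSolution
  refine Finset.sum_eq_zero fun p hp => Finset.sum_eq_zero fun l _ => ?_
  rw [sectorBoundaryIntegral_initial (hh l).1 (hh l).2 hp _ hx, mul_zero]

theorem isReducedSolution (hh : IsBoundaryData h) : IsReducedSolution h (reducedSolution h) := by
  have e : reducedSolution h = solutionDeriv h 0 := by
    ext x t
    exact reducedSolution_eq hh x t
  have hD : ∀ t n, ∀ x > 0, HasDerivAt ((fun n y => solutionDeriv h n y t) n)
      ((fun n y => solutionDeriv h n y t) (n + 1) x) x :=
    fun t n x hx => hasDerivAt_solutionDeriv hh n hx t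
  have hs : ((-1 : ℂ) ^ j) * (-1) ^ j = 1 := by rw [← mul_pow]; simp
  refine ⟨fun t _ => ?_, fun x hx t _ => ?_, fun x hx t _ => ?_, fun x hx => ⟨?_, ?_⟩,
    fun l t _ => ?_⟩
  · rw [e]
    exact contDiffOn_of_hasDerivAt (hD t) _ 0
  · rw [e]
    exact (hasDerivAt_solutionDeriv_zero_t hh hx.le t).differentiableAt
  · rw [e, (hasDerivAt_solutionDeriv_zero_t hh hx.le t).deriv,
      iteratedDeriv_eq_of_hasDerivAt (hD t) _ x hx]
    ring
  · exact reducedSolution_initial hh hx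
  · have h0 := reducedSolution_initial hh hx
    rw [e] at h0 ⊢
    -- The formula is differentiable in `t` on all of `ℝ`, so its value zero at `t = 0` is also the
    -- limit from the right.
    have := (hasDerivAt_solutionDeriv_zero_t hh hx.le 0).continuousAt.tendsto
    rw [h0] at this
    exact this.mono_left nhdsWithin_le_nhds
  · rw [e]
    refine (tendsto_solutionDeriv hh l t).congr' ?_
    filter_upwards [self_mem_nhdsWithin] with x hx
    exact (iteratedDeriv_eq_of_hasDerivAt (hD t) l x hx).symm

end ClassicalSolution

/-! ### Extensions with integrable transform and bounded weighted norm -/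

section Extensions

variable {X Y : Type*} [MeasureSpace X]

/-- On `U`, the function `u` is the superposition of the phases `e` with an integrable amplitude
whose weighted `L²` norm is at most `B`. -/
def HasExtension (w : X → ℝ≥0∞) (e : X → Y → ℂ) (U : Set Y) (u : Y → ℂ) (B : ℝ≥0∞) : Prop :=
  ∃ W : X → ℂ, Integrable W ∧ (∀ y ∈ U, ∫ q, W q * e q y = u y) ∧
    (∫⁻ q, w q * ‖W q‖ₑ ^ 2) ^ (1 / 2 : ℝ) ≤ B

variable {w : X → ℝ≥0∞} {e : X → Y → ℂ} {U : Set Y} {u v : Y → ℂ} {A B : ℝ≥0∞}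

lemma HasExtension.mono (h : HasExtension w e U u A) (hAB : A ≤ B) : HasExtension w e U u B := by
  obtain ⟨W, h1, h2, h3⟩ := h
  exact ⟨W, h1, h2, h3.trans hAB⟩

lemma HasExtension.zero : HasExtension w e U (fun _ => 0) 0 :=
  ⟨0, integrable_zero _ _ _, by simp, by simp⟩

lemma HasExtension.const_mul (c : ℂ) (h : HasExtension w e U u A) :
    HasExtension w e U (fun y => c * u y) (‖c‖ₑ * A) := by
  obtain ⟨W, h1, h2, h3⟩ := h
  refine ⟨fun q => c * W q, h1.const_mul c, fun y hy => ?_, ?_⟩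
  · simp only [mul_assoc, integral_const_mul, h2 y hy]
  · simp only [enorm_mul, mul_pow, mul_left_comm (w _)]
    rw [lintegral_const_mul' _ _ (by finiteness), ENNReal.mul_rpow_of_nonneg _ _ (by norm_num),
      ← ENNReal.rpow_natCast, ← ENNReal.rpow_mul]
    norm_num
    gcongr

lemma HasExtension.add (hw : Measurable w) (he : ∀ y, AEStronglyMeasurable fun q => e q y)
    (he1 : ∀ q y, ‖e q y‖ ≤ 1) (h : HasExtension w e U u A) (h' : HasExtension w e U v B) :
    HasExtension w e U (fun y => u y + v y) (A + B) := by
  obtain ⟨W, h1, h2, h3⟩ := h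
  obtain ⟨W', h1', h2', h3'⟩ := h'
  have hint : ∀ {Z : X → ℂ}, Integrable Z → ∀ y, Integrable fun q => Z q * e q y :=
    fun hZ y => hZ.mul_bdd (c := 1) (he y) (Eventually.of_forall fun q => he1 q y)
  refine ⟨fun q => W q + W' q, h1.add h1', fun y hy => ?_, ?_⟩
  · simp only [add_mul]
    rw [integral_add (hint h1 y) (hint h1' y), h2 y hy, h2' y hy]
  · have hsq : ∀ Z : X → ℂ, (∫⁻ q, w q * ‖Z q‖ₑ ^ 2) =
        ∫⁻ q, (w q ^ (1 / 2 : ℝ) * ‖Z q‖ₑ) ^ (2 : ℝ) := by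
      intro Z
      refine lintegral_congr fun q => ?_
      rw [ENNReal.mul_rpow_of_nonneg _ _ (by norm_num), ← ENNReal.rpow_mul]
      norm_num
    rw [hsq] at h3 h3' ⊢
    calc _ ≤ (∫⁻ q, ((fun q => w q ^ (1 / 2 : ℝ) * ‖W q‖ₑ) +
          fun q => w q ^ (1 / 2 : ℝ) * ‖W' q‖ₑ) q ^ (2 : ℝ)) ^ (1 / 2 : ℝ) := by
          gcongr with q
          rw [Pi.add_apply, ← mul_add]
          gcongr
          exact enorm_add_le _ _
      _ ≤ _ := ENNReal.lintegral_Lp_add_le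
          ((hw.pow_const _).aemeasurable.mul h1.aestronglyMeasurable.enorm)
          ((hw.pow_const _).aemeasurable.mul h1'.aestronglyMeasurable.enorm) (by norm_num)
      _ ≤ _ := add_le_add h3 h3'

lemma HasExtension.sum (hw : Measurable w) (he : ∀ y, AEStronglyMeasurable fun q => e q y)
    (he1 : ∀ q y, ‖e q y‖ ≤ 1) {ι : Type*} (s : Finset ι) {u : ι → Y → ℂ} {B : ι → ℝ≥0∞}
    (h : ∀ i ∈ s, HasExtension w e U (u i) (B i)) :
    HasExtension w e U (fun y => ∑ i ∈ s, u i y) (∑ i ∈ s, B i) := by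
  classical
  induction s using Finset.induction_on with
  | empty => simpa using HasExtension.zero
  | insert i s hi ih =>
    simp only [Finset.sum_insert hi]
    exact (h i (Finset.mem_insert_self _ _)).add hw he he1
      (ih fun k hk => h k (Finset.mem_insert_of_mem hk))

/-- Fubini, available because the amplitude is integrable and the phases are bounded: pointwise
inversion on `U` thereby becomes an identity of distributions. -/
lemma integral_mul_integral_phase [SFinite (volume : Measure X)] [MeasureSpace Y]
    [SFinite (volume : Measure Y)] {W : X → ℂ} {φ : Y → ℂ} (hW : Integrable W) (hφ : Integrable φ)
    (he : AEStronglyMeasurable (Function.uncurry e) (volume.prod volume))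
    (he1 : ∀ q y, ‖e q y‖ ≤ 1) :
    ∫ q, W q * ∫ y, e q y * φ y = ∫ y, φ y * ∫ q, W q * e q y := by
  simp only [← integral_const_mul]
  rw [integral_integral_swap]
  · congr 1
    ext y
    congr 1
    ext q
    ring
  · refine ((hW.mul_prod hφ).mul_bdd (c := 1) he
      (Eventually.of_forall fun q => he1 q.1 q.2)).congr (Eventually.of_forall fun q => ?_)
    simp only [Function.uncurry]
    ring

end Extensions

/-! ### Concrete phases and weights, and the passage to restriction norms -/

/-- The phases `e^{iξx}`. -/
def linePhase (ξ x : ℝ) : ℂ := Complex.exp (Complex.I * (ξ : ℂ) * (x : ℂ))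

/-- The phases `e^{i(ξx+τt)}`. -/
def planePhase (q y : ℝ × ℝ) : ℂ :=
  Complex.exp (Complex.I * ((q.1 : ℂ) * (y.1 : ℂ) + (q.2 : ℂ) * (y.2 : ℂ)))

lemma norm_linePhase (ξ x : ℝ) : ‖linePhase ξ x‖ = 1 := by
  unfold linePhase
  rw [Complex.norm_exp]
  simp

lemma norm_planePhase (q y : ℝ × ℝ) : ‖planePhase q y‖ = 1 := by
  unfold planePhase
  rw [Complex.norm_exp]
  simp

/-- The weight of the norm of `H^s(ℝ)`. -/
def lineWeight (s : ℝ) (ξ : ℝ) : ℝ≥0∞ := ENNReal.ofReal ((1 + |ξ|) ^ (2 * s))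

/-- The weight of the norm of `X^{s,b,α}(ℝ²)`. -/
def planeWeight (m : ℕ) (s b α : ℝ) (q : ℝ × ℝ) : ℝ≥0∞ :=
  ENNReal.ofReal ((1 + |q.1|) ^ (2 * s) * (1 + |q.2 - q.1 ^ m|) ^ (2 * b)) +
    (Icc (-1 : ℝ) 1 ×ˢ (univ : Set ℝ)).indicator
      (fun q => ENNReal.ofReal ((1 + |q.2|) ^ (2 * α))) q

lemma measurable_lineWeight (s : ℝ) : Measurable (lineWeight s) := by
  unfold lineWeight
  fun_prop

lemma measurable_planeWeight (m : ℕ) (s b α : ℝ) : Measurable (planeWeight m s b α) := by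
  unfold planeWeight
  have h1 : Measurable fun q : ℝ × ℝ =>
    ENNReal.ofReal ((1 + |q.1|) ^ (2 * s) * (1 + |q.2 - q.1 ^ m|) ^ (2 * b)) := by fun_prop
  have h2 : Measurable fun q : ℝ × ℝ => ENNReal.ofReal ((1 + |q.2|) ^ (2 * α)) := by fun_prop
  exact h1.add (h2.indicator (measurableSet_Icc.prod MeasurableSet.univ))

lemma halfLineSobolevNorm_le {s : ℝ} {u : ℝ → ℂ} {B : ℝ≥0∞}
    (h : HasExtension (lineWeight s) linePhase (Ioi 0) (fun x => 2 * (Real.pi : ℂ) * u x) B) :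
    halfLineSobolevNorm s u ≤ B := by
  obtain ⟨W, h1, h2, h3⟩ := h
  refine iInf_le_of_le W (iInf_le_of_le h1.aestronglyMeasurable (iInf_le_of_le ?_ h3))
  intro φ hφ hc hs
  have key := integral_mul_integral_phase (e := linePhase) h1
    (hφ.continuous.integrable_of_hasCompactSupport hc)
    (Continuous.aestronglyMeasurable (by unfold linePhase; fun_prop))
    (fun q y => (norm_linePhase q y).le)
  change _ = _ * ∫ ξ : ℝ, W ξ * ∫ x : ℝ, linePhase ξ x * φ x
  rw [key, ← integral_const_mul]
  congr 1
  ext x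
  have hpi : (Real.pi : ℂ) ≠ 0 := by exact_mod_cast Real.pi_ne_zero
  by_cases hx : x ∈ Ioi (0 : ℝ)
  · rw [h2 x hx]
    field_simp
  · rw [image_eq_zero_of_notMem_tsupport (fun h => hx (hs h))]
    simp

lemma bourgainRestrictionNorm_le {m : ℕ} {s b α T : ℝ} {u : ℝ → ℝ → ℂ} {B : ℝ≥0∞}
    (h : HasExtension (planeWeight m s b α) planePhase (Ioi (0 : ℝ) ×ˢ Ioo 0 T)
      (fun y => (2 * (Real.pi : ℂ)) ^ 2 * u y.1 y.2) B) :
    bourgainRestrictionNorm m s b α T u ≤ B := by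
  obtain ⟨V, h1, h2, h3⟩ := h
  refine iInf_le_of_le V (iInf_le_of_le h1.aestronglyMeasurable (iInf_le_of_le ?_ ?_))
  · intro φ hφ hc hs
    have key := integral_mul_integral_phase (e := planePhase) h1
      (hφ.continuous.integrable_of_hasCompactSupport hc)
      (Continuous.aestronglyMeasurable (by unfold planePhase; fun_prop))
      (fun q y => (norm_planePhase q y).le)
    change _ = _ * ∫ q : ℝ × ℝ, V q * ∫ y : ℝ × ℝ, planePhase q y * φ y
    rw [key, ← integral_const_mul]
    congr 1
    ext y
    have hpi : (Real.pi : ℂ) ≠ 0 := by exact_mod_cast Real.pi_ne_zero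
    by_cases hy : y ∈ Ioi (0 : ℝ) ×ˢ Ioo 0 T
    · rw [h2 y hy]
      field_simp
    · rw [image_eq_zero_of_notMem_tsupport (fun h => hy (hs h))]
      simp
  · refine le_trans (le_of_eq ?_) h3
    unfold bourgainFourierNorm planeWeight
    simp only [add_mul]
    rw [lintegral_add_left', ← lintegral_indicator (measurableSet_Icc.prod MeasurableSet.univ)]
    · congr 3
      ext q
      by_cases hq : q ∈ Icc (-1 : ℝ) 1 ×ˢ (univ : Set ℝ)
      · rw [indicator_of_mem hq, indicator_of_mem hq]
      · rw [indicator_of_notMem hq, indicator_of_notMem hq, zero_mul]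
    · exact AEMeasurable.mul (by fun_prop) (h1.aestronglyMeasurable.enorm.pow_const 2)

/-! ### Schur's test -/

/-- Split `K = K^{1/2} K^{1/2}`, apply Cauchy–Schwarz in `y`, and exchange the integrals. -/
lemma lintegral_sq_le_of_schur {X Y : Type*} [MeasurableSpace X] [MeasurableSpace Y]
    {μ : Measure X} {ν : Measure Y} [SFinite μ] [SFinite ν] {K : X → Y → ℝ≥0∞} {F : Y → ℝ≥0∞}
    (hK : Measurable (Function.uncurry K)) (hF : Measurable F) {A B : ℝ≥0∞}
    (hA : ∀ x, ∫⁻ y, K x y ∂ν ≤ A) (hB : ∀ y, ∫⁻ x, K x y ∂μ ≤ B) :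
    ∫⁻ x, (∫⁻ y, K x y * F y ∂ν) ^ 2 ∂μ ≤ A * B * ∫⁻ y, F y ^ 2 ∂ν := by
  have hKx : ∀ x, Measurable (K x) := fun x => hK.comp measurable_prodMk_left
  have hKy : ∀ y, Measurable fun x => K x y := fun y => hK.comp measurable_prodMk_right
  have hpt : ∀ x, (∫⁻ y, K x y * F y ∂ν) ^ 2 ≤ A * ∫⁻ y, K x y * F y ^ 2 ∂ν := by
    intro x
    have h := ENNReal.lintegral_mul_le_Lp_mul_Lq ν Real.HolderConjugate.two_two
      (f := fun y => K x y ^ (1 / 2 : ℝ)) (g := fun y => K x y ^ (1 / 2 : ℝ) * F y)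
      ((hKx x).pow_const _).aemeasurable (((hKx x).pow_const _).mul hF).aemeasurable
    have e1 : ∀ y, ((fun y => K x y ^ (1 / 2 : ℝ)) * fun y => K x y ^ (1 / 2 : ℝ) * F y) y =
        K x y * F y := by
      intro y
      rw [Pi.mul_apply, ← mul_assoc, ← ENNReal.rpow_add_of_nonneg _ _ (by norm_num) (by norm_num)]
      norm_num
    have e2 : ∀ y, (K x y ^ (1 / 2 : ℝ)) ^ (2 : ℝ) = K x y := by
      intro y
      rw [← ENNReal.rpow_mul]
      norm_num
    have e3 : ∀ y, (K x y ^ (1 / 2 : ℝ) * F y) ^ (2 : ℝ) = K x y * F y ^ 2 := by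
      intro y
      rw [ENNReal.mul_rpow_of_nonneg _ _ (by norm_num), e2]
      norm_cast
    simp only [e1, e2, e3] at h
    have e4 : ∀ a : ℝ≥0∞, (a ^ (1 / 2 : ℝ)) ^ 2 = a := by
      intro a
      rw [← ENNReal.rpow_natCast, ← ENNReal.rpow_mul]
      norm_num
    calc _ ≤ ((∫⁻ y, K x y ∂ν) ^ (1 / 2 : ℝ) * (∫⁻ y, K x y * F y ^ 2 ∂ν) ^ (1 / 2 : ℝ)) ^ 2 := by
          gcongr
      _ = (∫⁻ y, K x y ∂ν) * ∫⁻ y, K x y * F y ^ 2 ∂ν := by rw [mul_pow, e4, e4]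
      _ ≤ _ := by gcongr; exact hA x
  have hKF : Measurable (Function.uncurry fun x y => K x y * F y ^ 2) :=
    hK.mul ((hF.comp measurable_snd).pow_const 2)
  calc _ ≤ ∫⁻ x, A * ∫⁻ y, K x y * F y ^ 2 ∂ν ∂μ := lintegral_mono hpt
    _ = A * ∫⁻ x, ∫⁻ y, K x y * F y ^ 2 ∂ν ∂μ :=
        lintegral_const_mul _ (Measurable.lintegral_prod_right hKF)
    _ = A * ∫⁻ y, ∫⁻ x, K x y * F y ^ 2 ∂μ ∂ν := by
        rw [lintegral_lintegral_swap hKF.aemeasurable]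
    _ ≤ A * ∫⁻ y, B * F y ^ 2 ∂ν := by
        gcongr with y
        rw [lintegral_mul_const _ (hKy y)]
        gcongr
        exact hB y
    _ = _ := by rw [lintegral_const_mul _ (hF.pow_const 2), mul_assoc]

/-- The kernel `r⁻¹ k(ξ/r)` with `k(η) = η²/(1+η²)²`. -/
def dilationKernel (ξ r : ℝ) : ℝ≥0∞ := ENNReal.ofReal (r * ξ ^ 2 / (r ^ 2 + ξ ^ 2) ^ 2)

lemma measurable_dilationKernel : Measurable (Function.uncurry dilationKernel) := by
  unfold dilationKernel Function.uncurry
  fun_prop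

lemma lintegral_inv_one_add_div_sq {r : ℝ} (hr : 0 < r) :
    ∫⁻ ξ : ℝ, ENNReal.ofReal ((1 + (ξ / r) ^ 2)⁻¹) = ENNReal.ofReal (r * Real.pi) := by
  rw [← ofReal_integral_eq_lintegral_ofReal (integrable_inv_one_add_sq.comp_div hr.ne')
    (Eventually.of_forall fun ξ => by positivity)]
  rw [MeasureTheory.Measure.integral_comp_div (fun η : ℝ => (1 + η ^ 2)⁻¹), abs_of_pos hr,
    integral_univ_inv_one_add_sq, smul_eq_mul]

lemma lintegral_dilationKernel_left {r : ℝ} (hr : 0 < r) :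
    ∫⁻ ξ : ℝ, dilationKernel ξ r ≤ ENNReal.ofReal Real.pi := by
  calc _ ≤ ∫⁻ ξ : ℝ, ENNReal.ofReal r⁻¹ * ENNReal.ofReal ((1 + (ξ / r) ^ 2)⁻¹) := by
        refine lintegral_mono fun ξ => ?_
        unfold dilationKernel
        rw [← ENNReal.ofReal_mul (by positivity)]
        refine ENNReal.ofReal_le_ofReal ?_
        have e : r⁻¹ * (1 + (ξ / r) ^ 2)⁻¹ = r * (r ^ 2 + ξ ^ 2) / (r ^ 2 + ξ ^ 2) ^ 2 := by
          field_simp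
        rw [e]
        gcongr
        nlinarith [sq_nonneg r]
    _ = _ := by
        rw [lintegral_const_mul' _ _ ENNReal.ofReal_ne_top, lintegral_inv_one_add_div_sq hr,
          ← ENNReal.ofReal_mul (by positivity), inv_mul_cancel_left₀ hr.ne']

/-- By homogeneity this is `∫ k(η) dη/η`, finite only because `k` vanishes at `0`. For `ξ ≠ 0` the
explicit primitive gives `1/2`. -/
lemma lintegral_dilationKernel_right (ξ : ℝ) :
    ∫⁻ r in Ioi (0 : ℝ), dilationKernel ξ r ≤ 1 := by
  rcases eq_or_ne ξ 0 with rfl | hξ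
  · simp [dilationKernel]
  have hd : ∀ r ∈ Ici (0 : ℝ), HasDerivAt (fun r : ℝ => -(ξ ^ 2 / 2) * (r ^ 2 + ξ ^ 2)⁻¹)
      (r * ξ ^ 2 / (r ^ 2 + ξ ^ 2) ^ 2) r := by
    intro r _
    have h0 : r ^ 2 + ξ ^ 2 ≠ 0 := by positivity
    have h1 : HasDerivAt (fun r : ℝ => r ^ 2 + ξ ^ 2) (2 * r) r := by
      simpa using (hasDerivAt_pow 2 r).add_const (ξ ^ 2)
    exact ((h1.fun_inv h0).const_mul (-(ξ ^ 2 / 2))).congr_deriv (by field_simp)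
  have hpos : ∀ r ∈ Ioi (0 : ℝ), 0 ≤ r * ξ ^ 2 / (r ^ 2 + ξ ^ 2) ^ 2 := by
    intro r hr
    have : 0 < r := hr
    positivity
  have hlim : Tendsto (fun r : ℝ => -(ξ ^ 2 / 2) * (r ^ 2 + ξ ^ 2)⁻¹) atTop (𝓝 0) := by
    have : Tendsto (fun r : ℝ => r ^ 2 + ξ ^ 2) atTop atTop :=
      tendsto_atTop_add_const_right _ _ (tendsto_pow_atTop two_ne_zero)
    simpa using this.inv_tendsto_atTop.const_mul (-(ξ ^ 2 / 2))
  have hi := integrableOn_Ioi_deriv_of_nonneg' hd hpos hlim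
  have hv := integral_Ioi_of_hasDerivAt_of_nonneg' hd hpos hlim
  unfold dilationKernel
  rw [← ofReal_integral_eq_lintegral_ofReal hi
    ((ae_restrict_iff' measurableSet_Ioi).2 (Eventually.of_forall hpos)), hv,
    ENNReal.ofReal_le_one]
  field_simp
  nlinarith [sq_nonneg ξ]

/-! ### The change of variable `τ = ± r^m` -/

lemma lintegral_Ioi_comp_pow (j : ℕ) (F : ℝ → ℝ≥0∞) :
    ∫⁻ r in Ioi (0 : ℝ), ENNReal.ofReal ((2 * j + 1 : ℕ) * r ^ (2 * j)) * F (r ^ (2 * j + 1)) =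
      ∫⁻ l in Ioi (0 : ℝ), F l := by
  have himg : (fun r : ℝ => r ^ (2 * j + 1)) '' Ioi 0 = Ioi 0 := by
    ext y
    constructor
    · rintro ⟨r, hr, rfl⟩
      exact pow_pos (mem_Ioi.1 hr) _
    · intro hy
      have hy : 0 < y := hy
      refine ⟨y ^ (((2 * j + 1 : ℕ) : ℝ)⁻¹), Real.rpow_pos_of_pos hy _, ?_⟩
      exact Real.rpow_inv_natCast_pow hy.le (by omega)
  have h := lintegral_image_eq_lintegral_abs_deriv_mul (s := Ioi (0 : ℝ))
    (f := fun r => r ^ (2 * j + 1)) (f' := fun r => (2 * j + 1 : ℕ) * r ^ (2 * j))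
    measurableSet_Ioi
    (fun r _ => by simpa using (hasDerivAt_pow (2 * j + 1) r).hasDerivWithinAt)
    (fun a ha b hb hab => (pow_left_inj₀ (le_of_lt ha) (le_of_lt hb) (by omega)).1 hab) F
  rw [himg] at h
  rw [h]
  refine setLIntegral_congr_fun measurableSet_Ioi fun r hr => ?_
  have : 0 < r := hr
  rw [abs_of_nonneg (by positivity)]

lemma sign_cases {ε : ℝ} (hε : |ε| = 1) : ε = 1 ∨ ε = -1 := by
  rcases abs_choice ε with h | h
  · left; linarith
  · right; linarith

lemma lintegral_comp_sign_mul {ε : ℝ} (hε : |ε| = 1) (F : ℝ → ℝ≥0∞) :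
    ∫⁻ l : ℝ, F (ε * l) = ∫⁻ l : ℝ, F l := by
  rcases sign_cases hε with rfl | rfl
  · simp
  · simp only [neg_one_mul]
    exact lintegral_neg_eq_self (μ := volume) F

lemma integral_comp_sign_mul {ε : ℝ} (hε : |ε| = 1) (F : ℝ → ℂ) :
    ∫ l : ℝ, F (ε * l) = ∫ l : ℝ, F l := by
  rcases sign_cases hε with rfl | rfl
  · simp
  · simp only [neg_one_mul]
    exact integral_neg_eq_self F volume

/-- The quantities `(1+r)^m` and `1+r^m` are comparable in both directions; the sign of `τ` decides
which direction is needed. -/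
lemma one_add_rpow_le (j : ℕ) {r : ℝ} (hr : 0 ≤ r) (τ : ℝ) :
    (1 + r) ^ ((2 * j + 1 : ℕ) * τ) ≤
      (2 ^ (2 * j + 1 : ℕ) : ℝ) ^ |τ| * (1 + r ^ (2 * j + 1)) ^ τ := by
  rw [Real.rpow_mul (by positivity), Real.rpow_natCast]
  have h1 : 1 + r ^ (2 * j + 1) ≤ (1 + r) ^ (2 * j + 1) := by
    simpa using pow_add_pow_le zero_le_one hr (n := 2 * j + 1) (by omega)
  have h2 : (1 + r) ^ (2 * j + 1) ≤ 2 ^ (2 * j + 1) * (1 + r ^ (2 * j + 1)) := by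
    have := add_pow_le zero_le_one hr (2 * j + 1)
    rw [one_pow] at this
    refine this.trans ?_
    gcongr
    · norm_num
    · omega
  rcases le_total 0 τ with h | h
  · rw [abs_of_nonneg h, ← Real.mul_rpow (by positivity) (by positivity)]
    gcongr
  · calc _ ≤ (1 + r ^ (2 * j + 1)) ^ τ := Real.rpow_le_rpow_of_nonpos (by positivity) h1 h
      _ ≤ _ := le_mul_of_one_le_left (by positivity)
          (Real.one_le_rpow (one_le_pow₀ (by norm_num)) (abs_nonneg _))

/-- The `H^σ` norm read along a ray: with `λ = εr^m`, the Jacobian gives `r^{2j}` and the weight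
becomes a power of `1+r`. -/
lemma exists_lintegral_ray_le (j : ℕ) (σ : ℝ) : ∃ c : ℝ≥0, ∀ ε : ℝ, |ε| = 1 → ∀ W : ℝ → ℂ,
    ∫⁻ r in Ioi (0 : ℝ), ENNReal.ofReal (r ^ (2 * j) * (1 + r) ^ ((2 * j + 1 : ℕ) * (2 * σ))) *
      ‖W (ε * r ^ (2 * j + 1))‖ₑ ^ 2 ≤ c * sobolevFourierNorm σ W ^ 2 := by
  refine ⟨Real.toNNReal ((2 ^ (2 * j + 1 : ℕ) : ℝ) ^ |2 * σ|), fun ε hε W => ?_⟩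
  rw [sobolevFourierNorm_sq, ← lintegral_comp_sign_mul hε]
  change _ ≤ ENNReal.ofReal _ * _
  rw [← lintegral_const_mul' _ _ ENNReal.ofReal_ne_top]
  refine le_trans ?_ (setLIntegral_le_lintegral (Ioi (0 : ℝ)) _)
  rw [← lintegral_Ioi_comp_pow j (fun l => ENNReal.ofReal ((2 ^ (2 * j + 1 : ℕ) : ℝ) ^ |2 * σ|) *
    (ENNReal.ofReal ((1 + |ε * l|) ^ (2 * σ)) * ‖W (ε * l)‖ₑ ^ 2))]
  refine setLIntegral_mono' measurableSet_Ioi fun r hr => ?_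
  have hr : 0 < r := hr
  rw [← mul_assoc (ENNReal.ofReal _) (ENNReal.ofReal _), ← ENNReal.ofReal_mul (by positivity),
    ← mul_assoc (ENNReal.ofReal _) (ENNReal.ofReal _), ← ENNReal.ofReal_mul (by positivity)]
  refine mul_le_mul' (ENNReal.ofReal_le_ofReal ?_) le_rfl
  rw [abs_mul ε, hε, one_mul, abs_of_pos (pow_pos hr _), mul_assoc (((2 * j + 1 : ℕ) : ℝ) * _)]
  have h1 : r ^ (2 * j) ≤ ((2 * j + 1 : ℕ) : ℝ) * r ^ (2 * j) :=
    le_mul_of_one_le_left (by positivity) (by exact_mod_cast Nat.le_add_left 1 (2 * j))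
  exact mul_le_mul h1 (one_add_rpow_le j hr.le _) (by positivity) (by positivity)

/-! ### Weights at the scale of a ray -/

/-- The function `|η|/(1+|η|)²`. -/
def damp (η : ℝ) : ℝ := |η| / (1 + |η|) ^ 2

lemma damp_nonneg (η : ℝ) : 0 ≤ damp η := by
  unfold damp
  positivity

lemma damp_pos {η : ℝ} (hη : η ≠ 0) : 0 < damp η := by
  unfold damp
  positivity

lemma one_add_mul_damp_le (η : ℝ) : (1 + |η|) * damp η ≤ 1 := by
  unfold damp
  have := abs_nonneg η
  rw [mul_div_assoc', div_le_one (by positivity)]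
  nlinarith

lemma damp_le_one (η : ℝ) : damp η ≤ 1 :=
  (le_mul_of_one_le_left (damp_nonneg η) (by linarith [abs_nonneg η])).trans
    (one_add_mul_damp_le η)

lemma damp_le_abs (η : ℝ) : damp η ≤ |η| := by
  unfold damp
  have := abs_nonneg η
  rw [div_le_iff₀ (by positivity)]
  nlinarith [mul_nonneg this this, mul_nonneg (mul_nonneg this this) this]

/-- On the strip `|ξ| = r|η| ≤ 1` a large `r` forces a small `η`, so each factor `damp η` pays for a
factor `1+r`. -/
lemma one_add_mul_damp_le_of_mul_le {r η : ℝ} (h : r * |η| ≤ 1) : (1 + r) * damp η ≤ 1 := by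
  unfold damp
  have := abs_nonneg η
  rw [mul_div_assoc', div_le_one (by positivity)]
  nlinarith

/-- Transfers a weight in `ξ = rη` to the scale `r`. For `s ≥ 0`, `1+r|η| ≤ (1+r)(1+|η|)` and `damp`
absorbs `1+|η|`, by its decay; for `s ≤ 0`, `(1+r) damp η ≤ 1+r|η|`, by its zero at the origin. -/
lemma rpow_mul_damp_pow_le {s : ℝ} {n : ℕ} (hn : |s| ≤ n) {r η : ℝ} (hr : 0 < r) (hη : η ≠ 0) :
    (1 + |r * η|) ^ s * damp η ^ n ≤ (1 + r) ^ s := by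
  have hd := damp_pos hη
  have hd1 := damp_le_one η
  have h0 := abs_nonneg η
  have h1 : damp η ^ n ≤ damp η ^ |s| := by
    rw [← Real.rpow_natCast]
    exact Real.rpow_le_rpow_of_exponent_ge hd hd1 hn
  rw [abs_mul, abs_of_pos hr]
  refine (mul_le_mul_of_nonneg_left h1 (by positivity)).trans ?_
  rcases le_total 0 s with h | h
  · rw [abs_of_nonneg h, ← Real.mul_rpow (by positivity) hd.le]
    refine Real.rpow_le_rpow (by positivity) ?_ h
    calc (1 + r * |η|) * damp η ≤ ((1 + r) * (1 + |η|)) * damp η := by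
          gcongr
          nlinarith
      _ = (1 + r) * ((1 + |η|) * damp η) := by ring
      _ ≤ (1 + r) * 1 := by
          gcongr
          exact one_add_mul_damp_le η
      _ = _ := mul_one _
  · rw [abs_of_nonpos h, Real.rpow_neg hd.le, ← Real.inv_rpow hd.le,
      ← Real.mul_rpow (by positivity) (by positivity)]
    refine Real.rpow_le_rpow_of_nonpos (by positivity) ?_ h
    rw [← div_eq_mul_inv, le_div_iff₀ hd]
    have := damp_le_abs η
    nlinarith

lemma profile_bound_eq (K : ℕ) (η : ℝ) :
    |η| ^ K / (1 + |η|) ^ (2 * K + 2) = damp η ^ K / (1 + |η|) ^ 2 := by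
  unfold damp
  rw [div_pow, ← pow_mul, div_div, ← pow_add]

lemma one_add_sq_le (η : ℝ) : 1 + η ^ 2 ≤ (1 + |η|) ^ 2 := by
  nlinarith [sq_abs η, abs_nonneg η]

/-- The profile of the extension from the half-line, of order `K`. -/
structure IsProfile (ρ : ℂ) (K : ℕ) (C : ℝ) (Φ : ℝ → ℂ) : Prop where
  pos : 0 < C
  continuous : Continuous Φ
  bound : ∀ η, ‖Φ η‖ ≤ C * (damp η ^ K / (1 + |η|) ^ 2)
  inversion : ∀ x : ℝ, x > 0 → ∫ η : ℝ, Complex.exp (Complex.I * η * x) * Φ η =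
    2 * (Real.pi : ℂ) * Complex.exp (Complex.I * ρ * x)

lemma exists_isProfile {ρ : ℂ} (hρ : 0 < ρ.im) (K : ℕ) : ∃ C Φ, IsProfile ρ K C Φ := by
  obtain ⟨Φ, h1, ⟨C, h2, h3⟩, h4⟩ := exists_profile hρ K
  exact ⟨C, Φ, h2, h1, fun η => by rw [← profile_bound_eq]; exact h3 η, h4⟩

namespace IsProfile

variable {ρ : ℂ} {K : ℕ} {C : ℝ} {Φ : ℝ → ℂ}

lemma bound' (h : IsProfile ρ K C Φ) (η : ℝ) : ‖Φ η‖ ≤ C * (1 + η ^ 2)⁻¹ := by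
  have hC := h.pos
  have hd := pow_le_one₀ (damp_nonneg η) (damp_le_one η) (n := K)
  refine (h.bound η).trans ?_
  rw [← one_div]
  gcongr
  exact one_add_sq_le η

lemma integrable (h : IsProfile ρ K C Φ) : Integrable Φ :=
  (integrable_inv_one_add_sq.const_mul C).mono' h.continuous.aestronglyMeasurable
    (Eventually.of_forall h.bound')

lemma apply_zero (h : IsProfile ρ K C Φ) (hK : K ≠ 0) : Φ 0 = 0 := by
  have := h.bound 0
  simpa [damp, hK] using this

lemma integral_dilate (h : IsProfile ρ K C Φ) {r x : ℝ} (hr : 0 < r) (hx : 0 < x) :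
    ∫ ξ : ℝ, Φ (ξ / r) * linePhase ξ x =
      r * (2 * (Real.pi : ℂ) * Complex.exp (Complex.I * ρ * r * x)) := by
  have h1 := MeasureTheory.Measure.integral_comp_div
    (fun η : ℝ => Complex.exp (Complex.I * η * (r * x : ℝ)) * Φ η) r
  rw [h.inversion (r * x) (mul_pos hr hx), abs_of_pos hr, Complex.real_smul] at h1
  push_cast at h1
  rw [mul_assoc _ (r : ℂ) (x : ℂ), ← h1]
  congr 1
  ext ξ
  have hr' : (r : ℂ) ≠ 0 := by exact_mod_cast hr.ne'
  unfold linePhase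
  rw [mul_comm]
  congr 2
  field_simp

lemma integral_norm_dilate (Φ : ℝ → ℂ) {r : ℝ} (hr : 0 < r) :
    ∫ ξ : ℝ, ‖Φ (ξ / r)‖ = r * ∫ η : ℝ, ‖Φ η‖ := by
  rw [MeasureTheory.Measure.integral_comp_div (fun η : ℝ => ‖Φ η‖), abs_of_pos hr, smul_eq_mul]

/-- The weighted profile is dominated by the dilation kernel. -/
lemma line_bound {s : ℝ} {n : ℕ} (hn : |s| ≤ n) (h : IsProfile ρ (n + 2) C Φ) {r : ℝ} (hr : 0 < r)
    (ξ : ℝ) : (1 + |ξ|) ^ s * (r⁻¹ * ‖Φ (ξ / r)‖) ≤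
      C * (1 + r) ^ s * (r * ξ ^ 2 / (r ^ 2 + ξ ^ 2) ^ 2) := by
  have hC := h.pos
  rcases eq_or_ne ξ 0 with rfl | hξ
  · rw [zero_div, h.apply_zero (by omega)]
    simp
  obtain ⟨η, rfl⟩ : ∃ η, ξ = r * η := ⟨ξ / r, by field_simp⟩
  have hη : η ≠ 0 := by rintro rfl; simp at hξ
  rw [mul_div_cancel_left₀ _ hr.ne']
  have h1 := rpow_mul_damp_pow_le hn hr hη
  -- Of the `n+2` factors `damp η`, `n` absorb the Sobolev weight and two give the numerator of the
  -- kernel.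
  have h2 : damp η ^ 2 / (1 + |η|) ^ 2 ≤ η ^ 2 / (1 + η ^ 2) ^ 2 := by
    unfold damp
    rw [div_pow, sq_abs, div_div, ← pow_mul, ← pow_add]
    gcongr
    calc (1 + η ^ 2) ^ 2 ≤ ((1 + |η|) ^ 2) ^ 2 := by
          gcongr
          exact one_add_sq_le η
      _ = (1 + |η|) ^ 4 := by rw [← pow_mul]
      _ ≤ _ := pow_le_pow_right₀ (by linarith [abs_nonneg η]) (by norm_num)
  have h3 : r * (r * η) ^ 2 / (r ^ 2 + (r * η) ^ 2) ^ 2 = r⁻¹ * (η ^ 2 / (1 + η ^ 2) ^ 2) := by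
    have : r ^ 2 + (r * η) ^ 2 = r ^ 2 * (1 + η ^ 2) := by ring
    rw [this]
    field_simp
  rw [h3]
  calc _ ≤ (1 + |r * η|) ^ s * (r⁻¹ * (C * (damp η ^ (n + 2) / (1 + |η|) ^ 2))) := by
        gcongr
        exact h.bound η
    _ = C * ((1 + |r * η|) ^ s * damp η ^ n) * (r⁻¹ * (damp η ^ 2 / (1 + |η|) ^ 2)) := by
        rw [pow_add]; ring
    _ ≤ _ := by
        have := damp_nonneg η
        gcongr

lemma sq_bound (h : IsProfile ρ K C Φ) (η : ℝ) :
    ‖Φ η‖ ^ 2 ≤ damp η ^ K * (C ^ 2 * (1 + η ^ 2)⁻¹) := by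
  have hC := h.pos
  have hd0 := damp_nonneg η
  have hd := pow_le_one₀ hd0 (damp_le_one η) (n := K)
  have h1 : (1 : ℝ) ≤ (1 + |η|) ^ 2 := one_le_pow₀ (by linarith [abs_nonneg η])
  calc _ = ‖Φ η‖ * ‖Φ η‖ := by ring
    _ ≤ (C * (damp η ^ K / (1 + |η|) ^ 2)) * (C * (1 + η ^ 2)⁻¹) :=
        mul_le_mul (h.bound η) (h.bound' η) (norm_nonneg _) (by positivity)
    _ ≤ (C * (damp η ^ K / 1)) * (C * (1 + η ^ 2)⁻¹) := by gcongr
    _ = _ := by ring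

/-- The order `M = n + m + k` is a budget of factors `damp η`: `n` for the weight in `ξ`, `m` for
the modulation weight, where `2b < 1` allows the power `1`, and `k` for the weight `(1+|τ|)^{2α}` on
the strip `|ξ| ≤ 1`. The constant `3` is `2 + 1` from the two weights. -/
lemma plane_bound (j : ℕ) {s b α : ℝ} (hb : b < 1 / 2) (hα : 0 < α) {n k : ℕ}
    (hn : |2 * s| ≤ n) (hk : 2 * α * (2 * j + 1 : ℕ) - (2 * s + (2 * j + 1 : ℕ)) ≤ k) {M : ℕ}
    (hM : M = n + (2 * j + 1) + k) (h : IsProfile ρ M C Φ) {r : ℝ} (hr : 0 < r) {ε : ℝ}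
    (hε : |ε| = 1) (ξ : ℝ) :
    planeWeight (2 * j + 1) s b α (ξ, ε * r ^ (2 * j + 1)) * ‖Φ (ξ / r)‖ₑ ^ 2 ≤
      ENNReal.ofReal (3 * C ^ 2 * (1 + r) ^ (2 * s + (2 * j + 1 : ℕ)) *
        (1 + (ξ / r) ^ 2)⁻¹) := by
  have hC := h.pos
  rcases eq_or_ne ξ 0 with rfl | hξ
  · rw [zero_div, h.apply_zero (by omega)]
    simp
  obtain ⟨η, rfl⟩ : ∃ η, ξ = r * η := ⟨ξ / r, by field_simp⟩
  have hη : η ≠ 0 := by rintro rfl; simp at hξ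
  rw [mul_div_cancel_left₀ _ hr.ne']
  have hd := damp_pos hη
  have hd1 := damp_le_one η
  have h0 := abs_nonneg η
  set m := 2 * j + 1 with hm
  set G : ℝ := C ^ 2 * (1 + η ^ 2)⁻¹ with hG
  have hG0 : 0 ≤ G := by positivity
  have hΦ : ‖Φ η‖ ^ 2 ≤ damp η ^ M * G := h.sq_bound η
  have hr1 : 1 + r ^ m ≤ (1 + r) ^ m := by
    simpa using pow_add_pow_le zero_le_one hr.le (n := m) (by omega)
  have hA : (1 + |r * η|) ^ (2 * s) * (1 + |ε * r ^ m - (r * η) ^ m|) ^ (2 * b) * ‖Φ η‖ ^ 2 ≤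
      2 * (1 + r) ^ (2 * s + m) * G := by
    have h1 := rpow_mul_damp_pow_le hn hr hη
    have h2 : (1 + |ε * r ^ m - (r * η) ^ m|) ^ (2 * b) * damp η ^ m ≤ 2 * (1 + r) ^ m := by
      have e1 : (1 + |ε * r ^ m - (r * η) ^ m|) ^ (2 * b) ≤ 1 + |ε * r ^ m - (r * η) ^ m| :=
        Real.rpow_le_self_of_one_le (by linarith [abs_nonneg (ε * r ^ m - (r * η) ^ m)])
          (by linarith)
      have e2 : |ε * r ^ m - (r * η) ^ m| ≤ r ^ m + r ^ m * |η| ^ m := by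
        refine (abs_sub _ _).trans ?_
        rw [abs_mul, hε, one_mul, abs_pow, abs_of_pos hr, abs_pow, abs_mul, abs_of_pos hr, mul_pow]
      have e3 : |η| ^ m ≤ (1 + |η|) ^ m := by gcongr; linarith
      have e4 : (1 : ℝ) ≤ (1 + |η|) ^ m := one_le_pow₀ (by linarith)
      have e5 : 0 ≤ r ^ m := by positivity
      calc _ ≤ (2 * ((1 + r) ^ m * (1 + |η|) ^ m)) * damp η ^ m := by
            gcongr
            refine e1.trans ?_
            have : 1 + r ^ m + r ^ m * |η| ^ m ≤ (1 + r ^ m) * (1 + |η|) ^ m +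
                (1 + r ^ m) * (1 + |η|) ^ m := by nlinarith
            have h7 : (1 + r ^ m) * (1 + |η|) ^ m ≤ (1 + r) ^ m * (1 + |η|) ^ m := by gcongr
            linarith
        _ = 2 * (1 + r) ^ m * ((1 + |η|) * damp η) ^ m := by rw [mul_pow]; ring
        _ ≤ 2 * (1 + r) ^ m * 1 := by
            gcongr
            exact pow_le_one₀ (by positivity) (one_add_mul_damp_le η)
        _ = _ := mul_one _
    have h3 : damp η ^ k ≤ 1 := pow_le_one₀ hd.le hd1
    calc _ ≤ (1 + |r * η|) ^ (2 * s) * (1 + |ε * r ^ m - (r * η) ^ m|) ^ (2 * b) *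
          (damp η ^ M * G) := by gcongr
      _ = ((1 + |r * η|) ^ (2 * s) * damp η ^ n) *
          ((1 + |ε * r ^ m - (r * η) ^ m|) ^ (2 * b) * damp η ^ m) * damp η ^ k * G := by
          rw [hM, pow_add, pow_add]; ring
      _ ≤ (1 + r) ^ (2 * s) * (2 * (1 + r) ^ m) * 1 * G := by gcongr
      _ = _ := by rw [Real.rpow_add (by positivity), Real.rpow_natCast]; ring
  have hB : |r * η| ≤ 1 → (1 + |ε * r ^ m|) ^ (2 * α) * ‖Φ η‖ ^ 2 ≤ (1 + r) ^ (2 * s + m) * G := by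
    intro hle
    rw [abs_mul, abs_of_pos hr] at hle
    have h1 : (1 + |ε * r ^ m|) ^ (2 * α) ≤ (1 + r) ^ (2 * s + m) * (1 + r) ^ k := by
      rw [abs_mul, hε, one_mul, abs_of_pos (pow_pos hr _)]
      calc (1 + r ^ m) ^ (2 * α) ≤ ((1 + r) ^ m) ^ (2 * α) := by gcongr
        _ = (1 + r) ^ (m * (2 * α)) := by rw [Real.rpow_mul (by positivity) (m : ℝ) (2 * α), Real.rpow_natCast]
        _ ≤ (1 + r) ^ ((2 * s + m) + k) := by
            refine Real.rpow_le_rpow_of_exponent_le (by linarith) ?_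
            linarith
        _ = _ := by rw [Real.rpow_add (by positivity), Real.rpow_natCast]
    have h2 : (1 + r) ^ k * damp η ^ k ≤ 1 := by
      rw [← mul_pow]
      exact pow_le_one₀ (by positivity) (one_add_mul_damp_le_of_mul_le hle)
    have h3 : damp η ^ (n + m) ≤ 1 := pow_le_one₀ hd.le hd1
    calc _ ≤ ((1 + r) ^ (2 * s + m) * (1 + r) ^ k) * (damp η ^ M * G) := by gcongr
      _ = (1 + r) ^ (2 * s + m) * ((1 + r) ^ k * damp η ^ k) * damp η ^ (n + m) * G := by
          rw [hM, pow_add _ _ k]; ring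
      _ ≤ (1 + r) ^ (2 * s + m) * 1 * 1 * G := by gcongr
      _ = _ := by ring
  have hΦe : ‖Φ η‖ₑ ^ 2 = ENNReal.ofReal (‖Φ η‖ ^ 2) := by
    rw [ENNReal.ofReal_pow (norm_nonneg _), ofReal_norm]
  have hrhs : 3 * C ^ 2 * (1 + r) ^ (2 * s + m) * (1 + η ^ 2)⁻¹ =
      2 * (1 + r) ^ (2 * s + m) * G + (1 + r) ^ (2 * s + m) * G := by rw [hG]; ring
  unfold planeWeight
  rw [hrhs, ENNReal.ofReal_add (by positivity) (by positivity), add_mul, hΦe]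
  refine add_le_add ?_ ?_
  · rw [← ENNReal.ofReal_mul (by positivity)]
    exact ENNReal.ofReal_le_ofReal hA
  · by_cases hq : |r * η| ≤ 1
    · rw [indicator_of_mem (by rw [mem_prod]; exact ⟨abs_le.1 hq, mem_univ _⟩),
        ← ENNReal.ofReal_mul (by positivity)]
      exact ENNReal.ofReal_le_ofReal (hB hq)
    · rw [indicator_of_notMem (by rw [mem_prod]; exact fun h => hq (abs_le.2 h.1)), zero_mul]
      exact zero_le

end IsProfile

lemma rpow_half_le_of_le_mul_sq {a S : ℝ≥0∞} {k : ℝ≥0} (h : a ≤ k * S ^ 2) :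
    a ^ (1 / 2 : ℝ) ≤ (k ^ (1 / 2 : ℝ) : ℝ≥0) * S := by
  calc a ^ (1 / 2 : ℝ) ≤ (k * S ^ 2) ^ (1 / 2 : ℝ) := by gcongr
    _ = _ := by
      rw [ENNReal.mul_rpow_of_nonneg _ _ (by norm_num), ENNReal.coe_rpow_of_nonneg _ (by norm_num),
        ← ENNReal.rpow_natCast, ← ENNReal.rpow_mul]
      norm_num

/-! ### The Hadamard space estimate for a ray -/

section LineRay

variable {ρ : ℂ} {K : ℕ} {C : ℝ} {Φ : ℝ → ℂ}

/-- The transform of the extension of `∫_0^∞ e^{iρrx} a(r) dr` from the half-line. -/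
def dilationTransform (Φ a : ℝ → ℂ) (ξ : ℝ) : ℂ :=
  ∫ r in Ioi (0 : ℝ), (r : ℂ)⁻¹ * Φ (ξ / r) * a r

/-- The `L¹` norm of `ξ ↦ r⁻¹Φ(ξ/r)` does not depend on `r`. -/
lemma integrable_dilation (hΦ : Continuous Φ) (hΦi : Integrable Φ) {a : ℝ → ℂ}
    (ha : Integrable a (volume.restrict (Ioi 0))) :
    Integrable (fun q : ℝ × ℝ => (q.2 : ℂ)⁻¹ * Φ (q.1 / q.2) * a q.2)
      (volume.prod (volume.restrict (Ioi 0))) := by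
  have hm : AEStronglyMeasurable (fun q : ℝ × ℝ => (q.2 : ℂ)⁻¹ * Φ (q.1 / q.2) * a q.2)
      (volume.prod (volume.restrict (Ioi 0))) := by
    refine AEStronglyMeasurable.mul ?_ ha.aestronglyMeasurable.comp_snd
    have : Measurable fun q : ℝ × ℝ => (q.2 : ℂ)⁻¹ * Φ (q.1 / q.2) :=
      (Complex.measurable_ofReal.comp measurable_snd).inv.mul
        (hΦ.measurable.comp (measurable_fst.div measurable_snd))
    exact this.aestronglyMeasurable
  rw [integrable_prod_iff' hm]
  refine ⟨?_, ?_⟩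
  · refine (ae_restrict_iff' measurableSet_Ioi).2 (Eventually.of_forall fun r hr => ?_)
    have h1 : Integrable fun ξ : ℝ => (r : ℂ)⁻¹ * Φ (ξ / r) * a r :=
      ((hΦi.comp_div (ne_of_gt hr)).const_mul _).mul_const _
    exact h1
  · refine (ha.norm.const_mul (∫ η, ‖Φ η‖)).congr
      ((ae_restrict_iff' measurableSet_Ioi).2 (Eventually.of_forall fun r hr => ?_))
    have hr : 0 < r := hr
    simp only [norm_mul, integral_mul_const, integral_const_mul]
    rw [IsProfile.integral_norm_dilate Φ hr, norm_inv, Complex.norm_real, Real.norm_of_nonneg hr.le]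
    field_simp

lemma integral_dilationTransform_mul (h : IsProfile ρ K C Φ) {a : ℝ → ℂ}
    (ha : Integrable a (volume.restrict (Ioi 0))) {x : ℝ} (hx : 0 < x) :
    ∫ ξ : ℝ, dilationTransform Φ a ξ * linePhase ξ x =
      2 * (Real.pi : ℂ) * ∫ r in Ioi (0 : ℝ), Complex.exp (Complex.I * ρ * r * x) * a r := by
  have hi := integrable_dilation h.continuous h.integrable ha
  have hc : Continuous fun q : ℝ × ℝ => linePhase q.1 x := by
    unfold linePhase
    fun_prop
  have hi2 : Integrable (Function.uncurry fun (ξ r : ℝ) =>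
      (r : ℂ)⁻¹ * Φ (ξ / r) * a r * linePhase ξ x) (volume.prod (volume.restrict (Ioi 0))) :=
    hi.mul_bdd (c := 1) hc.aestronglyMeasurable
      (Eventually.of_forall fun q => (norm_linePhase _ _).le)
  unfold dilationTransform
  simp only [← integral_mul_const]
  rw [integral_integral_swap hi2, ← integral_const_mul]
  refine setIntegral_congr_fun measurableSet_Ioi fun r hr => ?_
  have hr : 0 < r := hr
  have hr' : (r : ℂ) ≠ 0 := by exact_mod_cast hr.ne'
  calc ∫ ξ : ℝ, (r : ℂ)⁻¹ * Φ (ξ / r) * a r * linePhase ξ x =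
        ∫ ξ : ℝ, ((r : ℂ)⁻¹ * a r) * (Φ (ξ / r) * linePhase ξ x) := by
        congr 1
        ext ξ
        ring
    _ = _ := by
        rw [integral_const_mul, h.integral_dilate hr hx]
        field_simp

lemma lintegral_dilationTransform_le {s : ℝ} {n : ℕ} (hn : |s| ≤ n)
    (h : IsProfile ρ (n + 2) C Φ) {a : ℝ → ℂ} (ha : Measurable a) :
    ∫⁻ ξ, lineWeight s ξ * ‖dilationTransform Φ a ξ‖ₑ ^ 2 ≤
      ENNReal.ofReal (Real.pi * C ^ 2) *
        ∫⁻ r in Ioi (0 : ℝ), ENNReal.ofReal ((1 + r) ^ (2 * s)) * ‖a r‖ₑ ^ 2 := by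
  have hC := h.pos
  let F : ℝ → ℝ≥0∞ := fun r => ENNReal.ofReal (C * (1 + r) ^ s) * ‖a r‖ₑ
  have hF : Measurable F := by
    refine Measurable.mul ?_ ha.enorm
    fun_prop
  have hpt : ∀ ξ, lineWeight s ξ * ‖dilationTransform Φ a ξ‖ₑ ^ 2 ≤
      (∫⁻ r in Ioi (0 : ℝ), dilationKernel ξ r * F r) ^ 2 := by
    intro ξ
    have e1 : lineWeight s ξ = ENNReal.ofReal ((1 + |ξ|) ^ s) ^ 2 := by
      unfold lineWeight
      rw [← ENNReal.ofReal_pow (by positivity), mul_comm 2 s, Real.rpow_mul (by positivity),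
        Real.rpow_two]
    rw [e1, ← mul_pow]
    gcongr
    calc _ ≤ ENNReal.ofReal ((1 + |ξ|) ^ s) *
          ∫⁻ r in Ioi (0 : ℝ), ‖(r : ℂ)⁻¹ * Φ (ξ / r) * a r‖ₑ := by
          gcongr
          exact enorm_integral_le_lintegral_enorm _
      _ = ∫⁻ r in Ioi (0 : ℝ), ENNReal.ofReal ((1 + |ξ|) ^ s) *
          ‖(r : ℂ)⁻¹ * Φ (ξ / r) * a r‖ₑ := (lintegral_const_mul' _ _ ENNReal.ofReal_ne_top).symm
      _ ≤ _ := by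
          refine setLIntegral_mono' measurableSet_Ioi fun r hr => ?_
          have hr : 0 < r := hr
          simp only [F]
          rw [enorm_mul _ (a r), ← mul_assoc, ← mul_assoc]
          gcongr ?_ * _
          unfold dilationKernel
          rw [← ofReal_norm, ← ENNReal.ofReal_mul (by positivity),
            ← ENNReal.ofReal_mul (by positivity)]
          refine ENNReal.ofReal_le_ofReal ?_
          rw [norm_mul, norm_inv, Complex.norm_real, Real.norm_of_nonneg hr.le]
          exact (h.line_bound hn hr ξ).trans_eq (mul_comm _ _)
  refine (lintegral_mono hpt).trans ?_
  -- Schur's test asks for a bound at every real `r`, whereas the kernel is controlled for `r > 0`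
  -- only; hence the cut-off of the kernel.
  have hS : ∀ r, ∫⁻ ξ, (fun ξ r => (Ioi (0 : ℝ)).indicator (dilationKernel ξ) r) ξ r ≤
      ENNReal.ofReal Real.pi := by
    intro r
    by_cases hr : r ∈ Ioi (0 : ℝ)
    · simp only [indicator_of_mem hr]
      exact lintegral_dilationKernel_left hr
    · simp only [indicator_of_notMem hr, lintegral_zero]
      exact zero_le
  have hKm : Measurable (Function.uncurry fun ξ r =>
      (Ioi (0 : ℝ)).indicator (dilationKernel ξ) r) := by
    have : (Function.uncurry fun ξ r => (Ioi (0 : ℝ)).indicator (dilationKernel ξ) r) =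
        (Prod.snd ⁻¹' Ioi (0 : ℝ)).indicator (Function.uncurry dilationKernel) := by
      ext ⟨ξ, r⟩
      simp [indicator]
    rw [this]
    exact measurable_dilationKernel.indicator (measurable_snd measurableSet_Ioi)
  have hSchur := lintegral_sq_le_of_schur (μ := (volume : Measure ℝ))
    (ν := volume.restrict (Ioi (0 : ℝ))) hKm hF (A := 1) (B := ENNReal.ofReal Real.pi)
    (fun ξ => by
      rw [setLIntegral_congr_fun measurableSet_Ioi (fun r hr => indicator_of_mem hr _)]
      exact lintegral_dilationKernel_right ξ) hS
  have e2 : ∀ ξ, ∫⁻ r in Ioi (0 : ℝ), dilationKernel ξ r * F r =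
      ∫⁻ r in Ioi (0 : ℝ), (Ioi (0 : ℝ)).indicator (dilationKernel ξ) r * F r := by
    intro ξ
    refine setLIntegral_congr_fun measurableSet_Ioi fun r hr => ?_
    rw [indicator_of_mem hr]
  simp only [e2]
  refine hSchur.trans (le_of_eq ?_)
  rw [one_mul, ENNReal.ofReal_mul Real.pi_pos.le, mul_assoc]
  congr 1
  rw [← lintegral_const_mul' _ _ ENNReal.ofReal_ne_top]
  refine setLIntegral_congr_fun measurableSet_Ioi fun r hr => ?_
  have hr : 0 < r := hr
  simp only [F]
  rw [mul_pow, ← mul_assoc, ← ENNReal.ofReal_pow (by positivity),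
    ← ENNReal.ofReal_mul (by positivity), mul_pow, mul_comm 2 s, Real.rpow_mul (by positivity),
    Real.rpow_two]

end LineRay

/-- This fixes the Sobolev index: `r^{2(2j-l)} = r^{2j} r^{2j-2l}`, where `r^{2j}` is the Jacobian
and `2s + 2j - 2l = m · 2(s+j-l)/m`. -/
lemma pow_mul_rpow_le {j l : ℕ} (hl : l < j) (s : ℝ) {r : ℝ} (hr : 0 < r) :
    (1 + r) ^ (2 * s) * (r ^ (2 * j - l)) ^ 2 ≤
      r ^ (2 * j) * (1 + r) ^ ((2 * j + 1 : ℕ) * (2 * ((s + j - l) / (2 * j + 1 : ℕ)))) := by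
  have hm : ((2 * j + 1 : ℕ) : ℝ) ≠ 0 := Nat.cast_ne_zero.2 (by omega)
  have e1 : ((2 * j + 1 : ℕ) : ℝ) * (2 * ((s + j - l) / (2 * j + 1 : ℕ))) =
      2 * s + ((2 * j - 2 * l : ℕ) : ℝ) := by
    rw [Nat.cast_sub (by omega)]
    push_cast
    push_cast at hm
    field_simp
    ring
  rw [e1, Real.rpow_add (by positivity), Real.rpow_natCast, ← pow_mul,
    show (2 * j - l) * 2 = 2 * j + (2 * j - 2 * l) by omega, pow_add]
  have : r ^ (2 * j - 2 * l) ≤ (1 + r) ^ (2 * j - 2 * l) := by gcongr; linarith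
  calc _ = r ^ (2 * j) * ((1 + r) ^ (2 * s) * r ^ (2 * j - 2 * l)) := by ring
    _ ≤ _ := by gcongr

/-- The time phase is put into the amplitude, where its modulus is one; this is why the constant
does not depend on `t`. -/
lemma exists_rayWave_line_extension {j l : ℕ} (hl : l < j) (s : ℝ) {ρ : ℂ} (hρ : 0 < ρ.im) {ε : ℝ}
    (hε : |ε| = 1) :
    ∃ c : ℝ≥0, ∀ g : ℝ → ℂ, ContDiff ℝ ∞ g → tsupport g ⊆ Icc 0 2 → ∀ t : ℝ,
      HasExtension (lineWeight s) linePhase (Ioi 0)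
        (fun x => 2 * (Real.pi : ℂ) * rayWave j ρ ε (2 * j - l) g x t)
        (c * sobolevNorm ((s + j - l) / (2 * j + 1 : ℕ)) g) := by
  obtain ⟨n, hn⟩ := exists_nat_ge |s|
  obtain ⟨C, Φ, hΦ⟩ := exists_isProfile hρ (n + 2)
  obtain ⟨c, hc⟩ := exists_lintegral_ray_le j ((s + j - l) / (2 * j + 1 : ℕ))
  refine ⟨(Real.toNNReal (Real.pi * C ^ 2) * c) ^ (1 / 2 : ℝ), fun g hg hs t => ?_⟩
  have hcg := continuous_lineFourier_of_data hg hs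
  let a : ℝ → ℂ := fun r => Complex.exp (Complex.I * (ε * r ^ (2 * j + 1) : ℝ) * t) *
    ((r : ℂ) ^ (2 * j - l) * lineFourier g (ε * r ^ (2 * j + 1)))
  have hac : Continuous a := by fun_prop
  have ha : Integrable a (volume.restrict (Ioi 0)) := by
    have := integrableOn_rayIntegrand hg hs j (ρ := 0) (by simp) hε (2 * j - l) (x := 0) le_rfl t
    simp only [Complex.ofReal_zero, mul_zero, zero_mul, zero_add] at this
    exact this
  refine ⟨dilationTransform Φ a, ?_, fun x hx => ?_, ?_⟩
  · exact (integrable_dilation hΦ.continuous hΦ.integrable ha).integral_prod_left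
  · rw [integral_dilationTransform_mul hΦ ha hx]
    unfold rayWave
    congr 2
    ext r
    simp only [a]
    rw [Complex.exp_add]
    ring
  · refine rpow_half_le_of_le_mul_sq ?_
    refine (lintegral_dilationTransform_le hn hΦ hac.measurable).trans ?_
    rw [ENNReal.coe_mul, mul_assoc]
    change ENNReal.ofReal _ * _ ≤ ENNReal.ofReal _ * _
    gcongr
    refine le_trans ?_ (hc ε hε (lineFourier g))
    refine setLIntegral_mono' measurableSet_Ioi fun r hr => ?_
    have hr : 0 < r := hr
    have hna : ‖a r‖ₑ ^ 2 = ENNReal.ofReal ((r ^ (2 * j - l)) ^ 2) *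
        ‖lineFourier g (ε * r ^ (2 * j + 1))‖ₑ ^ 2 := by
      have h1 : ‖Complex.exp (Complex.I * (ε * r ^ (2 * j + 1) : ℝ) * t)‖ = 1 := by
        rw [show Complex.I * ((ε * r ^ (2 * j + 1) : ℝ) : ℂ) * t =
          ((ε * r ^ (2 * j + 1) * t : ℝ) : ℂ) * Complex.I by push_cast; ring]
        exact Complex.norm_exp_ofReal_mul_I _
      simp only [a]
      rw [enorm_mul, enorm_mul, mul_pow, mul_pow, ENNReal.ofReal_pow (by positivity),
        ← ofReal_norm (Complex.exp _), h1, ← ofReal_norm ((r : ℂ) ^ _), norm_pow,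
        Complex.norm_real, Real.norm_of_nonneg hr.le, ENNReal.ofReal_one, one_pow, one_mul]
    rw [hna, ← mul_assoc, ← ENNReal.ofReal_mul (by positivity)]
    exact mul_le_mul' (ENNReal.ofReal_le_ofReal (pow_mul_rpow_le hl s hr)) le_rfl

/-! ### The Bourgain space estimate for a ray -/

section PlaneRay

variable {j : ℕ} {ε : ℝ}

lemma lintegral_plane_eq (hε : |ε| = 1) {F : ℝ × ℝ → ℝ≥0∞} (hF : Measurable F)
    (hF0 : ∀ q : ℝ × ℝ, ε * q.2 ≤ 0 → F q = 0) :
    ∫⁻ q, F q = ∫⁻ r in Ioi (0 : ℝ), ENNReal.ofReal ((2 * j + 1 : ℕ) * r ^ (2 * j)) *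
      ∫⁻ ξ : ℝ, F (ξ, ε * r ^ (2 * j + 1)) := by
  have hεε : ε * ε = 1 := by rcases sign_cases hε with rfl | rfl <;> norm_num
  rw [lintegral_Ioi_comp_pow j (fun l => ∫⁻ ξ : ℝ, F (ξ, ε * l)), Measure.volume_eq_prod,
    lintegral_prod_symm' _ hF, ← lintegral_comp_sign_mul hε, ← lintegral_indicator measurableSet_Ioi]
  congr 1
  ext τ
  by_cases hτ : τ ∈ Ioi (0 : ℝ)
  · rw [indicator_of_mem hτ]
  · rw [indicator_of_notMem hτ]
    have : ∀ ξ : ℝ, F (ξ, ε * τ) = 0 := fun ξ =>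
      hF0 _ (by rw [← mul_assoc, hεε, one_mul]; exact not_lt.1 hτ)
    simp [this]

lemma integral_plane_eq (hε : |ε| = 1) {F : ℝ × ℝ → ℂ} (hF : Integrable F)
    (hF0 : ∀ q : ℝ × ℝ, ε * q.2 ≤ 0 → F q = 0) :
    ∫ q, F q = ((2 * j + 1 : ℕ) : ℂ) * ∫ r in Ioi (0 : ℝ), (r : ℂ) ^ (2 * j) *
      ∫ ξ : ℝ, F (ξ, ε * r ^ (2 * j + 1)) := by
  have hεε : ε * ε = 1 := by rcases sign_cases hε with rfl | rfl <;> norm_num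
  rw [integral_Ioi_comp_pow j (fun l => ∫ ξ : ℝ, F (ξ, ε * l))]
  rw [Measure.volume_eq_prod] at hF ⊢
  rw [integral_prod_symm _ hF, ← integral_comp_sign_mul hε, ← integral_indicator measurableSet_Ioi]
  congr 1
  ext τ
  by_cases hτ : τ ∈ Ioi (0 : ℝ)
  · rw [indicator_of_mem hτ]
  · rw [indicator_of_notMem hτ]
    have : ∀ ξ : ℝ, F (ξ, ε * τ) = 0 := fun ξ =>
      hF0 _ (by rw [← mul_assoc, hεε, one_mul]; exact not_lt.1 hτ)
    simp [this]

/-- The space-time transform of the extension of a ray wave from the quarter-plane. -/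
def planeTransform (j : ℕ) (ε : ℝ) (l : ℕ) (Φ : ℝ → ℂ) (g : ℝ → ℂ) : ℝ × ℝ → ℂ :=
  {q : ℝ × ℝ | 0 < ε * q.2}.indicator fun q =>
    (((|q.2| ^ (((2 * j + 1 : ℕ) : ℝ)⁻¹) : ℝ) : ℂ) ^ (l + 1))⁻¹ *
      Φ (q.1 / |q.2| ^ (((2 * j + 1 : ℕ) : ℝ)⁻¹)) * lineFourier g q.2

/-- The power `-(l+1)` collects `r^{2j-l}` from the wave, `r⁻¹` from the dilation and `r^{-2j}` from
`dr = dλ/(m r^{2j})`; the omitted `1/m` reappears as the factor `m` in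
`integral_planeTransform_mul`. -/
lemma planeTransform_apply (hε : |ε| = 1) (l : ℕ) (Φ g : ℝ → ℂ) {r : ℝ} (hr : 0 < r) (ξ : ℝ) :
    planeTransform j ε l Φ g (ξ, ε * r ^ (2 * j + 1)) =
      ((r : ℂ) ^ (l + 1))⁻¹ * Φ (ξ / r) * lineFourier g (ε * r ^ (2 * j + 1)) := by
  have hεε : ε * ε = 1 := by rcases sign_cases hε with rfl | rfl <;> norm_num
  have hmem : (ξ, ε * r ^ (2 * j + 1)) ∈ {q : ℝ × ℝ | 0 < ε * q.2} := by
    change 0 < ε * (ε * r ^ (2 * j + 1))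
    rw [← mul_assoc, hεε, one_mul]
    positivity
  have e : |ε * r ^ (2 * j + 1)| ^ (((2 * j + 1 : ℕ) : ℝ)⁻¹) = r := by
    rw [abs_mul, hε, one_mul, abs_of_pos (pow_pos hr _)]
    exact Real.pow_rpow_inv_natCast hr.le (by omega)
  unfold planeTransform
  rw [indicator_of_mem hmem]
  simp only [e]

lemma planeTransform_eq_zero (l : ℕ) (Φ g : ℝ → ℂ) {q : ℝ × ℝ} (hq : ε * q.2 ≤ 0) :
    planeTransform j ε l Φ g q = 0 := by
  have : q ∉ {q : ℝ × ℝ | 0 < ε * q.2} := not_lt.2 hq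
  exact indicator_of_notMem this _

lemma measurable_planeTransform (l : ℕ) {Φ g : ℝ → ℂ} (hΦ : Continuous Φ)
    (hg : Continuous (lineFourier g)) : Measurable (planeTransform j ε l Φ g) := by
  unfold planeTransform
  have h1 : Measurable fun q : ℝ × ℝ => |q.2| ^ (((2 * j + 1 : ℕ) : ℝ)⁻¹) := by fun_prop
  refine Measurable.indicator ?_ ?_
  · refine Measurable.mul (Measurable.mul ?_ ?_) (hg.measurable.comp measurable_snd)
    · exact ((Complex.measurable_ofReal.comp h1).pow_const _).inv
    · exact hΦ.measurable.comp (measurable_fst.div h1)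
  · exact measurableSet_lt measurable_const (by fun_prop)

variable {ρ : ℂ} {K : ℕ} {C : ℝ} {Φ : ℝ → ℂ} {g : ℝ → ℂ} {l : ℕ}

lemma integrable_planeTransform (h : IsProfile ρ K C Φ) (hl : l < j) (hε : |ε| = 1)
    (hg : ContDiff ℝ ∞ g) (hs : tsupport g ⊆ Icc 0 2) :
    Integrable (planeTransform j ε l Φ g) := by
  have hm := measurable_planeTransform (j := j) (ε := ε) l h.continuous
    (continuous_lineFourier_of_data hg hs)
  refine ⟨hm.aestronglyMeasurable, ?_⟩
  unfold HasFiniteIntegral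
  rw [lintegral_plane_eq (j := j) hε hm.enorm
    (fun q hq => by rw [planeTransform_eq_zero l Φ g hq, enorm_zero])]
  have hA := ((integrableOn_pow_mul_lineFourier hg hs j hε (2 * j - l)).const_mul
    (((2 * j + 1 : ℕ) * ∫ η, ‖Φ η‖ : ℝ) : ℂ)).2
  unfold HasFiniteIntegral at hA
  refine lt_of_le_of_lt (le_of_eq ?_) hA
  refine setLIntegral_congr_fun measurableSet_Ioi fun r hr => ?_
  have hr : 0 < r := hr
  simp only [planeTransform_apply hε l Φ g hr]
  rw [← ofReal_integral_norm_eq_lintegral_enorm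
    (((h.integrable.comp_div hr.ne').const_mul _).mul_const _)]
  simp only [norm_mul, integral_mul_const, integral_const_mul]
  rw [IsProfile.integral_norm_dilate Φ hr, ← ENNReal.ofReal_mul (by positivity), ← ofReal_norm]
  congr 1
  have hI : 0 ≤ ∫ η, ‖Φ η‖ := integral_nonneg fun _ => norm_nonneg _
  rw [norm_mul, norm_mul, norm_inv, norm_pow, norm_pow, Complex.norm_real, Complex.norm_real,
    Real.norm_of_nonneg hr.le, Real.norm_of_nonneg (by positivity)]
  have e : r ^ (2 * j) = r ^ (2 * j - l) * r ^ l := by rw [← pow_add]; congr 1; omega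
  rw [e, pow_succ r l]
  field_simp

lemma integral_planeTransform_mul (h : IsProfile ρ K C Φ) (hl : l < j) (hε : |ε| = 1)
    (hg : ContDiff ℝ ∞ g) (hs : tsupport g ⊆ Icc 0 2) {x : ℝ} (hx : 0 < x) (t : ℝ) :
    ∫ q, planeTransform j ε l Φ g q * planePhase q (x, t) =
      2 * (Real.pi : ℂ) * (2 * j + 1 : ℕ) * rayWave j ρ ε (2 * j - l) g x t := by
  have hc : Continuous fun q : ℝ × ℝ => planePhase q (x, t) := by
    unfold planePhase
    fun_prop
  rw [integral_plane_eq (j := j) hε ((integrable_planeTransform h hl hε hg hs).mul_bdd (c := 1)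
    hc.aestronglyMeasurable (Eventually.of_forall fun q => (norm_planePhase _ _).le))
    (fun q hq => by rw [planeTransform_eq_zero l Φ g hq, zero_mul])]
  unfold rayWave
  rw [mul_comm (2 * (Real.pi : ℂ)), mul_assoc]
  congr 1
  rw [← integral_const_mul]
  refine setIntegral_congr_fun measurableSet_Ioi fun r hr => ?_
  have hr : 0 < r := hr
  have hr' : (r : ℂ) ≠ 0 := by exact_mod_cast hr.ne'
  simp only [planeTransform_apply hε l Φ g hr]
  have e : ∀ ξ : ℝ, ((r : ℂ) ^ (l + 1))⁻¹ * Φ (ξ / r) * lineFourier g (ε * r ^ (2 * j + 1)) *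
      planePhase (ξ, ε * r ^ (2 * j + 1)) (x, t) =
      (((r : ℂ) ^ (l + 1))⁻¹ * lineFourier g (ε * r ^ (2 * j + 1)) *
        Complex.exp (Complex.I * (ε * r ^ (2 * j + 1) : ℝ) * t)) *
          (Φ (ξ / r) * linePhase ξ x) := by
    intro ξ
    have : planePhase (ξ, ε * r ^ (2 * j + 1)) (x, t) =
        Complex.exp (Complex.I * (ε * r ^ (2 * j + 1) : ℝ) * t) * linePhase ξ x := by
      unfold planePhase linePhase
      rw [← Complex.exp_add]
      congr 1
      ring
    rw [this]
    ring
  simp only [e]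
  rw [integral_const_mul, h.integral_dilate hr hx, Complex.exp_add]
  have e2 : (r : ℂ) ^ (2 * j) = r ^ (2 * j - l) * r ^ l := by rw [← pow_add]; congr 1; omega
  rw [e2, pow_succ (r : ℂ) l]
  field_simp

/-- For `r > 1` the left side is comparable to the weight of the data norm. For `r ≤ 1` it behaves
like `r^{2j-2l-1}`, which is bounded since `l < j` but not controlled by the Jacobian `r^{2j}`;
hence the separate indicator term. -/
lemma amplitude_le (hl : l < j) (s : ℝ) : ∃ A : ℝ, 0 ≤ A ∧ ∀ r : ℝ, 0 < r →
    (2 * j + 1 : ℕ) * r ^ (2 * j) * ((r ^ (l + 1))⁻¹ ^ 2 * ((1 + r) ^ (2 * s + (2 * j + 1 : ℕ)) * r))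
      ≤ A * ((Iic (1 : ℝ)).indicator 1 r +
        r ^ (2 * j) * (1 + r) ^ ((2 * j + 1 : ℕ) * (2 * ((s + j - l) / (2 * j + 1 : ℕ))))) := by
  have hm : ((2 * j + 1 : ℕ) : ℝ) ≠ 0 := Nat.cast_ne_zero.2 (by omega)
  have e1 : ((2 * j + 1 : ℕ) : ℝ) * (2 * ((s + j - l) / (2 * j + 1 : ℕ))) =
      (2 * s + (2 * j + 1 : ℕ)) - ((2 * l + 1 : ℕ) : ℝ) := by
    push_cast
    push_cast at hm
    field_simp
    ring
  rw [e1]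
  set κ : ℝ := 2 * s + (2 * j + 1 : ℕ) with hκ
  refine ⟨(2 * j + 1 : ℕ) * (2 ^ |κ| + 2 ^ (2 * l + 1)), by positivity, fun r hr => ?_⟩
  have e2 : r ^ (2 * j) * ((r ^ (l + 1))⁻¹ ^ 2 * ((1 + r) ^ κ * r)) =
      r ^ (2 * j) * (r ^ (2 * l + 1))⁻¹ * (1 + r) ^ κ := by
    rw [show (r ^ (l + 1))⁻¹ ^ 2 = (r ^ (2 * l + 1))⁻¹ * r⁻¹ by
      rw [inv_pow, ← pow_mul, ← mul_inv, ← pow_succ]; congr 2; ring]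
    field_simp
  rw [mul_assoc, e2, mul_assoc ((2 * j + 1 : ℕ) : ℝ)]
  refine mul_le_mul_of_nonneg_left ?_ (by positivity)
  have hp1 : (0 : ℝ) ≤ 2 ^ |κ| := by positivity
  rcases le_or_gt r 1 with h | h
  · rw [indicator_of_mem (by exact h), Pi.one_apply]
    have h1 : r ^ (2 * j) * (r ^ (2 * l + 1))⁻¹ ≤ 1 := by
      rw [← div_eq_mul_inv, div_le_one (by positivity)]
      exact pow_le_pow_of_le_one hr.le h (by omega)
    have h2 : (1 + r) ^ κ ≤ 2 ^ |κ| := by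
      calc (1 + r) ^ κ ≤ (1 + r) ^ |κ| :=
            Real.rpow_le_rpow_of_exponent_le (by linarith) (le_abs_self κ)
        _ ≤ 2 ^ |κ| := Real.rpow_le_rpow (by positivity) (by linarith) (abs_nonneg κ)
    calc _ ≤ 1 * (2 : ℝ) ^ |κ| := by gcongr
      _ ≤ (2 ^ |κ| + 2 ^ (2 * l + 1)) * 1 := by
          have : (0 : ℝ) ≤ 2 ^ (2 * l + 1) := by positivity
          linarith
      _ ≤ _ := by
          gcongr
          have : 0 ≤ r ^ (2 * j) * (1 + r) ^ (κ - ((2 * l + 1 : ℕ) : ℝ)) := by positivity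
          linarith
  · rw [indicator_of_notMem (by simpa using h), zero_add, Real.rpow_sub (by positivity),
      Real.rpow_natCast]
    have h1 : (r ^ (2 * l + 1))⁻¹ ≤ 2 ^ (2 * l + 1) / (1 + r) ^ (2 * l + 1) := by
      rw [← div_pow, ← inv_pow]
      gcongr
      rw [inv_eq_one_div, div_le_div_iff₀ hr (by positivity)]
      linarith
    calc _ ≤ r ^ (2 * j) * (2 ^ (2 * l + 1) / (1 + r) ^ (2 * l + 1)) * (1 + r) ^ κ := by gcongr
      _ = 2 ^ (2 * l + 1) * (r ^ (2 * j) * ((1 + r) ^ κ / (1 + r) ^ (2 * l + 1))) := by ring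
      _ ≤ _ := by
          gcongr
          linarith

end PlaneRay

lemma exists_rayWave_plane_extension {j l : ℕ} (hl : l < j) {s b α : ℝ} (hb : b < 1 / 2) (hα : 0 < α) {ρ : ℂ} (hρ : 0 < ρ.im) {ε : ℝ} (hε : |ε| = 1) (T : ℝ) :
    ∃ c : ℝ≥0, ∀ g : ℝ → ℂ, ContDiff ℝ ∞ g → tsupport g ⊆ Icc 0 2 →
      HasExtension (planeWeight (2 * j + 1) s b α) planePhase (Ioi (0 : ℝ) ×ˢ Ioo 0 T)
        (fun y => 2 * (Real.pi : ℂ) * (2 * j + 1 : ℕ) * rayWave j ρ ε (2 * j - l) g y.1 y.2)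
        (c * sobolevNorm ((s + j - l) / (2 * j + 1 : ℕ)) g) := by
  obtain ⟨n, hn⟩ := exists_nat_ge |2 * s|
  obtain ⟨k, hk⟩ := exists_nat_ge (2 * α * (2 * j + 1 : ℕ) - (2 * s + (2 * j + 1 : ℕ)))
  obtain ⟨C, Φ, hΦ⟩ := exists_isProfile hρ (n + (2 * j + 1) + k)
  have hC := hΦ.pos
  set σ : ℝ := (s + j - l) / (2 * j + 1 : ℕ) with hσ
  obtain ⟨c₁, hc₁⟩ := exists_lowFrequency_bound σ
  obtain ⟨c₂, hc₂⟩ := exists_lintegral_ray_le j σ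
  obtain ⟨A, hA0, hA⟩ := amplitude_le hl s
  refine ⟨(Real.toNNReal (3 * C ^ 2 * Real.pi * A) * (c₁ ^ 2 + c₂)) ^ (1 / 2 : ℝ),
    fun g hg hs => ?_⟩
  have hcg := continuous_lineFourier_of_data hg hs
  have hm := measurable_planeTransform (j := j) (ε := ε) l hΦ.continuous hcg
  refine ⟨planeTransform j ε l Φ g, integrable_planeTransform hΦ hl hε hg hs, fun y hy => ?_, ?_⟩
  · exact integral_planeTransform_mul hΦ hl hε hg hs hy.1 y.2
  refine rpow_half_le_of_le_mul_sq ?_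
  have hF : Measurable fun q => planeWeight (2 * j + 1) s b α q *
      ‖planeTransform j ε l Φ g q‖ₑ ^ 2 :=
    (measurable_planeWeight _ s b α).mul (hm.enorm.pow_const 2)
  rw [lintegral_plane_eq (j := j) hε hF
    (fun q hq => by rw [planeTransform_eq_zero l Φ g hq]; simp)]
  set P : ℝ := 3 * C ^ 2 * Real.pi * A with hP
  have hP0 : 0 ≤ P := by have := Real.pi_pos; positivity
  let w : ℝ → ℝ := fun r => r ^ (2 * j) * (1 + r) ^ ((2 * j + 1 : ℕ) * (2 * σ))
  let G : ℝ → ℝ≥0∞ := fun r => ‖lineFourier g (ε * r ^ (2 * j + 1))‖ₑ ^ 2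
  have hpt : ∀ r ∈ Ioi (0 : ℝ), ENNReal.ofReal ((2 * j + 1 : ℕ) * r ^ (2 * j)) *
      ∫⁻ ξ : ℝ, planeWeight (2 * j + 1) s b α (ξ, ε * r ^ (2 * j + 1)) *
        ‖planeTransform j ε l Φ g (ξ, ε * r ^ (2 * j + 1))‖ₑ ^ 2 ≤
      ENNReal.ofReal P * ((Iic (1 : ℝ)).indicator G r + ENNReal.ofReal (w r) * G r) := by
    intro r hr
    have hr : 0 < r := hr
    simp only [planeTransform_apply hε l Φ g hr]
    have h1 : ∀ ξ : ℝ, planeWeight (2 * j + 1) s b α (ξ, ε * r ^ (2 * j + 1)) *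
        ‖((r : ℂ) ^ (l + 1))⁻¹ * Φ (ξ / r) * lineFourier g (ε * r ^ (2 * j + 1))‖ₑ ^ 2 ≤
        (ENNReal.ofReal ((r ^ (l + 1))⁻¹ ^ 2 * (3 * C ^ 2 * (1 + r) ^ (2 * s + (2 * j + 1 : ℕ)))) *
          G r) * ENNReal.ofReal ((1 + (ξ / r) ^ 2)⁻¹) := by
      intro ξ
      have h2 := hΦ.plane_bound j hb hα hn hk rfl hr hε ξ
      have h3 : ‖((r : ℂ) ^ (l + 1))⁻¹‖ₑ ^ 2 = ENNReal.ofReal ((r ^ (l + 1))⁻¹ ^ 2) := by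
        rw [← ofReal_norm, norm_inv, norm_pow, Complex.norm_real, Real.norm_of_nonneg hr.le,
          ENNReal.ofReal_pow (by positivity)]
      rw [enorm_mul, enorm_mul, mul_pow, mul_pow, h3]
      calc _ = ENNReal.ofReal ((r ^ (l + 1))⁻¹ ^ 2) * G r *
            (planeWeight (2 * j + 1) s b α (ξ, ε * r ^ (2 * j + 1)) * ‖Φ (ξ / r)‖ₑ ^ 2) := by
            simp only [G]
            ring
        _ ≤ ENNReal.ofReal ((r ^ (l + 1))⁻¹ ^ 2) * G r * _ := mul_le_mul' le_rfl h2
        _ = _ := by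
            rw [ENNReal.ofReal_mul (by positivity : (0 : ℝ) ≤ 3 * C ^ 2 *
              (1 + r) ^ (2 * s + (2 * j + 1 : ℕ))), ENNReal.ofReal_mul (by positivity :
              (0 : ℝ) ≤ (r ^ (l + 1))⁻¹ ^ 2)]
            ring
    have hGt : G r ≠ ⊤ := ENNReal.pow_ne_top enorm_ne_top
    have h4 : ENNReal.ofReal ((Iic (1 : ℝ)).indicator 1 r + w r) * G r =
        (Iic (1 : ℝ)).indicator G r + ENNReal.ofReal (w r) * G r := by
      have hw : 0 ≤ w r := by simp only [w]; positivity
      by_cases hr1 : r ∈ Iic (1 : ℝ)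
      · rw [indicator_of_mem hr1, indicator_of_mem hr1, Pi.one_apply,
          ENNReal.ofReal_add zero_le_one hw, ENNReal.ofReal_one, add_mul, one_mul]
      · rw [indicator_of_notMem hr1, indicator_of_notMem hr1, zero_add, zero_add]
    calc _ ≤ ENNReal.ofReal ((2 * j + 1 : ℕ) * r ^ (2 * j)) * ∫⁻ ξ : ℝ, (ENNReal.ofReal
          ((r ^ (l + 1))⁻¹ ^ 2 * (3 * C ^ 2 * (1 + r) ^ (2 * s + (2 * j + 1 : ℕ)))) * G r) *
          ENNReal.ofReal ((1 + (ξ / r) ^ 2)⁻¹) := mul_le_mul' le_rfl (lintegral_mono h1)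
      _ = ENNReal.ofReal (3 * C ^ 2 * Real.pi * ((2 * j + 1 : ℕ) * r ^ (2 * j) *
          ((r ^ (l + 1))⁻¹ ^ 2 * ((1 + r) ^ (2 * s + (2 * j + 1 : ℕ)) * r)))) * G r := by
          rw [lintegral_const_mul' _ _ (by finiteness), lintegral_inv_one_add_div_sq hr,
            mul_right_comm _ (G r), ← ENNReal.ofReal_mul (by positivity), ← mul_assoc,
            ← ENNReal.ofReal_mul (by positivity)]
          congr 2
          ring
      _ ≤ ENNReal.ofReal (P * ((Iic (1 : ℝ)).indicator 1 r + w r)) * G r := by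
          have := Real.pi_pos
          refine mul_le_mul' (ENNReal.ofReal_le_ofReal ?_) le_rfl
          rw [hP, mul_assoc _ A]
          exact mul_le_mul_of_nonneg_left (hA r hr) (by positivity)
      _ = _ := by rw [ENNReal.ofReal_mul hP0, mul_assoc, h4]
  have hGm : Measurable G := by
    have : Continuous fun r : ℝ => lineFourier g (ε * r ^ (2 * j + 1)) := by fun_prop
    exact this.measurable.enorm.pow_const 2
  refine (setLIntegral_mono' measurableSet_Ioi hpt).trans ?_
  rw [lintegral_const_mul' _ _ ENNReal.ofReal_ne_top, lintegral_add_left (hGm.indicator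
    measurableSet_Iic), ENNReal.coe_mul, mul_assoc]
  change ENNReal.ofReal P * _ ≤ ENNReal.ofReal P * _
  rw [ENNReal.coe_add, ENNReal.coe_pow, add_mul]
  gcongr
  -- For `r ≤ 1` the frequency `εr^m` lies in `[-1,1]`, where the transform of the data is bounded
  -- by the Sobolev norm; the interval has length one.
  · calc _ ≤ ∫⁻ r in Ioi (0 : ℝ), (Iic (1 : ℝ)).indicator
          (fun _ => (c₁ * sobolevNorm σ g) ^ 2) r := by
          refine setLIntegral_mono' measurableSet_Ioi fun r hr => ?_
          have hr : 0 < r := hr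
          refine indicator_le_indicator' fun hr1 => ?_
          simp only [G]
          gcongr
          refine hc₁ g hg hs _ ?_
          rw [abs_mul, hε, one_mul, abs_of_pos (pow_pos hr _)]
          exact pow_le_one₀ hr.le hr1
      _ = _ := by
          rw [lintegral_indicator measurableSet_Iic, lintegral_const,
            Measure.restrict_restrict measurableSet_Iic, Measure.restrict_apply_univ,
            Iic_inter_Ioi, Real.volume_Ioc]
          simp [mul_pow]
  · exact hc₂ ε hε (lineFourier g)

/-! ### Superposition of the rays -/

/-- Serves both estimates. The parameter in `A` is frozen in the extension: it is the time `t` on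
the line and trivial on the plane. The factor `κ` carries the normalisation of the Fourier
inversion. -/
lemma exists_solution_extension {j : ℕ} {X Y A : Type*} [MeasureSpace X] {w : X → ℝ≥0∞}
    {e : X → Y → ℂ} {U : Set Y} (hw : Measurable w) (he : ∀ y, AEStronglyMeasurable fun q => e q y)
    (he1 : ∀ q y, ‖e q y‖ ≤ 1) (N : ℕ → (ℝ → ℂ) → ℝ≥0∞) (κ : ℂ) (pt : A → Y → ℝ × ℝ)
    (hray : ∀ l < j, ∀ (ρ : ℂ) (ε : ℝ), 0 < ρ.im → |ε| = 1 → ∃ c : ℝ≥0, ∀ g : ℝ → ℂ,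
      ContDiff ℝ ∞ g → tsupport g ⊆ Icc 0 2 → ∀ a, HasExtension w e U
        (fun y => κ * rayWave j ρ ε (2 * j - l) g (pt a y).1 (pt a y).2) (c * N l g)) :
    ∃ c : ℝ≥0, ∀ h : Fin j → ℝ → ℂ, IsBoundaryData h → ∀ a, HasExtension w e U
      (fun y => κ * reducedSolution h (pt a y).1 (pt a y).2) (c * ∑ l : Fin j, N l (h l)) := by
  have hterm : ∀ p ∈ Finset.Icc 1 j, ∀ l : Fin j, ∃ c : ℝ≥0, ∀ h : Fin j → ℝ → ℂ,
      IsBoundaryData h → ∀ a, HasExtension w e U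
        (fun y => κ * (fokasCoeff j p l *
          ((Complex.I * rot j (2 * p - 1)) ^ (2 * j - (l : ℕ)) * rot j (2 * p - 1) *
            rayWave j (rot j (2 * p - 1)) (-1) (2 * j - (l : ℕ)) (h l) (pt a y).1 (pt a y).2 -
          (Complex.I * rot j (2 * p)) ^ (2 * j - (l : ℕ)) * rot j (2 * p) *
            rayWave j (rot j (2 * p)) 1 (2 * j - (l : ℕ)) (h l) (pt a y).1 (pt a y).2)))
        (c * ∑ l : Fin j, N l (h l)) := by
    intro p hp l
    obtain ⟨c₁, hc₁⟩ := hray l l.2 _ (-1) (rot_odd_im_pos hp) (by simp)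
    obtain ⟨c₂, hc₂⟩ := hray l l.2 _ 1 (rot_even_im_pos hp) (by simp)
    set β₁ : ℂ := fokasCoeff j p l *
      ((Complex.I * rot j (2 * p - 1)) ^ (2 * j - (l : ℕ)) * rot j (2 * p - 1)) with hβ₁
    set β₂ : ℂ := -(fokasCoeff j p l *
      ((Complex.I * rot j (2 * p)) ^ (2 * j - (l : ℕ)) * rot j (2 * p))) with hβ₂
    refine ⟨‖β₁‖₊ * c₁ + ‖β₂‖₊ * c₂, fun h hh a => ?_⟩
    have key := ((hc₁ (h l) (hh l).1 (hh l).2 a).const_mul β₁).add hw he he1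
      ((hc₂ (h l) (hh l).1 (hh l).2 a).const_mul β₂)
    have hfun : ∀ y, κ * (fokasCoeff j p l *
          ((Complex.I * rot j (2 * p - 1)) ^ (2 * j - (l : ℕ)) * rot j (2 * p - 1) *
            rayWave j (rot j (2 * p - 1)) (-1) (2 * j - (l : ℕ)) (h l) (pt a y).1 (pt a y).2 -
          (Complex.I * rot j (2 * p)) ^ (2 * j - (l : ℕ)) * rot j (2 * p) *
            rayWave j (rot j (2 * p)) 1 (2 * j - (l : ℕ)) (h l) (pt a y).1 (pt a y).2)) =
        β₁ * (κ * rayWave j (rot j (2 * p - 1)) (-1) (2 * j - (l : ℕ)) (h l)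
          (pt a y).1 (pt a y).2) +
        β₂ * (κ * rayWave j (rot j (2 * p)) 1 (2 * j - (l : ℕ)) (h l)
          (pt a y).1 (pt a y).2) := by
      intro y
      rw [hβ₁, hβ₂]
      ring
    simp only [hfun]
    refine key.mono ?_
    have hN : N l (h l) ≤ ∑ l : Fin j, N l (h l) :=
      Finset.single_le_sum (f := fun l : Fin j => N l (h l)) (fun _ _ => zero_le)
        (Finset.mem_univ l)
    rw [← mul_assoc, ← mul_assoc, ← add_mul]
    push_cast
    exact mul_le_mul' le_rfl hN
  choose! c hc using hterm
  refine ⟨∑ p ∈ Finset.Icc 1 j, ∑ l : Fin j, c p l, fun h hh a => ?_⟩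
  have hsum := HasExtension.sum hw he he1 (Finset.Icc 1 j) fun p hp =>
    HasExtension.sum hw he he1 Finset.univ fun l _ => hc p hp l h hh a
  have hfun : ∀ y, κ * reducedSolution h (pt a y).1 (pt a y).2 =
      ∑ p ∈ Finset.Icc 1 j, ∑ l : Fin j, κ * (fokasCoeff j p l *
          ((Complex.I * rot j (2 * p - 1)) ^ (2 * j - (l : ℕ)) * rot j (2 * p - 1) *
            rayWave j (rot j (2 * p - 1)) (-1) (2 * j - (l : ℕ)) (h l) (pt a y).1 (pt a y).2 -
          (Complex.I * rot j (2 * p)) ^ (2 * j - (l : ℕ)) * rot j (2 * p) *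
            rayWave j (rot j (2 * p)) 1 (2 * j - (l : ℕ)) (h l) (pt a y).1 (pt a y).2)) := by
    intro y
    rw [reducedSolution_eq hh]
    unfold solutionDeriv
    simp only [Finset.mul_sum, add_zero]
  simp only [hfun]
  refine hsum.mono (le_of_eq ?_)
  push_cast
  simp only [Finset.sum_mul]

/-! ### The two estimates for the solution -/

theorem hadamard_estimate {j : ℕ} (s : ℝ) : ∃ c : ℝ≥0, ∀ h : Fin j → ℝ → ℂ, IsBoundaryData h →
    (⨆ t : ℝ, halfLineSobolevNorm s (fun x => reducedSolution h x t)) ≤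
      c * ∑ l : Fin j, sobolevNorm ((s + j - (l : ℕ)) / ((2 * j + 1 : ℕ) : ℝ)) (h l) := by
  obtain ⟨c, hc⟩ := exists_solution_extension (j := j) (U := Ioi (0 : ℝ))
    (measurable_lineWeight s) (e := linePhase)
    (fun x => Continuous.aestronglyMeasurable (by unfold linePhase; fun_prop))
    (fun q y => (norm_linePhase q y).le)
    (fun l => sobolevNorm ((s + j - l) / (2 * j + 1 : ℕ))) (2 * (Real.pi : ℂ))
    (fun (t x : ℝ) => (x, t))
    (fun l hl ρ ε hρ hε => exists_rayWave_line_extension hl s hρ hε)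
  exact ⟨c, fun h hh => iSup_le fun t => halfLineSobolevNorm_le (hc h hh t)⟩

theorem bourgain_estimate {j : ℕ} {s b α : ℝ} (hb : b < 1 / 2) (hα : 0 < α) (T : ℝ) :
    ∃ c : ℝ≥0, ∀ h : Fin j → ℝ → ℂ, IsBoundaryData h →
      bourgainRestrictionNorm (2 * j + 1) s b α T (reducedSolution h) ≤
        c * ∑ l : Fin j, sobolevNorm ((s + j - (l : ℕ)) / ((2 * j + 1 : ℕ) : ℝ)) (h l) := by
  obtain ⟨c, hc⟩ := exists_solution_extension (j := j) (A := Unit) (U := Ioi (0 : ℝ) ×ˢ Ioo 0 T)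
    (measurable_planeWeight (2 * j + 1) s b α) (e := planePhase)
    (fun y => Continuous.aestronglyMeasurable (by unfold planePhase; fun_prop))
    (fun q y => (norm_planePhase q y).le)
    (fun l => sobolevNorm ((s + j - l) / (2 * j + 1 : ℕ)))
    (2 * (Real.pi : ℂ) * (2 * j + 1 : ℕ)) (fun _ y => y)
    (fun l hl ρ ε hρ hε => by
      obtain ⟨c, hc⟩ := exists_rayWave_plane_extension (s := s) hl hb hα hρ hε T
      exact ⟨c, fun g hg hs _ => hc g hg hs⟩)
  -- Rescales the ray normalisation `2πm` to the factor `(2π)²` of Fourier inversion on the plane.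
  set β : ℂ := 2 * (Real.pi : ℂ) / (2 * j + 1 : ℕ) with hβ
  have hm : ((2 * j + 1 : ℕ) : ℂ) ≠ 0 := Nat.cast_ne_zero.2 (by omega)
  refine ⟨‖β‖₊ * c, fun h hh => bourgainRestrictionNorm_le ?_⟩
  have key := (hc h hh ()).const_mul β
  have hfun : ∀ y : ℝ × ℝ, β * (2 * (Real.pi : ℂ) * (2 * j + 1 : ℕ) * reducedSolution h y.1 y.2) =
      (2 * (Real.pi : ℂ)) ^ 2 * reducedSolution h y.1 y.2 := by
    intro y
    rw [hβ]
    field_simp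
  simp only [hfun] at key
  refine key.mono (le_of_eq ?_)
  rw [ENNReal.coe_mul, mul_assoc]
  rfl

end KdVm

end

theorem theorem2p1 (j : ℕ) (hj : 1 ≤ j) :
    (∀ h : Fin j → ℝ → ℂ, KdVm.IsBoundaryData h →
      KdVm.IsReducedSolution h (KdVm.reducedSolution h)) ∧
    (∀ s : ℝ, 0 ≤ s → ∃ c : ℝ≥0, ∀ h : Fin j → ℝ → ℂ, KdVm.IsBoundaryData h →
      (⨆ t : ℝ, KdVm.halfLineSobolevNorm s (fun x => KdVm.reducedSolution h x t)) ≤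
        c * ∑ l : Fin j,
          KdVm.sobolevNorm ((s + j - (l : ℕ)) / ((2 * j + 1 : ℕ) : ℝ)) (h l)) ∧
    (∀ s b α : ℝ, -(j : ℝ) - 1 / 2 < s → 0 ≤ b → b < 1 / 2 → 1 / 2 < α →
      α ≤ 1 / 2 + (s + j + 1 / 2) / ((2 * j + 1 : ℕ) : ℝ) →
      ∃ c : ℝ≥0, ∀ h : Fin j → ℝ → ℂ, KdVm.IsBoundaryData h →
        KdVm.bourgainRestrictionNorm (2 * j + 1) s b α 2 (KdVm.reducedSolution h) ≤
          c * ∑ l : Fin j,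
            KdVm.sobolevNorm ((s + j - (l : ℕ)) / ((2 * j + 1 : ℕ) : ℝ)) (h l)) :=
  ⟨fun _ hh => KdVm.isReducedSolution hh, fun s _ => KdVm.hadamard_estimate s,
    fun _ _ _ _ _ hb hα _ => KdVm.bourgain_estimate hb (by linarith) 2⟩
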